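/- Let $M$ be a compact orientable smooth $n$-dimensional manifold (without boundary) with a smooth action of the circle group $S^1=\mathrm{U}(1)$. Let $N=M\times S^1$ with the diagonal circle action $g\cdot(p,z)=(g\cdot p,\,gz)$, let $w$ be the vector field on $N$ generating this action, i.e. $w(q)=\frac{d}{dt}\big|_{t=0}e^{it}\cdot q$, and let $D=d-\iota_w$ be the corresponding equivariant differential on the (real, inhomogeneous) smooth differential forms $\Omega^\bullet(N)$. Let $\varphi \bmod 2\pi$ be the angular coordinate on the factor $S^1$, let $d\varphi$ be the corresponding $1$-form on $N$, and let $u=d/d\varphi$ be the corresponding vector field on $N$. Orient $N$, and let the integral over $N$ of an inhomogeneous form be the integral of its component of degree $n+1$. **Lemma.** Let $\alpha\in\Omega^\bullet(N)$ be an equivariantly closed form, $D\alpha=0$, with $\iota_u\alpha=0$ (that is, $\alpha$ does not contain $d\varphi$). Let $V$ be a circle-invariant smooth $1$-form on $N$ such that $\iota_uV=0$ and $\iota_uDV=0$. Then for all $s\in\mathbb R$ $$\int_N d\varphi\wedge\alpha=\int_N d\varphi\wedge\alpha\wedge e^{-s\,DV},$$ where $e^{-s\,DV}=\sum_{j\ge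 0}\frac{(-s)^j}{j!}(DV)^{j}$, with powers taken for the exterior product. -/

import Mathlib

open scoped Manifold ContDiff Topology

noncomputable section

namespace EquivForms

/-! ### Exterior algebra of one tangent space -/

section Pointwise

variable {E : Type*} [NormedAddCommGroup E] [NormedSpace ℝ E]

/-- The exterior product of a `k`-covector and an `l`-covector, as an `m`-covector, `m = k + l`:
the alternating sum over `(k, l)`-shuffles of the products `f (..) * g (..)`
(no further normalising factor). -/
def wedge {k l m : ℕ} (h : k + l = m) (f : E [⋀^Fin k]→L[ℝ] ℝ) (g : E [⋀^Fin l]→L[ℝ] ℝ) :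
    E [⋀^Fin m]→L[ℝ] ℝ :=
  { ((LinearMap.mul' ℝ ℝ).compAlternatingMap
      (f.toAlternatingMap.domCoprod g.toAlternatingMap)).domDomCongr
        (finSumFinEquiv.trans (finCongr h)) with
    cont := by
      have hf := f.cont
      have hg := g.cont
      change Continuous fun v : Fin m → E => LinearMap.mul' ℝ ℝ
        ((f.toAlternatingMap.domCoprod g.toAlternatingMap)
          fun i => v ((finSumFinEquiv.trans (finCongr h)) i))
      simp only [AlternatingMap.domCoprod_apply, _root_.sum_apply, map_sum]
      refine continuous_finsetSum _ fun σ _ => ?_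
      induction σ using Quotient.inductionOn' with
      | h σ =>
        rw [AlternatingMap.domCoprod.summand_mk'']
        simp only [_root_.smul_apply, MultilinearMap.domDomCongr_apply,
          MultilinearMap.domCoprod_apply]
        rcases Int.units_eq_one_or (Equiv.Perm.sign σ) with h1 | h1
        · rw [h1]
          simp only [one_smul, LinearMap.mul'_apply]
          refine Continuous.mul (hf.comp ?_) (hg.comp ?_) <;> fun_prop
        · rw [h1]
          simp only [Units.neg_smul, one_smul, map_neg, LinearMap.mul'_apply]
          refine (Continuous.mul (hf.comp ?_) (hg.comp ?_)).neg <;> fun_prop }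

end Pointwise

/-! ### Differential forms on a manifold without boundary

`X` is a manifold modelled on the finite-dimensional real space `E` through `I`. In Mathlib the
tangent space `TangentSpace I x` is, by definition, a copy of `E`. -/

/-- A (not necessarily smooth) real differential form of degree `k` on `X`: a `k`-covector on the
tangent space (which is a copy of `E`) at each point. -/
abbrev DForm (E : Type*) [NormedAddCommGroup E] [NormedSpace ℝ E] (X : Type*) (k : ℕ) :=
  X → E [⋀^Fin k]→L[ℝ] ℝ

/-- A (not necessarily smooth) real inhomogeneous differential form: one component in each
degree. The components of degree larger than the dimension are automatically zero. -/
abbrev InhomForm (E : Type*) [NormedAddCommGroup E] [NormedSpace ℝ E] (X : Type*) :=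
  (k : ℕ) → DForm E X k

section Algebra

variable {E : Type*} [NormedAddCommGroup E] [NormedSpace ℝ E] {X : Type*}

/-- A form of degree `k`, regarded as an inhomogeneous form. -/
def ofDegree {k : ℕ} (η : DForm E X k) : InhomForm E X := Pi.single k η

/-- The exterior product of inhomogeneous forms. -/
def wedgeForm (α β : InhomForm E X) : InhomForm E X := fun m x =>
  ∑ p ∈ (Finset.HasAntidiagonal.antidiagonal m).attach,
    wedge (Finset.HasAntidiagonal.mem_antidiagonal.1 p.2) (α p.1.1 x) (β p.1.2 x)

/-- The constant function `1`, as an inhomogeneous form. -/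
def oneForm : InhomForm E X :=
  ofDegree (k := 0) fun _ => ContinuousAlternatingMap.constOfIsEmpty ℝ E (Fin 0) 1

/-- Powers with respect to the exterior product. -/
def wedgePow (η : InhomForm E X) : ℕ → InhomForm E X
  | 0 => oneForm
  | j + 1 => wedgeForm η (wedgePow η j)

/-- The exponential `e^η = ∑ η^j / j!` in the algebra of inhomogeneous forms. The series is taken
in each degree at each point, where it is an (always convergent) series in a finite-dimensional
space. -/
def expForm (η : InhomForm E X) : InhomForm E X := fun k x =>
  ∑' j : ℕ, ((j.factorial : ℝ)⁻¹) • wedgePow η j k x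

/-- The interior product `ι_v` of a vector field `v` with an inhomogeneous form. -/
def interiorProd (v : X → E) (α : InhomForm E X) : InhomForm E X := fun k x =>
  (α (k + 1) x).curryLeft (v x)

end Algebra

section Calculus

variable {E : Type*} [NormedAddCommGroup E] [NormedSpace ℝ E]
  {H : Type*} [TopologicalSpace H] (I : ModelWithCorners ℝ E H)
  {X : Type*} [TopologicalSpace X] [ChartedSpace H X]

/-- The pullback of a form under `f : X → X`. -/
def pullback {k : ℕ} (f : X → X) (η : DForm E X k) : DForm E X k := fun x =>
  (η (f x)).compContinuousLinearMap (mfderiv I I f x : E →L[ℝ] E)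

/-- The expression of a form in the preferred chart around `x₀`, that is, its pullback under the
inverse of that chart. Only its values on the target of the chart are meaningful. -/
def inChart {k : ℕ} (x₀ : X) (η : DForm E X k) : E → E [⋀^Fin k]→L[ℝ] ℝ := fun y =>
  (η ((extChartAt I x₀).symm y)).compContinuousLinearMap
    (mfderiv 𝓘(ℝ, E) I (extChartAt I x₀).symm y : E →L[ℝ] E)

/-- A form is smooth if it is smooth in the charts. -/
def IsSmooth {k : ℕ} (η : DForm E X k) : Prop :=
  ∀ x₀ : X, ContDiffOn ℝ ∞ (inChart I x₀ η) (extChartAt I x₀).target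

/-- The exterior derivative of a form of degree `k`, computed at `x` in the preferred chart
around `x`. -/
def extD {k : ℕ} (η : DForm E X k) : DForm E X (k + 1) := fun x =>
  (extDeriv (inChart I x η) (extChartAt I x x)).compContinuousLinearMap
    (mfderiv I 𝓘(ℝ, E) (extChartAt I x) x : E →L[ℝ] E)

/-- The exterior derivative of an inhomogeneous form. -/
def extDForm (α : InhomForm E X) : InhomForm E X
  | 0 => 0
  | k + 1 => extD I (α k)

/-- The equivariant differential `D = d - ι_v`. -/
def equivD (v : X → E) (α : InhomForm E X) : InhomForm E X :=
  extDForm I α - interiorProd v α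

/-- A volume form on `X`: a smooth, nowhere vanishing form of top degree. -/
def IsVolumeForm (μ : DForm E X (Module.finrank ℝ E)) : Prop :=
  IsSmooth I μ ∧ ∀ x, μ x ≠ 0

variable (X) in
/-- `X` is orientable: it carries a volume form. -/
def IsOrientable : Prop := ∃ μ : DForm E X (Module.finrank ℝ E), IsVolumeForm I μ

variable (X) in
/-- A smooth partition of unity on `X`, subordinate to the domains of the charts. -/
def chartPartition [FiniteDimensional ℝ E] [IsManifold I ∞ X] [T2Space X] [CompactSpace X] :
    SmoothPartitionOfUnity X I X Set.univ :=
  (SmoothPartitionOfUnity.exists_isSubordinate_chartAt_source I X).choose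

/-- The integral over the compact manifold `X`, with the orientation in which the volume form `μ`
is positive, of (the component of top degree of) an inhomogeneous form `η`: it is cut by a
partition of unity into pieces supported in charts, and each piece `f dy₁ ∧ ⋯ ∧ dy_m` is
integrated in the coordinates `y` of its chart, with the sign `±1` according to whether these
coordinates are positively oriented. The coordinates, and the Lebesgue measure, are those of
some basis of `E`. -/
def integral [FiniteDimensional ℝ E] [MeasurableSpace E] [BorelSpace E]
    [IsManifold I ∞ X] [T2Space X] [CompactSpace X]
    (μ : DForm E X (Module.finrank ℝ E)) (η : InhomForm E X) : ℝ :=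
  ∑ᶠ i : X, ∫ y in (extChartAt I i).target,
    chartPartition I X i ((extChartAt I i).symm y) *
      Real.sign (inChart I i μ y (Module.finBasis ℝ E)) *
      inChart I i (η (Module.finrank ℝ E)) y (Module.finBasis ℝ E)
    ∂(Module.finBasis ℝ E).addHaar

end Calculus

/-! ### Circle actions -/

section Action

variable {E : Type*} [NormedAddCommGroup E] [NormedSpace ℝ E]
  {H : Type*} [TopologicalSpace H] (I : ModelWithCorners ℝ E H)
  (X : Type*) [TopologicalSpace X] [ChartedSpace H X]

/-- The vector field of a circle action: at `x`, the velocity at `t = 0` of `t ↦ e^{it} • x`. -/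
def actionField [SMul Circle X] : X → E := fun x =>
  (mfderiv 𝓘(ℝ, ℝ) I (fun t : ℝ => Circle.exp t • x) 0 : ℝ →L[ℝ] E) 1

variable {X} in
/-- Invariance of a form under a circle action. -/
def IsInvariant [SMul Circle X] {k : ℕ} (η : DForm E X k) : Prop :=
  ∀ g : Circle, pullback I (fun x : X => g • x) η = η

end Action

/-! ### The product `N = M × S¹` -/

section Product

variable (n : ℕ)

/-- The model space of `M × S¹`, where `M` has dimension `n`. -/
abbrev ProdSpace : Type := EuclideanSpace ℝ (Fin n) × EuclideanSpace ℝ (Fin 1)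

/-- The model with corners of `M × S¹`, where `M` has dimension `n`. -/
abbrev prodModel : ModelWithCorners ℝ (ProdSpace n)
    (ModelProd (EuclideanSpace ℝ (Fin n)) (EuclideanSpace ℝ (Fin 1))) :=
  (𝓡 n).prod (𝓡 1)

variable (M : Type*) [TopologicalSpace M] [ChartedSpace (EuclideanSpace ℝ (Fin n)) M]

/-- The vector field `u = d/dφ` on `M × S¹`. -/
def angleField : M × Circle → ProdSpace n := fun q =>
  (mfderiv 𝓘(ℝ, ℝ) (prodModel n)
    (fun t : ℝ => ((q.1, Circle.exp t * q.2) : M × Circle)) 0 : ℝ →L[ℝ] ProdSpace n) 1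

/-- The vector field on `M × S¹` of the diagonal circle action
`g • (p, z) = (g • p, g z)`. -/
def diagField [MulAction Circle M] : M × Circle → ProdSpace n :=
  actionField (prodModel n) (M × Circle)

/-- The `1`-form `dφ` on `M × S¹`: the imaginary part of `z⁻¹ dz`, where `z = e^{iφ}` is the
complex coordinate on the second factor. -/
def dAngle : DForm (ProdSpace n) (M × Circle) 1 := fun q =>
  ContinuousAlternatingMap.ofSubsingleton ℝ (ProdSpace n) ℝ (0 : Fin 1)
    (Complex.imCLM ∘L ContinuousLinearMap.mul ℝ ℂ (q.2 : ℂ)⁻¹ ∘L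
      (mfderiv (prodModel n) 𝓘(ℝ, ℂ) (fun r : M × Circle => (r.2 : ℂ)) q :
        ProdSpace n →L[ℝ] ℂ))

end Product

end EquivForms

end

noncomputable section

set_option linter.unusedSectionVars false

namespace EquivForms

/-! ### Permutations of `Fin (m + 1)` and tuples with one inserted entry. -/

section PermSum

/-! Write `DV = f + η` with `f = -ι_w V` and `η = dV`. Since `V` is invariant, Cartan's formula
gives `d ι_w V + ι_w dV = 0`, that is `df = ι_w η`, so `f + η` is equivariantly closed. The function
`g(x) = (e^{-sx} - 1)/x` extends smoothly across `0`. It can be applied to `f + η` through its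
Taylor expansion at `f`, which is a finite sum because `η` is nilpotent: `P = ∑ g_m(f) η^m` with
`g_m = g^{(m)}/m!`. Then `e^{-s DV} = 1 + DV ∧ P` (`expForm_smul_ofFun_add_eq`), and `DP = 0`,
because `d(g_m(f)) = (m+1) g_{m+1}(f) ι_w η` makes the sum telescope (`equivD_polyForm`).

Hence `α ∧ (e^{-s DV} - 1) = DC`, where `C = α' ∧ V ∧ P` and `α'` is `α` with the sign `(-1)^k` in
degree `k`. The forms `α`, `V` and `P` are annihilated by `ι_u`, and so is `C`. As `dφ` is closed
and `ι_w dφ = 1`, one has `D(dφ ∧ C) = -C - dφ ∧ DC`. Now look at the top degree. `C` has no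
component there because it does not contain `dφ` (`apply_finrank_eq_zero_of_interiorProd`), and an
interior product never has one, so `D` acts as `d`. The top component of `dφ ∧ α ∧ (e^{-s DV} - 1)`
is therefore exact, and its integral vanishes by Stokes' theorem (`integral_extDForm_eq_zero`). No
derivative in `s` is taken. The argument is assembled in `integral_wedgeForm_expForm`, for a general
closed `1`-form with value `1` on both `u` and `w`.

The calculus of forms rests on `curryLeft_wedge`: the interior product is an antiderivation. A form
of positive degree is determined by its interior products, so graded commutativity, associativity
and the Leibniz rule follow by induction on the degree. The passage to manifolds is `inChart_extD`,
and Cartan's formula is `extD_curryLeft_add_curryLeft_extD`. -/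

/-- A sum over the permutations of `Fin (m + 1)`, split according to the preimage of `0`. -/
theorem sum_perm_fin_succ {A : Type*} [AddCommMonoid A] {m : ℕ}
    (F : Equiv.Perm (Fin (m + 1)) → A) :
    ∑ σ, F σ = ∑ p : Fin (m + 1), ∑ e : Equiv.Perm (Fin m),
      F (Equiv.Perm.decomposeFin.symm (0, e) * p.cycleRange) := by
  rw [← Fintype.sum_prod_type']
  symm
  refine Fintype.sum_bijective
    (fun q : Fin (m + 1) × Equiv.Perm (Fin m) =>
      Equiv.Perm.decomposeFin.symm (0, q.2) * q.1.cycleRange) ?_ _ _ (fun _ => rfl)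
  rw [Fintype.bijective_iff_injective_and_card]
  constructor
  · rintro ⟨p, e⟩ ⟨p', e'⟩ h
    dsimp only at h
    -- `p` is the preimage of `0`: `p.cycleRange` sends `p` to `0`, and the other factor fixes `0`.
    -- Surjectivity then follows by counting, `(m + 1) * m! = (m + 1)!`.
    have h1 : p = p' := by
      have h2 := congrArg (fun σ : Equiv.Perm (Fin (m + 1)) => σ p) h
      simp only [Equiv.Perm.mul_apply, Fin.cycleRange_self,
        Equiv.Perm.decomposeFin_symm_apply_zero] at h2
      have h3 : p'.cycleRange p = 0 := by
        apply (Equiv.Perm.decomposeFin.symm (0, e')).injective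
        rw [← h2, Equiv.Perm.decomposeFin_symm_apply_zero]
      rw [← Fin.cycleRange_self p'] at h3
      exact p'.cycleRange.injective h3
    subst h1
    have h4 := Equiv.Perm.decomposeFin.symm.injective (mul_right_cancel h)
    rw [Prod.mk.injEq] at h4
    rw [h4.2]
  · rw [Fintype.card_prod, Fintype.card_fin, Fintype.card_perm, Fintype.card_perm,
      Fintype.card_fin, Fintype.card_fin, Nat.factorial_succ]

/-- This is the reason for splitting permutations this way: the factor `p.cycleRange`, of sign
`(-1)^p`, moves `x` from the front to slot `p`, while `e` permutes only the other entries. -/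
theorem cons_comp_decomposeFin_mul_cycleRange {A : Type*} {m : ℕ} (x : A) (u : Fin m → A)
    (p : Fin (m + 1)) (e : Equiv.Perm (Fin m)) (j : Fin (m + 1)) :
    (Fin.cons x u : Fin (m + 1) → A)
      ((Equiv.Perm.decomposeFin.symm (0, e) * p.cycleRange : Equiv.Perm (Fin (m + 1))) j) =
      (p.insertNth x (u ∘ e) : Fin (m + 1) → A) j := by
  rw [← Fin.cons_apply_cycleRange, Equiv.Perm.mul_apply]
  cases p.cycleRange j using Fin.cases with
  | zero => simp
  | succ i => simp

/-- This and the next three lemmas cut a tuple into its first `k` and last `l` slots. The block that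
receives `x` sees an insertion; the other block sees only entries of `u`. -/
theorem insertNth_castAdd_left {A : Type*} {k l m : ℕ} (h : k + 1 + l = m + 1) (h' : k + l = m)
    (x : A) (u : Fin m → A) (q : Fin (k + 1)) :
    (fun i : Fin (k + 1) => (Fin.insertNth (Fin.cast h (Fin.castAdd l q)) x u :
        Fin (m + 1) → A) (Fin.cast h (Fin.castAdd l i))) =
      Fin.insertNth q x fun i => u (Fin.cast h' (Fin.castAdd l i)) := by
  rw [Fin.eq_insertNth_iff]
  refine ⟨by simp, ?_⟩
  ext i
  rw [Fin.removeNth_apply]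
  have : Fin.cast h (Fin.castAdd l (q.succAbove i)) =
      (Fin.cast h (Fin.castAdd l q)).succAbove (Fin.cast h' (Fin.castAdd l i)) := by
    ext
    simp only [Fin.succAbove, Fin.lt_def, Fin.val_cast, Fin.val_castAdd, Fin.val_castSucc]
    split_ifs <;> simp
  rw [this, Fin.insertNth_apply_succAbove]

theorem insertNth_castAdd_right {A : Type*} {k l m : ℕ} (h : k + 1 + l = m + 1) (h' : k + l = m)
    (x : A) (u : Fin m → A) (q : Fin (k + 1)) :
    (fun i : Fin l => (Fin.insertNth (Fin.cast h (Fin.castAdd l q)) x u :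
        Fin (m + 1) → A) (Fin.cast h (Fin.natAdd (k + 1) i))) =
      fun i => u (Fin.cast h' (Fin.natAdd k i)) := by
  ext i
  have : Fin.cast h (Fin.natAdd (k + 1) i) =
      (Fin.cast h (Fin.castAdd l q)).succAbove (Fin.cast h' (Fin.natAdd k i)) := by
    ext
    simp only [Fin.succAbove, Fin.lt_def, Fin.val_cast, Fin.val_castAdd, Fin.val_castSucc,
      Fin.val_natAdd]
    have := q.2
    split_ifs <;> (simp; try omega)
  rw [this, Fin.insertNth_apply_succAbove]

theorem insertNth_natAdd_right {A : Type*} {k l m : ℕ} (h : k + (l + 1) = m + 1) (h' : k + l = m)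
    (x : A) (u : Fin m → A) (q : Fin (l + 1)) :
    (fun i : Fin (l + 1) => (Fin.insertNth (Fin.cast h (Fin.natAdd k q)) x u :
        Fin (m + 1) → A) (Fin.cast h (Fin.natAdd k i))) =
      Fin.insertNth q x fun i => u (Fin.cast h' (Fin.natAdd k i)) := by
  rw [Fin.eq_insertNth_iff]
  refine ⟨by simp, ?_⟩
  ext i
  rw [Fin.removeNth_apply]
  have : Fin.cast h (Fin.natAdd k (q.succAbove i)) =
      (Fin.cast h (Fin.natAdd k q)).succAbove (Fin.cast h' (Fin.natAdd k i)) := by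
    ext
    simp only [Fin.succAbove, Fin.lt_def, Fin.val_cast, Fin.val_natAdd, Fin.val_castSucc]
    split_ifs <;> (simp; try omega)
  rw [this, Fin.insertNth_apply_succAbove]

theorem insertNth_natAdd_left {A : Type*} {k l m : ℕ} (h : k + (l + 1) = m + 1) (h' : k + l = m)
    (x : A) (u : Fin m → A) (q : Fin (l + 1)) :
    (fun i : Fin k => (Fin.insertNth (Fin.cast h (Fin.natAdd k q)) x u :
        Fin (m + 1) → A) (Fin.cast h (Fin.castAdd (l + 1) i))) =
      fun i => u (Fin.cast h' (Fin.castAdd l i)) := by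
  ext i
  have : Fin.cast h (Fin.castAdd (l + 1) i) =
      (Fin.cast h (Fin.natAdd k q)).succAbove (Fin.cast h' (Fin.castAdd l i)) := by
    ext
    simp only [Fin.succAbove, Fin.lt_def, Fin.val_cast, Fin.val_castAdd, Fin.val_castSucc,
      Fin.val_natAdd]
    have := i.2
    split_ifs <;> (simp; try omega)
  rw [this, Fin.insertNth_apply_succAbove]

end PermSum

/-! ### Exterior product of covectors: permutation formula and interior product. -/

section Pointwise

variable {E : Type*} [NormedAddCommGroup E] [NormedSpace ℝ E]

/-- The exterior product as a sum over all permutations. -/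
theorem factorial_mul_wedge_apply {k l m : ℕ} (h : k + l = m) (f : E [⋀^Fin k]→L[ℝ] ℝ)
    (g : E [⋀^Fin l]→L[ℝ] ℝ) (v : Fin m → E) :
    ((k.factorial * l.factorial : ℕ) : ℝ) * wedge h f g v =
      ∑ σ : Equiv.Perm (Fin m), ((Equiv.Perm.sign σ : ℤ) : ℝ) *
        (f (fun i => v (σ (Fin.cast h (Fin.castAdd l i)))) *
          g (fun j => v (σ (Fin.cast h (Fin.natAdd k j))))) := by
  subst h
  -- As `f` and `g` are already alternating, each shuffle class contributes `k! * l!` equal terms to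
  -- the sum over all permutations.
  have h1 := MultilinearMap.domCoprod_alternization_eq f.toAlternatingMap g.toAlternatingMap
  have h2 := congrArg (fun T => LinearMap.mul' ℝ ℝ (T fun i => v (finSumFinEquiv i))) h1
  simp only [Fintype.card_fin, ← Nat.cast_smul_eq_nsmul ℝ, AlternatingMap.smul_apply, map_smul,
    smul_eq_mul] at h2
  have h3 : wedge rfl f g v = LinearMap.mul' ℝ ℝ
      ((f.toAlternatingMap.domCoprod g.toAlternatingMap) fun i => v (finSumFinEquiv i)) := rfl
  rw [h3, ← h2, MultilinearMap.alternatization_apply, map_sum]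
  refine Fintype.sum_equiv (finSumFinEquiv.permCongr) _ _ fun σ => ?_
  rw [Equiv.Perm.sign_permCongr]
  simp only [Units.smul_def, ← Int.cast_smul_eq_zsmul ℝ, map_smul,
    MultilinearMap.domDomCongr_apply, MultilinearMap.domCoprod_apply, LinearMap.mul'_apply,
    smul_eq_mul]
  congr 2 <;> simp [Equiv.permCongr_apply]

/-- The slot to which `x` is moved lies either in the block of `f` or in that of `g`, whence the two
inner sums. In the second block the slot number, and so the sign exponent, is shifted by `k`. -/
theorem factorial_mul_wedge_cons {k l m : ℕ} (h : k + l = m + 1) (f : E [⋀^Fin k]→L[ℝ] ℝ)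
    (g : E [⋀^Fin l]→L[ℝ] ℝ) (x : E) (v : Fin m → E) :
    ((k.factorial * l.factorial : ℕ) : ℝ) * wedge h f g (Matrix.vecCons x v) =
      ∑ e : Equiv.Perm (Fin m), ((Equiv.Perm.sign e : ℤ) : ℝ) *
        ((∑ p : Fin k, (-1) ^ (p : ℕ) *
          (f (fun i => (Fin.insertNth (Fin.cast h (Fin.castAdd l p)) x (v ∘ e) :
              Fin (m + 1) → E) (Fin.cast h (Fin.castAdd l i))) *
            g (fun j => (Fin.insertNth (Fin.cast h (Fin.castAdd l p)) x (v ∘ e) :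
              Fin (m + 1) → E) (Fin.cast h (Fin.natAdd k j))))) +
        ∑ p : Fin l, (-1) ^ (k + (p : ℕ)) *
          (f (fun i => (Fin.insertNth (Fin.cast h (Fin.natAdd k p)) x (v ∘ e) :
              Fin (m + 1) → E) (Fin.cast h (Fin.castAdd l i))) *
            g (fun j => (Fin.insertNth (Fin.cast h (Fin.natAdd k p)) x (v ∘ e) :
              Fin (m + 1) → E) (Fin.cast h (Fin.natAdd k j))))) := by
  rw [factorial_mul_wedge_apply, sum_perm_fin_succ, Finset.sum_comm]
  refine Finset.sum_congr rfl fun e _ => ?_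
  simp only [Matrix.vecCons, cons_comp_decomposeFin_mul_cycleRange]
  rw [← (finCongr h).sum_comp, Fin.sum_univ_add, mul_add, Finset.mul_sum, Finset.mul_sum]
  congr 1 <;> refine Finset.sum_congr rfl fun p _ => ?_ <;>
    simp [Equiv.Perm.decomposeFin.symm_sign] <;> ring

theorem neg_one_pow_mul_self (p : ℕ) : (-1 : ℝ) ^ p * (-1) ^ p = 1 := by
  rw [← mul_pow]; simp

/-- Moving `x` to the front of the arguments of `f` costs a second `(-1)^p`, so all `k + 1`
positions contribute equally. The factor `k + 1` turns `k!` into `(k + 1)!`. -/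
theorem sum_insertNth_left {k l m : ℕ} (h : k + 1 + l = m + 1) (h' : k + l = m)
    (f : E [⋀^Fin (k + 1)]→L[ℝ] ℝ) (g : E [⋀^Fin l]→L[ℝ] ℝ) (x : E) (u : Fin m → E) :
    ∑ p : Fin (k + 1), (-1) ^ (p : ℕ) *
      (f (fun i => (Fin.insertNth (Fin.cast h (Fin.castAdd l p)) x u :
          Fin (m + 1) → E) (Fin.cast h (Fin.castAdd l i))) *
        g (fun j => (Fin.insertNth (Fin.cast h (Fin.castAdd l p)) x u :
          Fin (m + 1) → E) (Fin.cast h (Fin.natAdd (k + 1) j)))) =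
      (k + 1) * (f.curryLeft x (fun i => u (Fin.cast h' (Fin.castAdd l i))) *
        g (fun j => u (Fin.cast h' (Fin.natAdd k j)))) := by
  have : ∀ p ∈ (Finset.univ : Finset (Fin (k + 1))), (-1) ^ (p : ℕ) *
      (f (fun i => (Fin.insertNth (Fin.cast h (Fin.castAdd l p)) x u :
          Fin (m + 1) → E) (Fin.cast h (Fin.castAdd l i))) *
        g (fun j => (Fin.insertNth (Fin.cast h (Fin.castAdd l p)) x u :
          Fin (m + 1) → E) (Fin.cast h (Fin.natAdd (k + 1) j)))) =
      f.curryLeft x (fun i => u (Fin.cast h' (Fin.castAdd l i))) *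
        g (fun j => u (Fin.cast h' (Fin.natAdd k j))) := by
    intro p _
    rw [insertNth_castAdd_left h h', insertNth_castAdd_right h h',
      ContinuousAlternatingMap.map_insertNth, ← Int.cast_smul_eq_zsmul ℝ, smul_eq_mul,
      Int.cast_pow, Int.cast_neg, Int.cast_one, ← mul_assoc, ← mul_assoc,
      neg_one_pow_mul_self, one_mul]
    rfl
  rw [Finset.sum_congr rfl this]
  simp

/-- Again the signs `(-1)^p` cancel, but `(-1)^k` remains from moving `x` past the arguments of `f`.
It is the sign in the antiderivation rule. -/
theorem sum_insertNth_right {k l m : ℕ} (h : k + (l + 1) = m + 1) (h' : k + l = m)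
    (f : E [⋀^Fin k]→L[ℝ] ℝ) (g : E [⋀^Fin (l + 1)]→L[ℝ] ℝ) (x : E) (u : Fin m → E) :
    ∑ p : Fin (l + 1), (-1) ^ (k + (p : ℕ)) *
      (f (fun i => (Fin.insertNth (Fin.cast h (Fin.natAdd k p)) x u :
          Fin (m + 1) → E) (Fin.cast h (Fin.castAdd (l + 1) i))) *
        g (fun j => (Fin.insertNth (Fin.cast h (Fin.natAdd k p)) x u :
          Fin (m + 1) → E) (Fin.cast h (Fin.natAdd k j)))) =
      (l + 1) * (-1) ^ k * (f (fun i => u (Fin.cast h' (Fin.castAdd l i))) *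
        g.curryLeft x (fun j => u (Fin.cast h' (Fin.natAdd k j)))) := by
  have : ∀ p ∈ (Finset.univ : Finset (Fin (l + 1))), (-1) ^ (k + (p : ℕ)) *
      (f (fun i => (Fin.insertNth (Fin.cast h (Fin.natAdd k p)) x u :
          Fin (m + 1) → E) (Fin.cast h (Fin.castAdd (l + 1) i))) *
        g (fun j => (Fin.insertNth (Fin.cast h (Fin.natAdd k p)) x u :
          Fin (m + 1) → E) (Fin.cast h (Fin.natAdd k j)))) =
      (-1) ^ k * (f (fun i => u (Fin.cast h' (Fin.castAdd l i))) *
        g.curryLeft x (fun j => u (Fin.cast h' (Fin.natAdd k j)))) := by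
    intro p _
    rw [insertNth_natAdd_left h h', insertNth_natAdd_right h h',
      ContinuousAlternatingMap.map_insertNth, ← Int.cast_smul_eq_zsmul ℝ, smul_eq_mul,
      Int.cast_pow, Int.cast_neg, Int.cast_one, pow_add,
      ContinuousAlternatingMap.curryLeft_apply_apply]
    linear_combination ((-1) ^ k * f (fun i => u (Fin.cast h' (Fin.castAdd l i))) *
        g (Matrix.vecCons x (fun j => u (Fin.cast h' (Fin.natAdd k j))))) *
          neg_one_pow_mul_self (p : ℕ)
  rw [Finset.sum_congr rfl this]
  simp [mul_assoc]

/-- The two terms record whether `x` is fed to `f` or to `g`. Both degrees are successors because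
`curryLeft` needs a slot to fill; in degree `0` one term disappears, and the next two lemmas treat
those cases. -/
theorem curryLeft_wedge {k l m : ℕ} (h : k + 1 + (l + 1) = m + 1) (h₁ : k + (l + 1) = m)
    (h₂ : k + 1 + l = m) (f : E [⋀^Fin (k + 1)]→L[ℝ] ℝ) (g : E [⋀^Fin (l + 1)]→L[ℝ] ℝ) (x : E) :
    (wedge h f g).curryLeft x =
      wedge h₁ (f.curryLeft x) g + (-1 : ℝ) ^ (k + 1) • wedge h₂ f (g.curryLeft x) := by
  ext v
  have h0 := factorial_mul_wedge_cons h f g x v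
  have hf := factorial_mul_wedge_apply h₁ (f.curryLeft x) g v
  have hg := factorial_mul_wedge_apply h₂ f (g.curryLeft x) v
  simp only [sum_insertNth_left h h₁, sum_insertNth_right h h₂] at h0
  have hne : (((k + 1).factorial * (l + 1).factorial : ℕ) : ℝ) ≠ 0 := by positivity
  refine mul_left_cancel₀ hne ?_
  rw [ContinuousAlternatingMap.curryLeft_apply_apply, h0]
  simp only [ContinuousAlternatingMap.add_apply, ContinuousAlternatingMap.smul_apply,
    smul_eq_mul, mul_add, Finset.sum_add_distrib]
  have e1 : (((k + 1).factorial * (l + 1).factorial : ℕ) : ℝ) =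
      (k + 1) * ((k.factorial * (l + 1).factorial : ℕ) : ℝ) := by
    rw [Nat.factorial_succ k]; push_cast; ring
  have e2 : (((k + 1).factorial * (l + 1).factorial : ℕ) : ℝ) =
      (l + 1) * (((k + 1).factorial * l.factorial : ℕ) : ℝ) := by
    rw [Nat.factorial_succ l]; push_cast; ring
  congr 1
  · rw [e1, mul_assoc, hf, Finset.mul_sum]
    exact Finset.sum_congr rfl fun _ _ => by simp only [Function.comp_apply]; ring
  · rw [e2, mul_assoc, mul_left_comm _ ((-1 : ℝ) ^ (k + 1)), hg, Finset.mul_sum, Finset.mul_sum]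
    exact Finset.sum_congr rfl fun _ _ => by simp only [Function.comp_apply]; ring

theorem curryLeft_wedge_zero_left {l m : ℕ} (h : 0 + (l + 1) = m + 1) (h₂ : 0 + l = m)
    (f : E [⋀^Fin 0]→L[ℝ] ℝ) (g : E [⋀^Fin (l + 1)]→L[ℝ] ℝ) (x : E) :
    (wedge h f g).curryLeft x = wedge h₂ f (g.curryLeft x) := by
  ext v
  have h0 := factorial_mul_wedge_cons h f g x v
  have hg := factorial_mul_wedge_apply h₂ f (g.curryLeft x) v
  simp only [sum_insertNth_right h h₂] at h0
  simp only [Finset.univ_eq_empty, Finset.sum_empty, zero_add] at h0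
  have hne : (((0).factorial * (l + 1).factorial : ℕ) : ℝ) ≠ 0 := by positivity
  refine mul_left_cancel₀ hne ?_
  rw [ContinuousAlternatingMap.curryLeft_apply_apply, h0]
  have e2 : (((0).factorial * (l + 1).factorial : ℕ) : ℝ) =
      (l + 1) * (((0).factorial * l.factorial : ℕ) : ℝ) := by
    rw [Nat.factorial_succ l]; push_cast; ring
  rw [e2, mul_assoc, hg, Finset.mul_sum]
  exact Finset.sum_congr rfl fun _ _ => by simp only [Function.comp_apply]; ring

theorem curryLeft_wedge_zero_right {k m : ℕ} (h : k + 1 + 0 = m + 1) (h₁ : k + 0 = m)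
    (f : E [⋀^Fin (k + 1)]→L[ℝ] ℝ) (g : E [⋀^Fin 0]→L[ℝ] ℝ) (x : E) :
    (wedge h f g).curryLeft x = wedge h₁ (f.curryLeft x) g := by
  ext v
  have h0 := factorial_mul_wedge_cons h f g x v
  have hf := factorial_mul_wedge_apply h₁ (f.curryLeft x) g v
  simp only [sum_insertNth_left h h₁, Finset.univ_eq_empty, Finset.sum_empty, add_zero] at h0
  have hne : (((k + 1).factorial * (0).factorial : ℕ) : ℝ) ≠ 0 := by positivity
  refine mul_left_cancel₀ hne ?_
  rw [ContinuousAlternatingMap.curryLeft_apply_apply, h0]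
  have e1 : (((k + 1).factorial * (0).factorial : ℕ) : ℝ) =
      (k + 1) * ((k.factorial * (0).factorial : ℕ) : ℝ) := by
    rw [Nat.factorial_succ k]; push_cast; ring
  rw [e1, mul_assoc, hf, Finset.mul_sum]
  exact Finset.sum_congr rfl fun _ _ => by simp only [Function.comp_apply]; ring

theorem wedge_zero_zero_apply (h : 0 + 0 = 0) (f g : E [⋀^Fin 0]→L[ℝ] ℝ) (v : Fin 0 → E) :
    wedge h f g v = f v * g v := by
  have := factorial_mul_wedge_apply h f g v
  simp only [Nat.factorial_zero, mul_one, Nat.cast_one, one_mul, Finset.univ_unique,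
    Finset.sum_singleton] at this
  rw [this, Subsingleton.elim (default : Equiv.Perm (Fin 0)) 1]
  simp only [Equiv.Perm.sign_one, Units.val_one, Int.cast_one, one_mul]
  congr 2
  all_goals exact Subsingleton.elim _ _

end Pointwise

end EquivForms

namespace EquivForms

/-! ### The exterior product as a continuous bilinear map; algebraic identities by induction on the
degree. -/

section Pointwise

variable {E : Type*} [NormedAddCommGroup E] [NormedSpace ℝ E]

theorem wedge_apply {k l m : ℕ} (h : k + l = m) (f : E [⋀^Fin k]→L[ℝ] ℝ)
    (g : E [⋀^Fin l]→L[ℝ] ℝ) (v : Fin m → E) :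
    wedge h f g v = ((k.factorial * l.factorial : ℕ) : ℝ)⁻¹ *
      ∑ σ : Equiv.Perm (Fin m), ((Equiv.Perm.sign σ : ℤ) : ℝ) *
        (f (fun i => v (σ (Fin.cast h (Fin.castAdd l i)))) *
          g (fun j => v (σ (Fin.cast h (Fin.natAdd k j))))) := by
  rw [← factorial_mul_wedge_apply, inv_mul_cancel_left₀]
  positivity

/-- A crude bound, one `‖f‖ * ‖g‖` per permutation. It is needed only for continuity, so that wedge
products can be differentiated by the rules for bilinear maps. -/
theorem norm_wedge_le {k l m : ℕ} (h : k + l = m) (f : E [⋀^Fin k]→L[ℝ] ℝ)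
    (g : E [⋀^Fin l]→L[ℝ] ℝ) : ‖wedge h f g‖ ≤ (m.factorial : ℝ) * ‖f‖ * ‖g‖ := by
  refine ContinuousAlternatingMap.opNorm_le_bound _ (by positivity) fun v => ?_
  rw [wedge_apply, norm_mul]
  have h1 : ‖((k.factorial * l.factorial : ℕ) : ℝ)⁻¹‖ ≤ 1 := by
    rw [norm_inv, Real.norm_natCast]
    apply inv_le_one_of_one_le₀
    exact_mod_cast Nat.one_le_iff_ne_zero.2 (by positivity)
  have h2 : ∀ σ ∈ (Finset.univ : Finset (Equiv.Perm (Fin m))),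
      ‖((Equiv.Perm.sign σ : ℤ) : ℝ) *
        (f (fun i => v (σ (Fin.cast h (Fin.castAdd l i)))) *
          g (fun j => v (σ (Fin.cast h (Fin.natAdd k j)))))‖ ≤ ‖f‖ * ‖g‖ * ∏ i, ‖v i‖ := by
    intro σ _
    have h3 : ‖((Equiv.Perm.sign σ : ℤ) : ℝ)‖ = 1 := by
      rcases Int.units_eq_one_or (Equiv.Perm.sign σ) with h | h <;> simp [h]
    have h4 : ∏ i, ‖v i‖ = (∏ i, ‖v (σ (Fin.cast h (Fin.castAdd l i)))‖) *
        ∏ j, ‖v (σ (Fin.cast h (Fin.natAdd k j)))‖ := by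
      rw [← Equiv.prod_comp σ, ← (finCongr h).prod_comp, Fin.prod_univ_add]
      rfl
    rw [norm_mul, h3, one_mul, norm_mul, h4]
    calc _ ≤ (‖f‖ * ∏ i, ‖v (σ (Fin.cast h (Fin.castAdd l i)))‖) *
          (‖g‖ * ∏ j, ‖v (σ (Fin.cast h (Fin.natAdd k j)))‖) := by
            gcongr <;> apply ContinuousAlternatingMap.le_opNorm
      _ = _ := by ring
  calc _ ≤ 1 * ∑ σ : Equiv.Perm (Fin m), ‖f‖ * ‖g‖ * ∏ i, ‖v i‖ := by
        refine mul_le_mul h1 ((norm_sum_le _ _).trans (Finset.sum_le_sum h2)) (norm_nonneg _)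
          zero_le_one
    _ = _ := by
        rw [Finset.sum_const, Finset.card_univ, Fintype.card_perm, Fintype.card_fin]
        simp; ring

/-- The exterior product as a continuous bilinear map. -/
def wedgeL {k l m : ℕ} (h : k + l = m) :
    (E [⋀^Fin k]→L[ℝ] ℝ) →L[ℝ] (E [⋀^Fin l]→L[ℝ] ℝ) →L[ℝ] (E [⋀^Fin m]→L[ℝ] ℝ) :=
  LinearMap.mkContinuous₂
    (LinearMap.mk₂ ℝ (wedge h)
      (fun f f' g => by
        ext v
        simp only [wedge_apply, ContinuousAlternatingMap.add_apply, add_mul, mul_add,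
          Finset.sum_add_distrib])
      (fun c f g => by
        ext v
        simp only [wedge_apply, ContinuousAlternatingMap.smul_apply, smul_eq_mul, Finset.mul_sum]
        exact Finset.sum_congr rfl fun _ _ => by ring)
      (fun f g g' => by
        ext v
        simp only [wedge_apply, ContinuousAlternatingMap.add_apply, mul_add,
          Finset.sum_add_distrib])
      (fun c f g => by
        ext v
        simp only [wedge_apply, ContinuousAlternatingMap.smul_apply, smul_eq_mul, Finset.mul_sum]
        exact Finset.sum_congr rfl fun _ _ => by ring))
    (m.factorial : ℝ) (fun f g => norm_wedge_le h f g)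

@[simp] theorem wedgeL_apply {k l m : ℕ} (h : k + l = m) (f : E [⋀^Fin k]→L[ℝ] ℝ)
    (g : E [⋀^Fin l]→L[ℝ] ℝ) : wedgeL h f g = wedge h f g := rfl

section Linear

variable {k l m : ℕ} (h : k + l = m)

theorem wedge_add_left (f f' : E [⋀^Fin k]→L[ℝ] ℝ) (g : E [⋀^Fin l]→L[ℝ] ℝ) :
    wedge h (f + f') g = wedge h f g + wedge h f' g := by
  simp only [← wedgeL_apply, map_add, _root_.add_apply]

theorem wedge_add_right (f : E [⋀^Fin k]→L[ℝ] ℝ) (g g' : E [⋀^Fin l]→L[ℝ] ℝ) :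
    wedge h f (g + g') = wedge h f g + wedge h f g' := by
  simp only [← wedgeL_apply, map_add]

theorem wedge_sub_left (f f' : E [⋀^Fin k]→L[ℝ] ℝ) (g : E [⋀^Fin l]→L[ℝ] ℝ) :
    wedge h (f - f') g = wedge h f g - wedge h f' g := by
  simp only [← wedgeL_apply, map_sub, _root_.sub_apply]

theorem wedge_smul_left (c : ℝ) (f : E [⋀^Fin k]→L[ℝ] ℝ) (g : E [⋀^Fin l]→L[ℝ] ℝ) :
    wedge h (c • f) g = c • wedge h f g := by
  simp only [← wedgeL_apply, map_smul, _root_.smul_apply]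

theorem wedge_smul_right (c : ℝ) (f : E [⋀^Fin k]→L[ℝ] ℝ) (g : E [⋀^Fin l]→L[ℝ] ℝ) :
    wedge h f (c • g) = c • wedge h f g := by
  simp only [← wedgeL_apply, map_smul]

@[simp] theorem wedge_zero_form_right (f : E [⋀^Fin k]→L[ℝ] ℝ) :
    wedge h f (0 : E [⋀^Fin l]→L[ℝ] ℝ) = 0 := by
  simp only [← wedgeL_apply, map_zero]

theorem wedge_compContinuousLinearMap {E' : Type*} [NormedAddCommGroup E'] [NormedSpace ℝ E']
    (A : E' →L[ℝ] E) (f : E [⋀^Fin k]→L[ℝ] ℝ) (g : E [⋀^Fin l]→L[ℝ] ℝ) :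
    (wedge h f g).compContinuousLinearMap A =
      wedge h (f.compContinuousLinearMap A) (g.compContinuousLinearMap A) := by
  ext v
  simp only [ContinuousAlternatingMap.compContinuousLinearMap_apply, wedge_apply]
  rfl

end Linear

theorem neg_one_smul_form {k : ℕ} (f : E [⋀^Fin k]→L[ℝ] ℝ) : (-1 : ℝ) • f = -f := by
  ext v; simp

/-- The engine of the inductions that follow: an identity in degree `m + 1` is checked after
contraction with each vector, hence in degree `m`. -/
theorem ext_curryLeft {k : ℕ} {f g : E [⋀^Fin (k + 1)]→L[ℝ] ℝ}
    (h : ∀ x, f.curryLeft x = g.curryLeft x) : f = g := by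
  ext v
  have := congrArg (fun T => T (Matrix.vecTail v)) (h (Matrix.vecHead v))
  simpa using this

theorem wedge_zero_left {m : ℕ} (h : 0 + m = m) (f : E [⋀^Fin 0]→L[ℝ] ℝ)
    (g : E [⋀^Fin m]→L[ℝ] ℝ) : wedge h f g = f 0 • g := by
  induction m with
  | zero =>
    ext v
    rw [wedge_zero_zero_apply, Subsingleton.elim v 0]; rfl
  | succ m ih =>
    refine ext_curryLeft fun x => ?_
    rw [curryLeft_wedge_zero_left h (zero_add m), ih, ContinuousAlternatingMap.curryLeft_smul]
    rfl

theorem wedge_zero_right {m : ℕ} (h : m + 0 = m) (f : E [⋀^Fin m]→L[ℝ] ℝ)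
    (g : E [⋀^Fin 0]→L[ℝ] ℝ) : wedge h f g = g 0 • f := by
  induction m with
  | zero =>
    ext v
    rw [wedge_zero_zero_apply, Subsingleton.elim v 0, mul_comm]; rfl
  | succ m ih =>
    refine ext_curryLeft fun x => ?_
    rw [curryLeft_wedge_zero_right h (add_zero m), ih, ContinuousAlternatingMap.curryLeft_smul]
    rfl

/-- Graded commutativity of the exterior product. -/
theorem wedge_comm {k l m : ℕ} (h : k + l = m) (h' : l + k = m) (f : E [⋀^Fin k]→L[ℝ] ℝ)
    (g : E [⋀^Fin l]→L[ℝ] ℝ) : wedge h f g = (-1 : ℝ) ^ (k * l) • wedge h' g f := by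
  induction m generalizing k l with
  | zero =>
    obtain rfl : k = 0 := by omega
    obtain rfl : l = 0 := by omega
    rw [wedge_zero_left, wedge_zero_right]; simp
  | succ m ih =>
    rcases k with _ | k
    · obtain rfl : l = m + 1 := by omega
      rw [wedge_zero_left, wedge_zero_right]; simp
    rcases l with _ | l
    · obtain rfl : k = m := by omega
      rw [wedge_zero_left, wedge_zero_right]; simp
    refine ext_curryLeft fun x => ?_
    rw [ContinuousAlternatingMap.curryLeft_smul, _root_.smul_apply,
      curryLeft_wedge h (by omega) (by omega), curryLeft_wedge h' (by omega) (by omega),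
      ih _ (by omega), ih (by omega : k + 1 + l = m) (by omega), smul_add, add_comm, smul_smul,
      smul_smul]
    congr 2
    · ring
    -- The contraction rule exchanges the roles of the two terms; the extra `(-1)^(l+1)` from
    -- passing `g` cancels against part of `(-1)^((k+1)(l+1))`.
    · rw [show (k + 1) * (l + 1) = k * (l + 1) + (l + 1) by ring, pow_add, mul_assoc,
        neg_one_pow_mul_self, mul_one]

/-- Associativity of the exterior product. -/
theorem wedge_assoc {i j k a b m : ℕ} (h₁ : i + j = a) (h₂ : a + k = m) (h₃ : j + k = b)
    (h₄ : i + b = m) (f : E [⋀^Fin i]→L[ℝ] ℝ) (g : E [⋀^Fin j]→L[ℝ] ℝ)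
    (q : E [⋀^Fin k]→L[ℝ] ℝ) :
    wedge h₂ (wedge h₁ f g) q = wedge h₄ f (wedge h₃ g q) := by
  induction m generalizing i j k a b with
  | zero =>
    obtain rfl : i = 0 := by omega
    obtain rfl : j = a := by omega
    obtain rfl : b = 0 := by omega
    rw [wedge_zero_left, wedge_zero_left, wedge_smul_left]
  | succ m ih =>
    -- A factor of degree `0` is a scalar. Once these cases are gone, all three degrees are positive
    -- and the contraction formula applies to each product.
    rcases i with _ | i
    · obtain rfl : j = a := by omega
      obtain rfl : b = m + 1 := by omega
      rw [wedge_zero_left, wedge_zero_left, wedge_smul_left]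
    rcases j with _ | j
    · obtain rfl : i + 1 = a := by omega
      obtain rfl : k = b := by omega
      rw [wedge_zero_left, wedge_zero_right, wedge_smul_left, wedge_smul_right]
    rcases k with _ | k
    · obtain rfl : a = m + 1 := by omega
      obtain rfl : j + 1 = b := by omega
      rw [wedge_zero_right, wedge_zero_right, wedge_smul_right]
    obtain ⟨a, rfl⟩ : ∃ a', a = a' + 1 := ⟨i + j + 1, by omega⟩
    obtain ⟨b, rfl⟩ : ∃ b', b = b' + 1 := ⟨j + k + 1, by omega⟩
    refine ext_curryLeft fun x => ?_
    rw [curryLeft_wedge h₂ (by omega) (by omega), curryLeft_wedge h₄ (by omega) (by omega),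
      curryLeft_wedge h₁ (by omega) (by omega), curryLeft_wedge h₃ (by omega) (by omega),
      wedge_add_left, wedge_add_right, wedge_smul_left, wedge_smul_right, smul_add,
      ih _ _ h₃ (by omega), ih (by omega) _ (by omega : j + (k + 1) = b) (by omega),
      ih h₁ (by omega) (by omega : j + 1 + k = b) (by omega), smul_smul, ← pow_add, add_assoc]
    congr 4
    omega

theorem curryLeft_alternatizeUncurryFin_zero (T : E →L[ℝ] E [⋀^Fin 0]→L[ℝ] ℝ) (x : E) :
    (ContinuousAlternatingMap.alternatizeUncurryFin T).curryLeft x = T x := by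
  ext v
  simp [ContinuousAlternatingMap.alternatizeUncurryFin_apply]

/-- The interior product with a fixed vector. -/
def interiorL (k : ℕ) (x : E) : (E [⋀^Fin (k + 1)]→L[ℝ] ℝ) →L[ℝ] (E [⋀^Fin k]→L[ℝ] ℝ) :=
  (ContinuousLinearMap.apply ℝ _ x).comp
    (ContinuousAlternatingMap.curryLeftLI :
      (E [⋀^Fin (k + 1)]→L[ℝ] ℝ) →ₗᵢ[ℝ] _).toContinuousLinearMap

@[simp] theorem interiorL_apply {k : ℕ} (x : E) (f : E [⋀^Fin (k + 1)]→L[ℝ] ℝ) :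
    interiorL k x f = f.curryLeft x := rfl

/-- With `T` the derivative of a form, this is `ι_x d = ∂_x - d ι_x` for a constant vector `x`. The
summand `i = 0` uses `x` as direction of differentiation; in the others `x` stays an argument and
the shift of the index changes the sign. -/
theorem curryLeft_alternatizeUncurryFin {k : ℕ} (T : E →L[ℝ] E [⋀^Fin (k + 1)]→L[ℝ] ℝ) (x : E) :
    (ContinuousAlternatingMap.alternatizeUncurryFin T).curryLeft x =
      T x - ContinuousAlternatingMap.alternatizeUncurryFin ((interiorL k x).comp T) := by
  ext v
  rw [ContinuousAlternatingMap.curryLeft_apply_apply,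
    ContinuousAlternatingMap.alternatizeUncurryFin_apply, Fin.sum_univ_succ,
    ContinuousAlternatingMap.sub_apply, ContinuousAlternatingMap.alternatizeUncurryFin_apply,
    sub_eq_add_neg, ← Finset.sum_neg_distrib]
  congr 1
  · simp [Fin.removeNth_zero]
  · refine Finset.sum_congr rfl fun i _ => ?_
    have : i.succ.removeNth (Matrix.vecCons x v) = Matrix.vecCons x (i.removeNth v) := by
      ext j
      cases j using Fin.cases <;> simp [Fin.removeNth_apply, Matrix.vecCons]
    rw [this]
    simp [pow_succ]

/-- The algebraic half of the Leibniz rule, with `T` in the role of the derivative of the first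
factor. Both sides are contracted with `x`, and the derivatives of `ι_x` applied to the factors are
handled by the induction hypothesis. The companion for the second factor follows by graded
commutativity. -/
theorem alternatizeUncurryFin_wedge_left {k l m : ℕ} (h : k + l = m) (h' : k + 1 + l = m + 1)
    (T : E →L[ℝ] E [⋀^Fin k]→L[ℝ] ℝ) (g : E [⋀^Fin l]→L[ℝ] ℝ) :
    ContinuousAlternatingMap.alternatizeUncurryFin (((wedgeL h).flip g).comp T) =
      wedge h' (ContinuousAlternatingMap.alternatizeUncurryFin T) g := by
  induction m generalizing k l with
  | zero =>
    obtain rfl : k = 0 := by omega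
    obtain rfl : l = 0 := by omega
    refine ext_curryLeft fun x => ?_
    rw [curryLeft_alternatizeUncurryFin_zero, curryLeft_wedge_zero_right h' h,
      curryLeft_alternatizeUncurryFin_zero]
    rfl
  | succ m ih =>
    refine ext_curryLeft fun x => ?_
    rw [curryLeft_alternatizeUncurryFin]
    rcases k with _ | k
    · obtain rfl : l = m + 1 := by omega
      rw [curryLeft_wedge h' h (by omega), curryLeft_alternatizeUncurryFin_zero, ← ih (zero_add m),
        sub_eq_add_neg]
      congr 1
      rw [zero_add, pow_one]
      rw [neg_one_smul_form]
      congr 2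
      ext1 y
      simp only [ContinuousLinearMap.comp_apply, ContinuousLinearMap.flip_apply, wedgeL_apply,
        interiorL_apply]
      rw [curryLeft_wedge_zero_left h (by omega)]
    rcases l with _ | l
    · obtain rfl : k = m := by omega
      rw [curryLeft_wedge_zero_right h' h, curryLeft_alternatizeUncurryFin, wedge_sub_left,
        ← ih (add_zero k)]
      congr 2
      ext1 y
      simp only [ContinuousLinearMap.comp_apply, ContinuousLinearMap.flip_apply, wedgeL_apply,
        interiorL_apply]
      rw [curryLeft_wedge_zero_right h (by omega)]
    · rw [curryLeft_wedge h' h (by omega), curryLeft_alternatizeUncurryFin, wedge_sub_left,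
        ← ih (by omega : k + (l + 1) = m), ← ih (by omega : k + 1 + l = m), sub_add,
        ← ContinuousAlternatingMap.alternatizeUncurryFin_smul]
      congr 1
      rw [sub_eq_add_neg, ← neg_one_smul ℝ,
        ← ContinuousAlternatingMap.alternatizeUncurryFin_smul,
        ← ContinuousAlternatingMap.alternatizeUncurryFin_add]
      congr 1
      ext1 y
      simp only [ContinuousLinearMap.comp_apply, ContinuousLinearMap.flip_apply, wedgeL_apply,
        interiorL_apply, _root_.add_apply, _root_.smul_apply]
      rw [curryLeft_wedge h (by omega) (by omega)]
      congr 1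
      rw [smul_smul]
      congr 1
      ring

theorem alternatizeUncurryFin_wedge_right {k l m : ℕ} (h : k + l = m) (h' : k + (l + 1) = m + 1)
    (f : E [⋀^Fin k]→L[ℝ] ℝ) (T : E →L[ℝ] E [⋀^Fin l]→L[ℝ] ℝ) :
    ContinuousAlternatingMap.alternatizeUncurryFin ((wedgeL h f).comp T) =
      (-1 : ℝ) ^ k • wedge h' f (ContinuousAlternatingMap.alternatizeUncurryFin T) := by
  have h1 : (wedgeL h f).comp T =
      (-1 : ℝ) ^ (k * l) • ((wedgeL (by omega : l + k = m)).flip f).comp T := by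
    ext1 y
    simp only [ContinuousLinearMap.comp_apply, ContinuousLinearMap.flip_apply, wedgeL_apply,
      _root_.smul_apply]
    exact wedge_comm _ _ _ _
  rw [h1, ContinuousAlternatingMap.alternatizeUncurryFin_smul,
    alternatizeUncurryFin_wedge_left _ (by omega), wedge_comm h' (by omega), smul_smul]
  congr 1
  rw [← pow_add, mul_add, mul_one, ← add_assoc, add_comm k, pow_add, pow_add,
    mul_assoc, neg_one_pow_mul_self, mul_one]

end Pointwise

end EquivForms

namespace EquivForms

open Finset.HasAntidiagonal (antidiagonal mem_antidiagonal)

/-! ### The graded algebra of inhomogeneous forms. -/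

section Total

variable {E : Type*} [NormedAddCommGroup E] [NormedSpace ℝ E]

/-- The exterior product, extended by zero to the case of mismatched degrees. -/
def wedgeTotal (k l m : ℕ) :
    (E [⋀^Fin k]→L[ℝ] ℝ) →L[ℝ] (E [⋀^Fin l]→L[ℝ] ℝ) →L[ℝ] (E [⋀^Fin m]→L[ℝ] ℝ) :=
  if h : k + l = m then wedgeL h else 0

theorem wedgeTotal_of_eq {k l m : ℕ} (h : k + l = m) (f : E [⋀^Fin k]→L[ℝ] ℝ)
    (g : E [⋀^Fin l]→L[ℝ] ℝ) : wedgeTotal k l m f g = wedge h f g := by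
  rw [wedgeTotal, dif_pos h, wedgeL_apply]

theorem wedgeTotal_assoc {i j k a b m : ℕ} (h₁ : i + j = a) (h₂ : a + k = m) (h₃ : j + k = b)
    (f : E [⋀^Fin i]→L[ℝ] ℝ) (g : E [⋀^Fin j]→L[ℝ] ℝ) (q : E [⋀^Fin k]→L[ℝ] ℝ) :
    wedgeTotal a k m (wedgeTotal i j a f g) q = wedgeTotal i b m f (wedgeTotal j k b g q) := by
  rw [wedgeTotal_of_eq h₁, wedgeTotal_of_eq h₂, wedgeTotal_of_eq h₃,
    wedgeTotal_of_eq (by omega : i + b = m), wedge_assoc h₁ h₂ h₃]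

end Total

section Algebra

variable {E : Type*} [NormedAddCommGroup E] [NormedSpace ℝ E] {X : Type*}

/-- With the extension by zero, the summand no longer carries a proof that the degrees add up, so
sums over antidiagonals can be reindexed freely. -/
theorem wedgeForm_apply (α β : InhomForm E X) (m : ℕ) (x : X) :
    wedgeForm α β m x = ∑ p ∈ antidiagonal m, wedgeTotal p.1 p.2 m (α p.1 x) (β p.2 x) := by
  rw [wedgeForm, ← Finset.sum_attach (antidiagonal m)]
  exact Finset.sum_congr rfl fun p _ => (wedgeTotal_of_eq (mem_antidiagonal.1 p.2) _ _).symm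

/-- Multiplication of an inhomogeneous form by a function. -/
def funMul (a : X → ℝ) (α : InhomForm E X) : InhomForm E X := fun k x => a x • α k x

/-- The grading involution: multiplication by `(-1) ^ k` in degree `k`. -/
def gradeInv (α : InhomForm E X) : InhomForm E X := fun k x => (-1 : ℝ) ^ k • α k x

theorem wedgeForm_add_left (α α' β : InhomForm E X) :
    wedgeForm (α + α') β = wedgeForm α β + wedgeForm α' β := by
  ext1 m; ext1 x
  simp only [wedgeForm_apply, Pi.add_apply, map_add, _root_.add_apply, Finset.sum_add_distrib]

theorem wedgeForm_add_right (α β β' : InhomForm E X) :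
    wedgeForm α (β + β') = wedgeForm α β + wedgeForm α β' := by
  ext1 m; ext1 x
  simp only [wedgeForm_apply, Pi.add_apply, map_add, Finset.sum_add_distrib]

theorem wedgeForm_funMul_left (a : X → ℝ) (α β : InhomForm E X) :
    wedgeForm (funMul a α) β = funMul a (wedgeForm α β) := by
  ext1 m; ext1 x
  simp only [wedgeForm_apply, funMul, map_smul, _root_.smul_apply, Finset.smul_sum]

theorem wedgeForm_funMul_right (a : X → ℝ) (α β : InhomForm E X) :
    wedgeForm α (funMul a β) = funMul a (wedgeForm α β) := by
  ext1 m; ext1 x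
  simp only [wedgeForm_apply, funMul, map_smul, Finset.smul_sum]

theorem wedgeForm_smul_left (c : ℝ) (α β : InhomForm E X) :
    wedgeForm (c • α) β = c • wedgeForm α β :=
  wedgeForm_funMul_left (fun _ => c) α β

theorem wedgeForm_smul_right (c : ℝ) (α β : InhomForm E X) :
    wedgeForm α (c • β) = c • wedgeForm α β :=
  wedgeForm_funMul_right (fun _ => c) α β

theorem wedgeForm_neg_left (α β : InhomForm E X) : wedgeForm (-α) β = -wedgeForm α β := by
  ext1 m; ext1 x
  simp only [wedgeForm_apply, Pi.neg_apply, map_neg, _root_.neg_apply, Finset.sum_neg_distrib]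

theorem wedgeForm_neg_right (α β : InhomForm E X) : wedgeForm α (-β) = -wedgeForm α β := by
  ext1 m; ext1 x
  simp only [wedgeForm_apply, Pi.neg_apply, map_neg, Finset.sum_neg_distrib]

@[simp] theorem wedgeForm_zero_left (β : InhomForm E X) : wedgeForm 0 β = 0 := by
  ext1 m; ext1 x
  simp [wedgeForm_apply]

@[simp] theorem wedgeForm_zero_right (α : InhomForm E X) : wedgeForm α 0 = 0 := by
  ext1 m; ext1 x
  simp [wedgeForm_apply]

theorem wedgeForm_sum_right {ι : Type*} (s : Finset ι) (α : InhomForm E X)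
    (β : ι → InhomForm E X) : wedgeForm α (∑ i ∈ s, β i) = ∑ i ∈ s, wedgeForm α (β i) := by
  classical
  induction s using Finset.induction_on with
  | empty => simp
  | insert i s hi ih => rw [Finset.sum_insert hi, Finset.sum_insert hi, wedgeForm_add_right, ih]

theorem wedgeForm_assoc (α β γ : InhomForm E X) :
    wedgeForm (wedgeForm α β) γ = wedgeForm α (wedgeForm β γ) := by
  ext1 m; ext1 x
  simp only [wedgeForm_apply, map_sum, _root_.sum_apply]
  rw [Finset.sum_sigma', Finset.sum_sigma']
  refine Finset.sum_bij' (fun q _ => ⟨(q.2.1, q.2.2 + q.1.2), (q.2.2, q.1.2)⟩)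
    (fun q _ => ⟨(q.1.1 + q.2.1, q.2.2), (q.1.1, q.2.1)⟩) ?_ ?_ ?_ ?_ ?_
  · rintro ⟨⟨a, k⟩, ⟨i, j⟩⟩ h
    simp only [Finset.mem_sigma, mem_antidiagonal] at h ⊢
    exact ⟨by omega, trivial⟩
  · rintro ⟨⟨i, b⟩, ⟨j, k⟩⟩ h
    simp only [Finset.mem_sigma, mem_antidiagonal] at h ⊢
    exact ⟨by omega, trivial⟩
  · rintro ⟨⟨a, k⟩, ⟨i, j⟩⟩ h
    simp only [Finset.mem_sigma, mem_antidiagonal] at h ⊢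
    obtain ⟨h1, h2⟩ := h
    subst h2
    rfl
  · rintro ⟨⟨i, b⟩, ⟨j, k⟩⟩ h
    simp only [Finset.mem_sigma, mem_antidiagonal] at h ⊢
    obtain ⟨h1, h2⟩ := h
    subst h2
    rfl
  · rintro ⟨⟨a, k⟩, ⟨i, j⟩⟩ h
    simp only [Finset.mem_sigma, mem_antidiagonal] at h ⊢
    exact wedgeTotal_assoc h.2 h.1 rfl _ _ _

theorem ofDegree_apply_ne {k l : ℕ} (η : DForm E X k) (h : l ≠ k) : ofDegree η l = 0 :=
  Pi.single_eq_of_ne h η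

@[simp] theorem ofDegree_apply_self {k : ℕ} (η : DForm E X k) : ofDegree η k = η :=
  Pi.single_eq_same k η

/-- The exterior product with a homogeneous form has a single term in each degree. -/
theorem wedgeForm_ofDegree_left_apply {k l m : ℕ} (h : k + l = m) (η : DForm E X k)
    (β : InhomForm E X) (x : X) :
    wedgeForm (ofDegree η) β m x = wedge h (η x) (β l x) := by
  rw [wedgeForm_apply, Finset.sum_eq_single (k, l)]
  · rw [ofDegree_apply_self, wedgeTotal_of_eq h]
  · rintro ⟨k', l'⟩ hp hne
    rw [mem_antidiagonal] at hp
    have : k' ≠ k := by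
      rintro rfl
      exact hne (by simp at hp ⊢; omega)
    dsimp only
    rw [ofDegree_apply_ne _ this]
    simp
  · intro hp
    exact absurd (mem_antidiagonal.2 h) hp

theorem wedgeForm_ofDegree_left_apply_of_lt {k m : ℕ} (h : m < k) (η : DForm E X k)
    (β : InhomForm E X) : wedgeForm (ofDegree η) β m = 0 := by
  ext1 x
  rw [wedgeForm_apply]
  refine Finset.sum_eq_zero ?_
  rintro ⟨k', l'⟩ hp
  rw [mem_antidiagonal] at hp
  dsimp only at hp ⊢
  rw [ofDegree_apply_ne _ (by omega : k' ≠ k)]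
  simp

/-- The inhomogeneous form given by a function. -/
def ofFun (a : X → ℝ) : InhomForm E X :=
  ofDegree (k := 0) fun x => ContinuousAlternatingMap.constOfIsEmpty ℝ E (Fin 0) (a x)

theorem wedgeForm_ofFun (a : X → ℝ) (β : InhomForm E X) :
    wedgeForm (ofFun a) β = funMul a β := by
  ext1 m; ext1 x
  rw [ofFun, wedgeForm_ofDegree_left_apply (zero_add m), wedge_zero_left]
  rfl

theorem oneForm_wedgeForm (β : InhomForm E X) : wedgeForm oneForm β = β := by
  have := wedgeForm_ofFun (fun _ => 1) β
  rw [show (oneForm : InhomForm E X) = ofFun fun _ => 1 from rfl, this]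
  ext1 m; ext1 x
  exact one_smul ℝ _

/-- Homogeneous forms of even degree are central. -/
theorem wedgeForm_ofDegree_comm_of_even {k : ℕ} (hk : Even k) (η : DForm E X k)
    (β : InhomForm E X) : wedgeForm (ofDegree η) β = wedgeForm β (ofDegree η) := by
  ext1 m; ext1 x
  rw [wedgeForm_apply, wedgeForm_apply]
  refine Finset.sum_equiv (Equiv.prodComm ℕ ℕ) (fun p => by simp [add_comm]) fun p hp => ?_
  rw [mem_antidiagonal] at hp
  change _ = wedgeTotal p.2 p.1 m (β p.2 x) (ofDegree η p.1 x)
  by_cases h : p.1 = k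
  · have : Even (p.1 * p.2) := (h ▸ hk).mul_right _
    rw [wedgeTotal_of_eq hp, wedgeTotal_of_eq (by omega : p.2 + p.1 = m),
      wedge_comm hp (by omega), this.neg_one_pow, one_smul]
  · rw [ofDegree_apply_ne _ h]
    simp

theorem wedgeForm_oneForm (β : InhomForm E X) : wedgeForm β oneForm = β := by
  rw [oneForm, ← wedgeForm_ofDegree_comm_of_even Even.zero]
  exact oneForm_wedgeForm β

@[simp] theorem gradeInv_gradeInv (α : InhomForm E X) : gradeInv (gradeInv α) = α := by
  ext1 m; ext1 x
  rw [gradeInv, gradeInv, smul_smul, neg_one_pow_mul_self, one_smul]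

theorem gradeInv_ofDegree {k : ℕ} (η : DForm E X k) :
    gradeInv (ofDegree η) = (-1 : ℝ) ^ k • ofDegree η := by
  ext1 m; ext1 x
  by_cases h : m = k
  · subst h; rfl
  · simp [gradeInv, ofDegree_apply_ne _ h]

section Interior

variable (v : X → E)

theorem interiorProd_add (α β : InhomForm E X) :
    interiorProd v (α + β) = interiorProd v α + interiorProd v β := by
  ext1 m; ext1 x
  simp [interiorProd]

@[simp] theorem interiorProd_zero : interiorProd v (0 : InhomForm E X) = 0 := by
  ext1 m; ext1 x
  simp [interiorProd]

theorem interiorProd_funMul (a : X → ℝ) (α : InhomForm E X) :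
    interiorProd v (funMul a α) = funMul a (interiorProd v α) := by
  ext1 m; ext1 x
  simp [interiorProd, funMul]

theorem interiorProd_sum {ι : Type*} (s : Finset ι) (β : ι → InhomForm E X) :
    interiorProd v (∑ i ∈ s, β i) = ∑ i ∈ s, interiorProd v (β i) := by
  classical
  induction s using Finset.induction_on with
  | empty => simp
  | insert i s hi ih => rw [Finset.sum_insert hi, Finset.sum_insert hi, interiorProd_add, ih]

theorem interiorProd_gradeInv (α : InhomForm E X) :
    interiorProd v (gradeInv α) = -gradeInv (interiorProd v α) := by
  ext1 m; ext1 x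
  simp [interiorProd, gradeInv, pow_succ]

theorem interiorProd_ofDegree_succ {k : ℕ} (η : DForm E X (k + 1)) :
    interiorProd v (ofDegree η) = ofDegree fun x => (η x).curryLeft (v x) := by
  ext1 m; ext1 x
  by_cases h : m = k
  · subst h; simp [interiorProd]
  · simp [interiorProd, ofDegree_apply_ne _ h, ofDegree_apply_ne η (by omega : m + 1 ≠ k + 1)]

@[simp] theorem interiorProd_ofDegree_zero (η : DForm E X 0) :
    interiorProd v (ofDegree η) = 0 := by
  ext1 m; ext1 x
  simp [interiorProd, ofDegree_apply_ne η (by omega : m + 1 ≠ 0)]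

/-- The first term of the antiderivation formula for the interior product. -/
def interiorFst (α β : InhomForm E X) (m : ℕ) (x : X) : ℕ × ℕ → E [⋀^Fin m]→L[ℝ] ℝ
  | (0, _) => 0
  | (k + 1, l) => wedgeTotal k l m ((α (k + 1) x).curryLeft (v x)) (β l x)

/-- The second term of the antiderivation formula for the interior product. -/
def interiorSnd (α β : InhomForm E X) (m : ℕ) (x : X) : ℕ × ℕ → E [⋀^Fin m]→L[ℝ] ℝ
  | (_, 0) => 0
  | (k, l + 1) => wedgeTotal k l m ((-1 : ℝ) ^ k • α k x) ((β (l + 1) x).curryLeft (v x))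

/-- The interior product is an antiderivation. -/
theorem interiorProd_wedgeForm (α β : InhomForm E X) :
    interiorProd v (wedgeForm α β) =
      wedgeForm (interiorProd v α) β + wedgeForm (gradeInv α) (interiorProd v β) := by
  ext1 m; ext1 x
  have key : ∀ p ∈ antidiagonal (m + 1),
      interiorL m (v x) (wedgeTotal p.1 p.2 (m + 1) (α p.1 x) (β p.2 x)) =
        interiorFst v α β m x p + interiorSnd v α β m x p := by
    rintro ⟨k, l⟩ hp
    rw [mem_antidiagonal] at hp
    dsimp only at hp ⊢
    rw [wedgeTotal_of_eq hp, interiorL_apply]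
    rcases k with _ | k
    · obtain rfl : l = m + 1 := by omega
      simp only [interiorFst, interiorSnd]
      rw [curryLeft_wedge_zero_left hp (zero_add m), wedgeTotal_of_eq (zero_add m)]
      simp
    rcases l with _ | l
    · obtain rfl : k = m := by omega
      simp only [interiorFst, interiorSnd]
      rw [curryLeft_wedge_zero_right hp (add_zero k), wedgeTotal_of_eq (add_zero k), add_zero]
    · simp only [interiorFst, interiorSnd]
      rw [curryLeft_wedge hp (by omega) (by omega),
        wedgeTotal_of_eq (by omega : k + (l + 1) = m),
        wedgeTotal_of_eq (by omega : k + 1 + l = m), wedge_smul_left]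
  have hL : interiorProd v (wedgeForm α β) m x =
      interiorL m (v x) (wedgeForm α β (m + 1) x) := rfl
  -- Split off `(0, m + 1)` from the sum of first terms and `(m + 1, 0)` from the sum of second
  -- terms. Both are zero, and what remains runs over the antidiagonal of `m`.
  rw [hL, wedgeForm_apply, map_sum, Finset.sum_congr rfl key, Finset.sum_add_distrib,
    Finset.Nat.sum_antidiagonal_succ, Finset.Nat.sum_antidiagonal_succ' (f := interiorSnd v α β m x),
    Pi.add_apply, Pi.add_apply, wedgeForm_apply, wedgeForm_apply]
  simp only [interiorFst, interiorSnd, zero_add]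
  rfl

end Interior

/-! ### Powers of a `2`-form. -/

section Powers

theorem wedgePow_ofDegree_two_apply_ne (η : DForm E X 2) {m k : ℕ} (h : k ≠ 2 * m) :
    wedgePow (ofDegree η) m k = 0 := by
  induction m generalizing k with
  | zero => exact ofDegree_apply_ne _ (by omega)
  | succ m ih =>
    rw [wedgePow]
    by_cases hk : k < 2
    · exact wedgeForm_ofDegree_left_apply_of_lt hk _ _
    · obtain ⟨l, rfl⟩ : ∃ l, 2 + l = k := ⟨k - 2, by omega⟩
      ext1 x
      rw [wedgeForm_ofDegree_left_apply rfl, ih (by omega : l ≠ 2 * m)]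
      simp

theorem form_eq_zero_of_finrank_lt [FiniteDimensional ℝ E] {k : ℕ}
    (h : Module.finrank ℝ E < k) (f : E [⋀^Fin k]→L[ℝ] ℝ) : f = 0 := by
  ext v
  refine f.toAlternatingMap.map_linearDependent v fun hv => ?_
  have := hv.fintype_card_le_finrank
  rw [Fintype.card_fin] at this
  omega

/-- Nilpotency for degree reasons, which makes the polynomials in `η` below finite. Exponents above
half the dimension would already do. -/
theorem wedgePow_ofDegree_two_eq_zero [FiniteDimensional ℝ E] (η : DForm E X 2) {m : ℕ}
    (h : Module.finrank ℝ E < m) : wedgePow (ofDegree η) m = 0 := by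
  ext1 k
  by_cases hk : k = 2 * m
  · ext1 x
    exact form_eq_zero_of_finrank_lt (by omega) _
  · exact wedgePow_ofDegree_two_apply_ne η hk

theorem gradeInv_ofDegree_of_even {k : ℕ} (hk : Even k) (η : DForm E X k) :
    gradeInv (ofDegree η) = ofDegree η := by
  rw [gradeInv_ofDegree, hk.neg_one_pow, one_smul]

/-- A `2`-form is even, hence central, and the antiderivation `ι_v` acts on its powers like an
ordinary derivation. -/
theorem interiorProd_wedgePow (v : X → E) (η : DForm E X 2) (m : ℕ) :
    interiorProd v (wedgePow (ofDegree η) (m + 1)) =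
      ((m : ℝ) + 1) • wedgeForm (interiorProd v (ofDegree η)) (wedgePow (ofDegree η) m) := by
  induction m with
  | zero =>
    simp only [wedgePow, wedgeForm_oneForm]
    simp
  | succ m ih =>
    rw [wedgePow, interiorProd_wedgeForm, ih, gradeInv_ofDegree_of_even even_two,
      wedgeForm_smul_right, ← wedgeForm_assoc,
      wedgeForm_ofDegree_comm_of_even even_two, wedgeForm_assoc]
    change _ + _ • wedgeForm _ (wedgePow (ofDegree η) (m + 1)) = _
    rw [Nat.cast_succ, add_smul (_ + 1), one_smul, add_comm]

theorem interiorProd_wedgePow_eq_zero {v : X → E} {η : DForm E X 2}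
    (h : interiorProd v (ofDegree η) = 0) (m : ℕ) :
    interiorProd v (wedgePow (ofDegree η) m) = 0 := by
  rcases m with _ | m
  · exact interiorProd_ofDegree_zero v _
  · rw [interiorProd_wedgePow, h]
    simp

end Powers

end Algebra

end EquivForms

/-! ### Forms in charts: transition maps and the exterior derivative. -/

namespace EquivForms

theorem minSmoothness_two_le_infty : minSmoothness ℝ 2 ≤ (∞ : WithTop ℕ∞) := by
  rw [minSmoothness_of_isRCLikeNormedField]
  exact ENat.LEInfty.out

section Charts

variable {E : Type*} [NormedAddCommGroup E] [NormedSpace ℝ E]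
  {H : Type*} [TopologicalSpace H] (I : ModelWithCorners ℝ E H)
  {X : Type*} [TopologicalSpace X] [ChartedSpace H X]

/-- The derivative of a preferred chart. -/
def chartD (x₀ x : X) : E →L[ℝ] E := mfderiv I 𝓘(ℝ, E) (extChartAt I x₀) x

/-- The derivative of the inverse of a preferred chart. -/
def chartSymmD (x₀ : X) (y : E) : E →L[ℝ] E := mfderiv 𝓘(ℝ, E) I (extChartAt I x₀).symm y

/-- The transition map between two preferred charts. -/
def transition (x₀ x₁ : X) (y : E) : E := extChartAt I x₁ ((extChartAt I x₀).symm y)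

variable {I}

theorem inChart_apply {k : ℕ} (x₀ : X) (η : DForm E X k) (y : E) :
    inChart I x₀ η y =
      (η ((extChartAt I x₀).symm y)).compContinuousLinearMap (chartSymmD I x₀ y) := rfl

theorem extD_apply {k : ℕ} (η : DForm E X k) (x : X) :
    extD I η x = (extDeriv (inChart I x η) (extChartAt I x x)).compContinuousLinearMap
      (chartD I x x) := rfl

theorem inChart_add {k : ℕ} (η ζ : DForm E X k) (x₀ : X) :
    inChart I x₀ (η + ζ) = inChart I x₀ η + inChart I x₀ ζ := rfl

variable [I.Boundaryless] [IsManifold I ∞ X]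

theorem mdifferentiableAt_extChartAt_symm {x₀ : X} {y : E} (hy : y ∈ (extChartAt I x₀).target) :
    MDifferentiableAt 𝓘(ℝ, E) I (extChartAt I x₀).symm y :=
  (((contMDiffOn_extChartAt_symm (n := ∞) x₀).contMDiffAt
    ((isOpen_extChartAt_target x₀).mem_nhds hy)).mdifferentiableAt (by simp))

theorem mdifferentiableAt_extChartAt_of_mem {x₀ x : X} (hx : x ∈ (extChartAt I x₀).source) :
    MDifferentiableAt I 𝓘(ℝ, E) (extChartAt I x₀) x := by
  rw [extChartAt_source] at hx
  exact (contMDiffAt_extChartAt' (n := ∞) hx).mdifferentiableAt (by simp)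

theorem fderiv_transition {x₀ x₁ : X} {y : E} (hy : y ∈ (extChartAt I x₀).target)
    (hx : (extChartAt I x₀).symm y ∈ (extChartAt I x₁).source) :
    fderiv ℝ (transition I x₀ x₁) y =
      (chartD I x₁ ((extChartAt I x₀).symm y)).comp (chartSymmD I x₀ y) := by
  rw [← mfderiv_eq_fderiv]
  exact mfderiv_comp y (mdifferentiableAt_extChartAt_of_mem hx)
    (mdifferentiableAt_extChartAt_symm hy)

theorem chartSymmD_comp_chartD {x₀ x : X} (hx : x ∈ (extChartAt I x₀).source) :
    (chartSymmD I x₀ (extChartAt I x₀ x)).comp (chartD I x₀ x) =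
      ContinuousLinearMap.id ℝ E := by
  have hy := (extChartAt I x₀).map_source hx
  have h1 : mfderiv I I ((extChartAt I x₀).symm ∘ extChartAt I x₀) x =
      (chartSymmD I x₀ (extChartAt I x₀ x)).comp (chartD I x₀ x) :=
    mfderiv_comp x (mdifferentiableAt_extChartAt_symm hy) (mdifferentiableAt_extChartAt_of_mem hx)
  have h2 : (extChartAt I x₀).symm ∘ extChartAt I x₀ =ᶠ[𝓝 x] id := by
    filter_upwards [(isOpen_extChartAt_source (I := I) x₀).mem_nhds hx] with z hz
    exact (extChartAt I x₀).left_inv hz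
  rw [← h1, h2.mfderiv_eq, mfderiv_id]
  rfl

theorem chartSymmD_eq_comp_fderiv_transition {x₀ x₁ : X} {y : E}
    (hy : y ∈ (extChartAt I x₀).target)
    (hx : (extChartAt I x₀).symm y ∈ (extChartAt I x₁).source) :
    chartSymmD I x₀ y =
      (chartSymmD I x₁ (transition I x₀ x₁ y)).comp (fderiv ℝ (transition I x₀ x₁) y) := by
  rw [fderiv_transition hy hx, ← ContinuousLinearMap.comp_assoc, transition,
    chartSymmD_comp_chartD hx, ContinuousLinearMap.id_comp]

theorem isOpen_transition_source (x₀ x₁ : X) :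
    IsOpen ((extChartAt I x₀).target ∩ (extChartAt I x₀).symm ⁻¹' (extChartAt I x₁).source) :=
  (continuousOn_extChartAt_symm x₀).isOpen_inter_preimage (isOpen_extChartAt_target x₀)
    (isOpen_extChartAt_source x₁)

theorem contDiffAt_transition {x₀ x₁ : X} {y : E} (hy : y ∈ (extChartAt I x₀).target)
    (hx : (extChartAt I x₀).symm y ∈ (extChartAt I x₁).source) :
    ContDiffAt ℝ ∞ (transition I x₀ x₁) y := by
  have h := contDiffWithinAt_ext_coord_change (I := I) (n := ∞) x₁ x₀ (y := y)
    (by rw [PartialEquiv.trans_source]; exact ⟨hy, hx⟩)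
  rwa [I.range_eq_univ, contDiffWithinAt_univ] at h

theorem inChart_eq_transition {k : ℕ} (η : DForm E X k) {x₀ x₁ : X} {y : E}
    (hy : y ∈ (extChartAt I x₀).target)
    (hx : (extChartAt I x₀).symm y ∈ (extChartAt I x₁).source) :
    inChart I x₀ η y = (inChart I x₁ η (transition I x₀ x₁ y)).compContinuousLinearMap
      (fderiv ℝ (transition I x₀ x₁) y) := by
  have h1 : (extChartAt I x₁).symm (transition I x₀ x₁ y) = (extChartAt I x₀).symm y :=
    (extChartAt I x₁).left_inv hx
  rw [inChart_apply, inChart_apply, chartSymmD_eq_comp_fderiv_transition hy hx, h1]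
  rfl

theorem IsSmooth.contDiffAt {k : ℕ} {η : DForm E X k} (hη : IsSmooth I η) {x₀ : X} {y : E}
    (hy : y ∈ (extChartAt I x₀).target) : ContDiffAt ℝ ∞ (inChart I x₀ η) y :=
  (hη x₀).contDiffAt ((isOpen_extChartAt_target x₀).mem_nhds hy)

theorem IsSmooth.differentiableAt {k : ℕ} {η : DForm E X k} (hη : IsSmooth I η) {x₀ : X} {y : E}
    (hy : y ∈ (extChartAt I x₀).target) : DifferentiableAt ℝ (inChart I x₀ η) y :=
  (hη.contDiffAt hy).differentiableAt (by simp)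

theorem isSmooth_of_contDiffAt {k : ℕ} {η : DForm E X k}
    (h : ∀ x₀ : X, ∀ y ∈ (extChartAt I x₀).target, ContDiffAt ℝ ∞ (inChart I x₀ η) y) :
    IsSmooth I η := fun x₀ y hy => (h x₀ y hy).contDiffWithinAt

/-- The exterior derivative is computed by any preferred chart. -/
theorem inChart_extD {k : ℕ} {η : DForm E X k} (hη : IsSmooth I η) {x₀ : X} {y : E}
    (hy : y ∈ (extChartAt I x₀).target) :
    inChart I x₀ (extD I η) y = extDeriv (inChart I x₀ η) y := by
  -- The exterior derivative at `x` is defined with the chart around `x` itself. Near `y` the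
  -- expression in the chart at `x₀` is its pullback under the transition map, and `extDeriv`
  -- commutes with pullback.
  set x := (extChartAt I x₀).symm y with hx
  have hxs : (extChartAt I x₀).symm y ∈ (extChartAt I x).source := mem_extChartAt_source x
  have h1 : inChart I x₀ (extD I η) y =
      (extDeriv (inChart I x η) (transition I x₀ x y)).compContinuousLinearMap
        (fderiv ℝ (transition I x₀ x) y) := by
    rw [inChart_apply, extD_apply, fderiv_transition hy hxs]
    rfl
  have h2 : inChart I x₀ η =ᶠ[𝓝 y] fun z =>
      (inChart I x η (transition I x₀ x z)).compContinuousLinearMap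
        (fderiv ℝ (transition I x₀ x) z) := by
    filter_upwards [(isOpen_transition_source x₀ x).mem_nhds ⟨hy, hxs⟩] with z hz
    exact inChart_eq_transition η hz.1 hz.2
  rw [h1, h2.extDeriv_eq]
  refine (extDeriv_pullback (r := ∞) ?_ (contDiffAt_transition hy hxs)
    minSmoothness_two_le_infty).symm
  exact hη.differentiableAt ((extChartAt I x).map_source hxs)

/-- The value of a form is recovered from its chart expression by pulling back along the derivative
of the chart, since the derivatives of the chart and of its inverse compose to the identity. -/
theorem eq_of_inChart_eq {k : ℕ} {η ζ : DForm E X k} {x₀ x : X}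
    (hx : x ∈ (extChartAt I x₀).source)
    (h : inChart I x₀ η (extChartAt I x₀ x) = inChart I x₀ ζ (extChartAt I x₀ x)) :
    η x = ζ x := by
  have key : ∀ η : DForm E X k, η x =
      (inChart I x₀ η (extChartAt I x₀ x)).compContinuousLinearMap (chartD I x₀ x) := by
    intro η
    rw [inChart_apply, (extChartAt I x₀).left_inv hx]
    ext v
    have := chartSymmD_comp_chartD hx
    simp only [ContinuousAlternatingMap.compContinuousLinearMap_apply]
    congr 1
    ext1 i
    exact (DFunLike.congr_fun this (v i)).symm
  rw [key η, key ζ, h]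

theorem form_ext_inChart {k : ℕ} {η ζ : DForm E X k}
    (h : ∀ x₀ : X, ∀ y ∈ (extChartAt I x₀).target, inChart I x₀ η y = inChart I x₀ ζ y) :
    η = ζ :=
  funext fun x => eq_of_inChart_eq (mem_extChartAt_source (I := I) x)
    (h x _ (mem_extChartAt_target x))

end Charts

end EquivForms

namespace EquivForms

open Finset.HasAntidiagonal (antidiagonal mem_antidiagonal)

/-! ### Smoothness, Leibniz rules and `d ∘ d = 0`; the equivariant differential. -/

section Vector

variable {E : Type*} [NormedAddCommGroup E] [NormedSpace ℝ E]

theorem contDiffAt_wedge {k l m : ℕ} (h : k + l = m) {F : Type*} [NormedAddCommGroup F]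
    [NormedSpace ℝ F] {r : WithTop ℕ∞} {f : F → E [⋀^Fin k]→L[ℝ] ℝ} {g : F → E [⋀^Fin l]→L[ℝ] ℝ}
    {y : F} (hf : ContDiffAt ℝ r f y) (hg : ContDiffAt ℝ r g y) :
    ContDiffAt ℝ r (fun z => wedge h (f z) (g z)) y := by
  have h1 := ContinuousLinearMap.contDiff (𝕜 := ℝ) (E := E [⋀^Fin k]→L[ℝ] ℝ)
    (F := (E [⋀^Fin l]→L[ℝ] ℝ) →L[ℝ] (E [⋀^Fin m]→L[ℝ] ℝ)) (wedgeL h) (n := r)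
  exact (h1.contDiffAt.comp y hf).clm_apply hg

/-- The Leibniz rule for the exterior derivative on a vector space. -/
theorem extDeriv_wedge {k l m : ℕ} (h : k + l = m) (h₁ : k + 1 + l = m + 1)
    (h₂ : k + (l + 1) = m + 1) {f : E → E [⋀^Fin k]→L[ℝ] ℝ} {g : E → E [⋀^Fin l]→L[ℝ] ℝ} {y : E}
    (hf : DifferentiableAt ℝ f y) (hg : DifferentiableAt ℝ g y) :
    extDeriv (fun z => wedge h (f z) (g z)) y =
      wedge h₁ (extDeriv f y) (g y) + (-1 : ℝ) ^ k • wedge h₂ (f y) (extDeriv g y) := by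
  have h1 : fderiv ℝ (fun z => wedge h (f z) (g z)) y =
      ((wedgeL h).flip (g y)).comp (fderiv ℝ f y) + (wedgeL h (f y)).comp (fderiv ℝ g y) := by
    have := (wedgeL (E := E) h).fderiv_of_bilinear hf hg
    simp only [wedgeL_apply] at this
    rw [this, add_comm]
    rfl
  rw [extDeriv, h1, ContinuousAlternatingMap.alternatizeUncurryFin_add,
    alternatizeUncurryFin_wedge_left h h₁, alternatizeUncurryFin_wedge_right h h₂]
  rfl

theorem contDiffAt_extDeriv {k : ℕ} {f : E → E [⋀^Fin k]→L[ℝ] ℝ} {y : E}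
    (hf : ContDiffAt ℝ ∞ f y) : ContDiffAt ℝ ∞ (extDeriv f) y := by
  have h1 := ContinuousLinearMap.contDiff (𝕜 := ℝ) (E := E →L[ℝ] E [⋀^Fin k]→L[ℝ] ℝ)
    (F := E [⋀^Fin (k + 1)]→L[ℝ] ℝ)
    (ContinuousAlternatingMap.alternatizeUncurryFinCLM (n := k) ℝ E ℝ) (n := ∞)
  exact h1.contDiffAt.comp y (hf.fderiv_right (m := ∞) (by simp))

end Vector

section Charts

variable {E : Type*} [NormedAddCommGroup E] [NormedSpace ℝ E]
  {H : Type*} [TopologicalSpace H] (I : ModelWithCorners ℝ E H)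
  {X : Type*} [TopologicalSpace X] [ChartedSpace H X]

/-- A function is smooth in the charts. -/
def IsSmoothFun (a : X → ℝ) : Prop :=
  ∀ x₀ : X, ∀ y ∈ (extChartAt I x₀).target, ContDiffAt ℝ ∞ (a ∘ (extChartAt I x₀).symm) y

/-- A vector field is smooth in the charts. -/
def IsSmoothField (v : X → E) : Prop :=
  ∀ x₀ : X, ∀ y ∈ (extChartAt I x₀).target, ContDiffAt ℝ ∞
    (fun z => chartD I x₀ ((extChartAt I x₀).symm z) (v ((extChartAt I x₀).symm z))) y

/-- An inhomogeneous form is smooth. -/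
def IsSmoothForm (α : InhomForm E X) : Prop := ∀ k, IsSmooth I (α k)

variable {I}

theorem inChart_smul {k : ℕ} (a : X → ℝ) (η : DForm E X k) (x₀ : X) (y : E) :
    inChart I x₀ (fun x => a x • η x) y =
      a ((extChartAt I x₀).symm y) • inChart I x₀ η y := rfl

theorem inChart_wedge {k l m : ℕ} (h : k + l = m) (η : DForm E X k) (ζ : DForm E X l) (x₀ : X) :
    inChart I x₀ (fun x => wedge h (η x) (ζ x)) =
      fun y => wedge h (inChart I x₀ η y) (inChart I x₀ ζ y) :=
  funext fun _ => wedge_compContinuousLinearMap h _ _ _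

theorem inChart_sum {k : ℕ} {ι : Type*} (s : Finset ι) (η : ι → DForm E X k) (x₀ : X) :
    inChart I x₀ (∑ i ∈ s, η i) = ∑ i ∈ s, inChart I x₀ (η i) := by
  classical
  induction s using Finset.induction_on with
  | empty => rfl
  | insert i s hi ih => rw [Finset.sum_insert hi, Finset.sum_insert hi, inChart_add, ih]

variable [I.Boundaryless] [IsManifold I ∞ X]

/-- The vector must be transported into the chart by the derivative of the chart, which the
derivative of the inverse chart then undoes. -/
theorem inChart_curryLeft {k : ℕ} (v : X → E) (η : DForm E X (k + 1)) {x₀ : X} {y : E}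
    (hy : y ∈ (extChartAt I x₀).target) :
    inChart I x₀ (fun x => (η x).curryLeft (v x)) y = (inChart I x₀ η y).curryLeft
      (chartD I x₀ ((extChartAt I x₀).symm y) (v ((extChartAt I x₀).symm y))) := by
  rw [inChart_apply, inChart_apply, ContinuousAlternatingMap.curryLeft_compContinuousLinearMap]
  have := chartSymmD_comp_chartD ((extChartAt I x₀).map_target hy)
  rw [(extChartAt I x₀).right_inv hy] at this
  have h := DFunLike.congr_fun this (v ((extChartAt I x₀).symm y))
  simp only [ContinuousLinearMap.comp_apply] at h
  rw [h]
  rfl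

theorem IsSmooth.add {k : ℕ} {η ζ : DForm E X k} (hη : IsSmooth I η) (hζ : IsSmooth I ζ) :
    IsSmooth I (η + ζ) :=
  isSmooth_of_contDiffAt fun _ _ hy => (hη.contDiffAt hy).add (hζ.contDiffAt hy)

theorem isSmooth_zero {k : ℕ} : IsSmooth I (0 : DForm E X k) :=
  isSmooth_of_contDiffAt fun _ _ _ => contDiffAt_const (c := 0)

theorem IsSmooth.sum {k : ℕ} {ι : Type*} {s : Finset ι} {η : ι → DForm E X k}
    (h : ∀ i ∈ s, IsSmooth I (η i)) : IsSmooth I (∑ i ∈ s, η i) :=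
  Finset.sum_induction _ (fun η => IsSmooth I η) (fun _ _ => IsSmooth.add) isSmooth_zero h

theorem IsSmooth.funMul {k : ℕ} {a : X → ℝ} {η : DForm E X k} (ha : IsSmoothFun I a)
    (hη : IsSmooth I η) : IsSmooth I (fun x => a x • η x) :=
  isSmooth_of_contDiffAt fun x₀ y hy => (ha x₀ y hy).smul (hη.contDiffAt hy)

theorem isSmoothFun_const (c : ℝ) : IsSmoothFun I (fun _ : X => c) :=
  fun _ _ _ => contDiffAt_const

theorem IsSmooth.neg {k : ℕ} {η : DForm E X k} (hη : IsSmooth I η) : IsSmooth I (-η) :=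
  isSmooth_of_contDiffAt fun _ _ hy => (hη.contDiffAt hy).neg

theorem IsSmooth.wedge {k l m : ℕ} (h : k + l = m) {η : DForm E X k} {ζ : DForm E X l}
    (hη : IsSmooth I η) (hζ : IsSmooth I ζ) : IsSmooth I (fun x => wedge h (η x) (ζ x)) :=
  isSmooth_of_contDiffAt fun x₀ y hy => by
    rw [inChart_wedge]
    exact contDiffAt_wedge h (hη.contDiffAt hy) (hζ.contDiffAt hy)

theorem IsSmooth.extD {k : ℕ} {η : DForm E X k} (hη : IsSmooth I η) : IsSmooth I (extD I η) :=
  isSmooth_of_contDiffAt fun x₀ y hy => by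
    refine (contDiffAt_extDeriv (hη.contDiffAt hy)).congr_of_eventuallyEq ?_
    filter_upwards [(isOpen_extChartAt_target x₀).mem_nhds hy] with z hz
    exact inChart_extD hη hz

theorem IsSmooth.curryLeft {k : ℕ} {v : X → E} (hv : IsSmoothField I v) {η : DForm E X (k + 1)}
    (hη : IsSmooth I η) : IsSmooth I (fun x => (η x).curryLeft (v x)) :=
  isSmooth_of_contDiffAt fun x₀ y hy => by
    have h1 : ContDiffAt ℝ ∞ (fun z => (inChart I x₀ η z).curryLeft
        (chartD I x₀ ((extChartAt I x₀).symm z) (v ((extChartAt I x₀).symm z)))) y := by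
      have h2 := LinearIsometry.contDiff (𝕜 := ℝ) (E := E [⋀^Fin (k + 1)]→L[ℝ] ℝ)
        (F := E →L[ℝ] E [⋀^Fin k]→L[ℝ] ℝ)
        (ContinuousAlternatingMap.curryLeftLI (𝕜 := ℝ) (E := E) (F := ℝ) (n := k)) (n := ∞)
      exact (h2.contDiffAt.comp y (hη.contDiffAt hy)).clm_apply (hv x₀ y hy)
    refine h1.congr_of_eventuallyEq ?_
    filter_upwards [(isOpen_extChartAt_target x₀).mem_nhds hy] with z hz
    exact inChart_curryLeft v η hz

theorem extD_add {k : ℕ} {η ζ : DForm E X k} (hη : IsSmooth I η) (hζ : IsSmooth I ζ) :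
    extD I (η + ζ) = extD I η + extD I ζ :=
  form_ext_inChart fun x₀ y hy => by
    rw [inChart_extD (hη.add hζ) hy, inChart_add, inChart_add, Pi.add_apply, inChart_extD hη hy,
      inChart_extD hζ hy, extDeriv_add (hη.differentiableAt hy) (hζ.differentiableAt hy)]

theorem extD_zero {k : ℕ} : extD I (0 : DForm E X k) = 0 :=
  form_ext_inChart fun x₀ y hy => by
    rw [inChart_extD isSmooth_zero hy]
    have : inChart I x₀ (0 : DForm E X k) = 0 := rfl
    rw [this, extDeriv, fderiv_zero, Pi.zero_apply]
    exact map_zero (ContinuousAlternatingMap.alternatizeUncurryFinCLM ℝ E ℝ)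

theorem extD_smul {k : ℕ} (c : ℝ) {η : DForm E X k} (hη : IsSmooth I η) :
    extD I (c • η) = c • extD I η :=
  form_ext_inChart fun x₀ y hy => by
    have h : IsSmooth I (c • η) := IsSmooth.funMul (isSmoothFun_const c) hη
    rw [inChart_extD h hy]
    exact (extDeriv_smul c (inChart I x₀ η)).trans (congrArg (c • ·) (inChart_extD hη hy).symm)

theorem extD_sum {k : ℕ} {ι : Type*} {s : Finset ι} {η : ι → DForm E X k}
    (h : ∀ i ∈ s, IsSmooth I (η i)) : extD I (∑ i ∈ s, η i) = ∑ i ∈ s, extD I (η i) := by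
  classical
  induction s using Finset.induction_on with
  | empty => exact extD_zero
  | insert i s hi ih =>
    have hs : ∀ j ∈ s, IsSmooth I (η j) := fun j hj => h j (Finset.mem_insert_of_mem hj)
    rw [Finset.sum_insert hi, Finset.sum_insert hi,
      extD_add (h i (Finset.mem_insert_self i s)) (IsSmooth.sum hs), ih hs]

/-- The Leibniz rule for the exterior derivative. -/
theorem extD_wedge {k l m : ℕ} (h : k + l = m) (h₁ : k + 1 + l = m + 1)
    (h₂ : k + (l + 1) = m + 1) {η : DForm E X k} {ζ : DForm E X l}
    (hη : IsSmooth I η) (hζ : IsSmooth I ζ) :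
    extD I (fun x => wedge h (η x) (ζ x)) =
      (fun x => wedge h₁ (extD I η x) (ζ x)) +
        fun x => (-1 : ℝ) ^ k • wedge h₂ (η x) (extD I ζ x) :=
  form_ext_inChart fun x₀ y hy => by
    rw [inChart_extD (hη.wedge h hζ) hy, inChart_wedge, inChart_add, Pi.add_apply,
      inChart_smul (fun _ => (-1 : ℝ) ^ k), inChart_wedge, inChart_wedge,
      extDeriv_wedge h h₁ h₂ (hη.differentiableAt hy) (hζ.differentiableAt hy),
      ← inChart_extD hη hy, ← inChart_extD hζ hy]

theorem extD_extD {k : ℕ} {η : DForm E X k} (hη : IsSmooth I η) : extD I (extD I η) = 0 :=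
  form_ext_inChart fun x₀ y hy => by
    have h : inChart I x₀ (extD I η) =ᶠ[𝓝 y] extDeriv (inChart I x₀ η) := by
      filter_upwards [(isOpen_extChartAt_target (I := I) x₀).mem_nhds hy] with z hz
      exact inChart_extD hη hz
    rw [inChart_extD hη.extD hy, h.extDeriv_eq,
      extDeriv_extDeriv_apply (hη.contDiffAt hy) minSmoothness_two_le_infty]
    rfl

/-! Inhomogeneous forms -/

theorem IsSmoothForm.add {α β : InhomForm E X} (hα : IsSmoothForm I α) (hβ : IsSmoothForm I β) :
    IsSmoothForm I (α + β) := fun k => (hα k).add (hβ k)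

theorem IsSmoothForm.neg {α : InhomForm E X} (hα : IsSmoothForm I α) :
    IsSmoothForm I (-α) := fun k => (hα k).neg

theorem isSmoothForm_zero : IsSmoothForm I (0 : InhomForm E X) := fun _ => isSmooth_zero

theorem IsSmoothForm.sum {ι : Type*} {s : Finset ι} {β : ι → InhomForm E X}
    (h : ∀ i ∈ s, IsSmoothForm I (β i)) : IsSmoothForm I (∑ i ∈ s, β i) :=
  Finset.sum_induction _ (fun β => IsSmoothForm I β) (fun _ _ => IsSmoothForm.add)
    isSmoothForm_zero h

theorem IsSmoothForm.funMul {a : X → ℝ} {β : InhomForm E X} (ha : IsSmoothFun I a)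
    (hβ : IsSmoothForm I β) : IsSmoothForm I (funMul a β) := fun k => (hβ k).funMul ha

theorem IsSmoothForm.gradeInv {β : InhomForm E X} (hβ : IsSmoothForm I β) :
    IsSmoothForm I (gradeInv β) := fun k => (hβ k).funMul (isSmoothFun_const _)

theorem isSmoothForm_ofDegree {k : ℕ} {η : DForm E X k} (hη : IsSmooth I η) :
    IsSmoothForm I (ofDegree η) := by
  intro l
  by_cases h : l = k
  · subst h
    rwa [ofDegree_apply_self]
  · rw [ofDegree_apply_ne _ h]
    exact isSmooth_zero

theorem inChart_constOfIsEmpty (a : X → ℝ) (x₀ : X) :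
    inChart I x₀ (fun x => ContinuousAlternatingMap.constOfIsEmpty ℝ E (Fin 0) (a x)) =
      fun y => ContinuousAlternatingMap.constOfIsEmpty ℝ E (Fin 0)
        (a ((extChartAt I x₀).symm y)) := rfl

theorem isSmoothForm_ofFun {a : X → ℝ} (ha : IsSmoothFun I a) :
    IsSmoothForm I (ofFun a : InhomForm E X) :=
  isSmoothForm_ofDegree <| isSmooth_of_contDiffAt fun x₀ y hy => by
    have h1 := (ContinuousAlternatingMap.constOfIsEmptyLIE ℝ E ℝ (Fin 0)).contDiff (n := ∞)
    exact h1.contDiffAt.comp y (ha x₀ y hy)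

theorem wedgeForm_eq_sum (α β : InhomForm E X) (m : ℕ) :
    wedgeForm α β m = ∑ p ∈ (antidiagonal m).attach, fun x =>
      wedge (mem_antidiagonal.1 p.2) (α p.1.1 x) (β p.1.2 x) := by
  ext1 x
  rw [Finset.sum_apply]
  rfl

theorem IsSmoothForm.wedgeForm {α β : InhomForm E X} (hα : IsSmoothForm I α)
    (hβ : IsSmoothForm I β) : IsSmoothForm I (wedgeForm α β) := by
  intro m
  rw [wedgeForm_eq_sum]
  exact IsSmooth.sum fun p _ => (hα _).wedge _ (hβ _)

theorem IsSmoothForm.wedgePow {α : InhomForm E X} (hα : IsSmoothForm I α) (j : ℕ) :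
    IsSmoothForm I (wedgePow α j) := by
  induction j with
  | zero => exact isSmoothForm_ofFun (isSmoothFun_const 1)
  | succ j ih => exact hα.wedgeForm ih

theorem IsSmoothForm.extDForm {α : InhomForm E X} (hα : IsSmoothForm I α) :
    IsSmoothForm I (extDForm I α)
  | 0 => isSmooth_zero
  | k + 1 => (hα k).extD

theorem IsSmoothForm.interiorProd {v : X → E} (hv : IsSmoothField I v) {α : InhomForm E X}
    (hα : IsSmoothForm I α) : IsSmoothForm I (interiorProd v α) :=
  fun k => (hα (k + 1)).curryLeft hv

theorem IsSmoothForm.equivD {v : X → E} (hv : IsSmoothField I v) {α : InhomForm E X}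
    (hα : IsSmoothForm I α) : IsSmoothForm I (equivD I v α) := by
  rw [EquivForms.equivD, sub_eq_add_neg]
  exact hα.extDForm.add (hα.interiorProd hv).neg

theorem extDForm_add {α β : InhomForm E X} (hα : IsSmoothForm I α) (hβ : IsSmoothForm I β) :
    extDForm I (α + β) = extDForm I α + extDForm I β := by
  ext1 k
  rcases k with _ | k
  · exact (add_zero _).symm
  · exact extD_add (hα k) (hβ k)

theorem extDForm_zero : extDForm I (0 : InhomForm E X) = 0 := by
  ext1 k
  rcases k with _ | k
  · rfl
  · exact extD_zero

theorem extDForm_gradeInv {α : InhomForm E X} (hα : IsSmoothForm I α) :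
    extDForm I (gradeInv α) = -gradeInv (extDForm I α) := by
  ext1 k
  rcases k with _ | k
  · ext1 x
    simp [extDForm, gradeInv]
  · have h := extD_smul ((-1 : ℝ) ^ k) (hα k)
    refine h.trans ?_
    ext1 x
    change _ = -((-1 : ℝ) ^ (k + 1) • extD I (α k) x)
    ext w
    simp [pow_succ]

theorem extDForm_ofDegree {k : ℕ} (η : DForm E X k) :
    extDForm I (ofDegree η) = ofDegree (extD I η) := by
  ext1 l
  rcases l with _ | l
  · rw [ofDegree_apply_ne _ (by omega : 0 ≠ k + 1)]
    rfl
  · by_cases h : l = k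
    · subst h
      simp [extDForm]
    · rw [ofDegree_apply_ne _ (by omega : l + 1 ≠ k + 1)]
      simp [extDForm, ofDegree_apply_ne _ h, extD_zero]

/-- The exterior derivative is an antiderivation. -/
theorem extDForm_wedgeForm {α β : InhomForm E X} (hα : IsSmoothForm I α)
    (hβ : IsSmoothForm I β) :
    extDForm I (wedgeForm α β) =
      wedgeForm (extDForm I α) β + wedgeForm (gradeInv α) (extDForm I β) := by
  ext1 m
  ext1 x
  rw [Pi.add_apply, Pi.add_apply, wedgeForm_apply, wedgeForm_apply]
  rcases m with _ | m
  · simp [extDForm]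
  -- The terms split off contain the degree `0` component of an exterior derivative, which is zero;
  -- the rest is indexed by the antidiagonal of `m`.
  rw [Finset.Nat.sum_antidiagonal_succ, Finset.Nat.sum_antidiagonal_succ']
  have h0 : extDForm I (wedgeForm α β) (m + 1) = extD I (wedgeForm α β m) := rfl
  rw [h0, wedgeForm_eq_sum, extD_sum fun p _ => (hα _).wedge _ (hβ _), Finset.sum_apply]
  have h1 : ∀ p : {p // p ∈ antidiagonal m},
      extD I (fun x => wedge (mem_antidiagonal.1 p.2) (α p.1.1 x) (β p.1.2 x)) x =
        wedgeTotal (p.1.1 + 1) p.1.2 (m + 1) (extDForm I α (p.1.1 + 1) x) (β p.1.2 x) +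
        wedgeTotal p.1.1 (p.1.2 + 1) (m + 1) (gradeInv α p.1.1 x)
          (extDForm I β (p.1.2 + 1) x) := by
    intro p
    have hp := mem_antidiagonal.1 p.2
    rw [extD_wedge hp (by omega) (by omega) (hα _) (hβ _), Pi.add_apply,
      wedgeTotal_of_eq (by omega : p.1.1 + 1 + p.1.2 = m + 1),
      wedgeTotal_of_eq (by omega : p.1.1 + (p.1.2 + 1) = m + 1), gradeInv, wedge_smul_left]
    rfl
  rw [Finset.sum_congr rfl fun p _ => h1 p, Finset.sum_add_distrib,
    Finset.sum_attach (antidiagonal m) fun p =>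
      wedgeTotal (p.1 + 1) p.2 (m + 1) (extDForm I α (p.1 + 1) x) (β p.2 x),
    Finset.sum_attach (antidiagonal m) fun p =>
      wedgeTotal p.1 (p.2 + 1) (m + 1) (gradeInv α p.1 x) (extDForm I β (p.2 + 1) x)]
  have h2 : ∀ γ : InhomForm E X, extDForm I γ 0 x = 0 := fun _ => rfl
  rw [h2, h2]
  simp

/-- The equivariant differential is an antiderivation. -/
theorem equivD_wedgeForm (v : X → E) {α β : InhomForm E X} (hα : IsSmoothForm I α)
    (hβ : IsSmoothForm I β) :
    equivD I v (wedgeForm α β) =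
      wedgeForm (equivD I v α) β + wedgeForm (gradeInv α) (equivD I v β) := by
  simp only [equivD, extDForm_wedgeForm hα hβ, interiorProd_wedgeForm, sub_eq_add_neg,
    wedgeForm_add_left, wedgeForm_add_right, wedgeForm_neg_left, wedgeForm_neg_right]
  abel

theorem equivD_add (v : X → E) {α β : InhomForm E X} (hα : IsSmoothForm I α)
    (hβ : IsSmoothForm I β) : equivD I v (α + β) = equivD I v α + equivD I v β := by
  simp only [equivD, extDForm_add hα hβ, interiorProd_add]
  abel

theorem equivD_sum (v : X → E) {ι : Type*} {s : Finset ι} {β : ι → InhomForm E X}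
    (h : ∀ i ∈ s, IsSmoothForm I (β i)) :
    equivD I v (∑ i ∈ s, β i) = ∑ i ∈ s, equivD I v (β i) := by
  classical
  induction s using Finset.induction_on with
  | empty => simp [equivD, extDForm_zero]
  | insert i s hi ih =>
    have hs : ∀ j ∈ s, IsSmoothForm I (β j) := fun j hj => h j (Finset.mem_insert_of_mem hj)
    rw [Finset.sum_insert hi, Finset.sum_insert hi,
      equivD_add v (h i (Finset.mem_insert_self i s)) (IsSmoothForm.sum hs), ih hs]

/-- Both `d` and `ι_v` change the parity of the degree, so `D` anticommutes with the grading
involution. -/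
theorem equivD_gradeInv (v : X → E) {α : InhomForm E X} (hα : IsSmoothForm I α) :
    equivD I v (gradeInv α) = -gradeInv (equivD I v α) := by
  rw [equivD, extDForm_gradeInv hα, interiorProd_gradeInv]
  ext1 k
  ext1 x
  simp only [equivD, gradeInv, smul_sub, Pi.sub_apply, Pi.neg_apply]
  abel

end Charts

end EquivForms

namespace EquivForms

open MeasureTheory

/-! ### Integration on a vector space: determinants, orientation signs, extension by zero, Stokes.
-/

section Vector

variable {E : Type*} [NormedAddCommGroup E] [NormedSpace ℝ E]

/-- Top-degree covectors form a line spanned by the determinant of the basis. This produces the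
Jacobian under a change of chart. -/
theorem form_comp_basis {m : ℕ} (b : Module.Basis (Fin m) ℝ E) (f : E [⋀^Fin m]→L[ℝ] ℝ)
    (A : E →L[ℝ] E) : f.compContinuousLinearMap A b = A.det * f b := by
  have h := f.toAlternatingMap.eq_smul_basis_det b
  have h1 : ∀ v, f v = f b * b.det v := fun v => DFunLike.congr_fun h v
  rw [ContinuousAlternatingMap.compContinuousLinearMap_apply, h1]
  have h2 : b.det (⇑A ∘ ⇑b) = LinearMap.det (A : E →ₗ[ℝ] E) * b.det b :=
    Module.Basis.det_comp b (A : E →ₗ[ℝ] E) b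
  rw [h2, b.det_self, mul_one, mul_comm]

theorem form_apply_basis_ne_zero {m : ℕ} (b : Module.Basis (Fin m) ℝ E)
    {f : E [⋀^Fin m]→L[ℝ] ℝ} (hf : f ≠ 0) : f b ≠ 0 := by
  intro h0
  apply hf
  have h := f.toAlternatingMap.eq_smul_basis_det b
  ext v
  have h1 : f v = f b * b.det v := DFunLike.congr_fun h v
  rw [h1, h0, zero_mul]
  rfl

theorem real_sign_mul (a b : ℝ) : Real.sign (a * b) = Real.sign a * Real.sign b := by
  rcases lt_trichotomy a 0 with ha | ha | ha <;> rcases lt_trichotomy b 0 with hb | hb | hb <;>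
    simp [Real.sign_of_neg, Real.sign_of_pos, ha, hb, mul_pos_of_neg_of_neg, mul_neg_of_neg_of_pos,
      mul_neg_of_pos_of_neg]

theorem real_sign_mul_self (a : ℝ) : Real.sign a * a = |a| := by
  rcases lt_trichotomy a 0 with ha | ha | ha
  · simp [Real.sign_of_neg ha, abs_of_neg ha]
  · simp [ha]
  · simp [Real.sign_of_pos ha, abs_of_pos ha]

/-- The orientation sign in the definition of the integral is locally constant, so it affects
neither smoothness nor exterior derivatives. -/
theorem real_sign_eventuallyEq {F : Type*} [TopologicalSpace F] {f : F → ℝ} {y : F}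
    (hf : ContinuousAt f y) (h : f y ≠ 0) :
    (fun z => Real.sign (f z)) =ᶠ[𝓝 y] fun _ => Real.sign (f y) := by
  rcases h.lt_or_gt with h | h
  · filter_upwards [hf.eventually_lt_const h] with z hz
    rw [Real.sign_of_neg hz, Real.sign_of_neg h]
  · filter_upwards [hf.eventually_const_lt h] with z hz
    rw [Real.sign_of_pos hz, Real.sign_of_pos h]

variable {W : Type*} [NormedAddCommGroup W] [NormedSpace ℝ W]

section Indicator

variable {T K : Set E} {F : E → W}

theorem indicator_eventuallyEq (hT : IsOpen T) {y : E} (hy : y ∈ T) :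
    T.indicator F =ᶠ[𝓝 y] F := by
  filter_upwards [hT.mem_nhds hy] with z hz
  exact Set.indicator_of_mem hz F

theorem indicator_eventuallyEq_zero (hK : IsCompact K) (hKT : K ⊆ T)
    (hF : ∀ y ∈ T, y ∉ K → F y = 0) {y : E} (hy : y ∉ T) :
    T.indicator F =ᶠ[𝓝 y] fun _ => 0 := by
  filter_upwards [hK.isClosed.isOpen_compl.mem_nhds fun h => hy (hKT h)] with z hz
  by_cases hzT : z ∈ T
  · rw [Set.indicator_of_mem hzT, hF z hzT hz]
  · exact Set.indicator_of_notMem hzT F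

/-- Extension by zero of a function which is smooth on an open set and vanishes off a compact
subset. -/
theorem contDiff_indicator (hT : IsOpen T) (hK : IsCompact K) (hKT : K ⊆ T)
    (hF : ∀ y ∈ T, y ∉ K → F y = 0) (hs : ∀ y ∈ T, ContDiffAt ℝ ∞ F y) :
    ContDiff ℝ ∞ (T.indicator F) := by
  rw [contDiff_iff_contDiffAt]
  intro y
  by_cases hy : y ∈ T
  · exact (hs y hy).congr_of_eventuallyEq (indicator_eventuallyEq hT hy)
  · exact contDiffAt_const.congr_of_eventuallyEq (indicator_eventuallyEq_zero hK hKT hF hy)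

theorem hasCompactSupport_indicator (hK : IsCompact K) (hF : ∀ y ∈ T, y ∉ K → F y = 0) :
    HasCompactSupport (T.indicator F) := by
  refine HasCompactSupport.intro hK fun y hy => ?_
  by_cases hyT : y ∈ T
  · rw [Set.indicator_of_mem hyT, hF y hyT hy]
  · exact Set.indicator_of_notMem hyT F

theorem integrableOn_of_contDiffAt [MeasurableSpace E] [BorelSpace E]
    {ν : Measure E} [IsFiniteMeasureOnCompacts ν]
    (hT : IsOpen T) (hK : IsCompact K) (hKT : K ⊆ T)
    (hF : ∀ y ∈ T, y ∉ K → F y = 0) (hs : ∀ y ∈ T, ContDiffAt ℝ ∞ F y) :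
    IntegrableOn F T ν := by
  rw [← integrable_indicator_iff hT.measurableSet]
  exact (contDiff_indicator hT hK hKT hF hs).continuous.integrable_of_hasCompactSupport
    (hasCompactSupport_indicator hK hF)

end Indicator

variable [FiniteDimensional ℝ E] [MeasurableSpace E] [BorelSpace E]

theorem integral_fderiv_eq_zero (ν : Measure E) [ν.IsAddHaarMeasure] {g : E → ℝ}
    (hg : ContDiff ℝ ∞ g) (hc : HasCompactSupport g) (v : E) : ∫ y, fderiv ℝ g y v ∂ν = 0 := by
  have h1 : Integrable (fun y => fderiv ℝ g y v) ν :=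
    ((hg.continuous_fderiv (by simp)).clm_apply continuous_const).integrable_of_hasCompactSupport
      (hc.fderiv_apply (𝕜 := ℝ) v)
  -- Integration by parts against the constant function `1`.
  have h := integral_mul_fderiv_eq_neg_fderiv_mul_of_integrable (μ := ν) (f := fun _ : E => (1 : ℝ))
    (g := g) (v := v) (by simp) (by simpa using h1)
    (by simpa using hg.continuous.integrable_of_hasCompactSupport hc)
    (fun x _ => differentiableAt_const _) (fun x _ => hg.differentiable (by simp) x)
  simpa using h

/-- Stokes' theorem on a vector space, for a compactly supported form. -/
theorem integral_extDeriv_eq_zero (ν : Measure E) [ν.IsAddHaarMeasure] {k : ℕ}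
    {f : E → E [⋀^Fin k]→L[ℝ] ℝ} (hf : ContDiff ℝ ∞ f) (hc : HasCompactSupport f)
    (v : Fin (k + 1) → E) : ∫ y, extDeriv f y v ∂ν = 0 := by
  have hg : ∀ w : Fin k → E, ContDiff ℝ ∞ (fun y => f y w) := fun w =>
    (ContinuousLinearMap.contDiff (𝕜 := ℝ) (E := E [⋀^Fin k]→L[ℝ] ℝ) (F := ℝ)
      (ContinuousAlternatingMap.apply ℝ E ℝ w)).comp hf
  have hgc : ∀ w : Fin k → E, HasCompactSupport (fun y => f y w) := fun w =>
    hc.comp_left (g := fun T : E [⋀^Fin k]→L[ℝ] ℝ => T w) rfl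
  have h1 : ∀ y, extDeriv f y v =
      ∑ i : Fin (k + 1), (-1 : ℝ) ^ i.val * fderiv ℝ (f · (i.removeNth v)) y (v i) := fun y => by
    rw [extDeriv_apply (hf.differentiable (by simp) y) v]
    simp
  simp only [h1]
  rw [integral_finsetSum]
  · refine Finset.sum_eq_zero fun i _ => ?_
    rw [integral_const_mul, integral_fderiv_eq_zero ν (hg _) (hgc _), mul_zero]
  · intro i _
    refine Integrable.const_mul ?_ _
    exact (((hg _).continuous_fderiv (by simp)).clm_apply
      continuous_const).integrable_of_hasCompactSupport ((hgc _).fderiv_apply (𝕜 := ℝ) _)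

end Vector

end EquivForms

namespace EquivForms

open MeasureTheory

/-! ### Stokes' theorem on a compact manifold. -/

section Stokes

variable {E : Type*} [NormedAddCommGroup E] [NormedSpace ℝ E]
  {H : Type*} [TopologicalSpace H] {I : ModelWithCorners ℝ E H}
  {X : Type*} [TopologicalSpace X] [ChartedSpace H X]
  [I.Boundaryless] [IsManifold I ∞ X]

/-- A top-degree form in a chart, evaluated on the basis used for integration, with the sign given
by the orientation. -/
def signedCoord (I : ModelWithCorners ℝ E H) (μ : DForm E X (Module.finrank ℝ E)) (i : X)
    (θ : DForm E X (Module.finrank ℝ E)) [FiniteDimensional ℝ E] (y : E) : ℝ :=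
  Real.sign (inChart I i μ y (Module.finBasis ℝ E)) * inChart I i θ y (Module.finBasis ℝ E)

/-- The compact set of chart coordinates of the points of a closed set. -/
def chartImage (I : ModelWithCorners ℝ E H) (i : X) (s : Set X) : Set E := extChartAt I i '' s

theorem isCompact_chartImage [CompactSpace X] {i : X} {s : Set X} (hs : IsClosed s)
    (hsi : s ⊆ (extChartAt I i).source) : IsCompact (chartImage I i s) :=
  hs.isCompact.image_of_continuousOn ((continuousOn_extChartAt i).mono hsi)

theorem chartImage_subset {i : X} {s : Set X} (hsi : s ⊆ (extChartAt I i).source) :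
    chartImage I i s ⊆ (extChartAt I i).target := by
  rintro _ ⟨x, hx, rfl⟩
  exact (extChartAt I i).map_source (hsi hx)

theorem symm_notMem_of_notMem_chartImage {i : X} {s : Set X} {y : E}
    (hy : y ∈ (extChartAt I i).target) (h : y ∉ chartImage I i s) :
    (extChartAt I i).symm y ∉ s :=
  fun hs => h ⟨_, hs, (extChartAt I i).right_inv hy⟩

/-- The exterior derivative vanishes off the support. -/
theorem extD_funMul_eq_zero {k : ℕ} {a : X → ℝ} {η : DForm E X k} {x : X} (hx : x ∉ tsupport a) :
    extD I (fun x => a x • η x) x = 0 := by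
  have h1 : inChart I x (fun x => a x • η x) =ᶠ[𝓝 (extChartAt I x x)] fun _ => 0 := by
    have h2 : a =ᶠ[𝓝 x] fun _ => 0 := notMem_tsupport_iff_eventuallyEq.1 hx
    have h3 := (continuousAt_extChartAt_symm (I := I) x)
    rw [ContinuousAt, extChartAt_to_inv] at h3
    filter_upwards [h3.eventually h2] with y hy
    rw [inChart_smul, hy, zero_smul]
  rw [extD_apply, h1.extDeriv_eq]
  have : extDeriv (fun _ : E => (0 : E [⋀^Fin k]→L[ℝ] ℝ)) (extChartAt I x x) = 0 := by
    rw [extDeriv, fderiv_fun_const]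
    exact map_zero (ContinuousAlternatingMap.alternatizeUncurryFinCLM ℝ E ℝ)
  rw [this]
  rfl

theorem inChart_ne_zero {k : ℕ} {η : DForm E X k} {i : X} {y : E}
    (hy : y ∈ (extChartAt I i).target) (h : η ((extChartAt I i).symm y) ≠ 0) :
    inChart I i η y ≠ 0 := by
  intro h0
  apply h
  refine eq_of_inChart_eq (ζ := 0) ((extChartAt I i).map_target hy) ?_
  rw [(extChartAt I i).right_inv hy, h0]
  rfl

variable [FiniteDimensional ℝ E]

theorem sign_eventuallyEq {μ : DForm E X (Module.finrank ℝ E)} (hμ : IsVolumeForm I μ) {i : X}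
    {y : E} (hy : y ∈ (extChartAt I i).target) :
    (fun z => Real.sign (inChart I i μ z (Module.finBasis ℝ E))) =ᶠ[𝓝 y]
      fun _ => Real.sign (inChart I i μ y (Module.finBasis ℝ E)) := by
  refine real_sign_eventuallyEq ?_ ?_
  · exact (ContinuousAlternatingMap.apply ℝ E ℝ (Module.finBasis ℝ E)).continuous.continuousAt.comp
      (hμ.1.contDiffAt hy).continuousAt
  · exact form_apply_basis_ne_zero _ (inChart_ne_zero hy (hμ.2 _))

theorem contDiffAt_signedCoord {μ : DForm E X (Module.finrank ℝ E)} (hμ : IsVolumeForm I μ) {i : X}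
    {θ : DForm E X (Module.finrank ℝ E)} (hθ : IsSmooth I θ) {y : E}
    (hy : y ∈ (extChartAt I i).target) : ContDiffAt ℝ ∞ (signedCoord I μ i θ) y := by
  have h1 := ContinuousLinearMap.contDiff (𝕜 := ℝ)
    (E := E [⋀^Fin (Module.finrank ℝ E)]→L[ℝ] ℝ) (F := ℝ)
      (ContinuousAlternatingMap.apply ℝ E ℝ (Module.finBasis ℝ E)) (n := ∞)
  exact (contDiffAt_const.congr_of_eventuallyEq (sign_eventuallyEq hμ hy)).mul
    (h1.contDiffAt.comp y (hθ.contDiffAt hy))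

/-- The coordinate of `θ` is multiplied by the Jacobian determinant and the sign of `μ` by its sign.
The product is the absolute value demanded by the change of variables formula. -/
theorem signedCoord_transition (μ θ : DForm E X (Module.finrank ℝ E)) {i j : X} {y : E}
    (hy : y ∈ (extChartAt I j).target) (hx : (extChartAt I j).symm y ∈ (extChartAt I i).source) :
    signedCoord I μ j θ y =
      |(fderiv ℝ (transition I j i) y).det| * signedCoord I μ i θ (transition I j i y) := by
  rw [signedCoord, signedCoord, inChart_eq_transition μ hy hx, inChart_eq_transition θ hy hx,
    form_comp_basis, form_comp_basis, real_sign_mul, ← real_sign_mul_self]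
  ring

variable [MeasurableSpace E] [BorelSpace E]

theorem image_transition (i j : X) :
    transition I j i '' ((extChartAt I j).target ∩
        (extChartAt I j).symm ⁻¹' (extChartAt I i).source) =
      (extChartAt I i).target ∩ (extChartAt I i).symm ⁻¹' (extChartAt I j).source := by
  ext z
  constructor
  · rintro ⟨y, ⟨hy, hx⟩, rfl⟩
    refine ⟨(extChartAt I i).map_source hx, ?_⟩
    rw [Set.mem_preimage, transition, (extChartAt I i).left_inv hx]
    exact (extChartAt I j).map_target hy
  · rintro ⟨hz, hx⟩
    refine ⟨extChartAt I j ((extChartAt I i).symm z), ⟨(extChartAt I j).map_source hx, ?_⟩, ?_⟩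
    · rw [Set.mem_preimage, (extChartAt I j).left_inv hx]
      exact (extChartAt I i).map_target hz
    · rw [transition, (extChartAt I j).left_inv hx, (extChartAt I i).right_inv hz]

theorem setIntegral_chart_eq (i : X) {F : E → ℝ} (s : Set X)
    (hF : ∀ y ∈ (extChartAt I i).target, (extChartAt I i).symm y ∉ s → F y = 0) (ν : Measure E) :
    ∫ y in (extChartAt I i).target, F y ∂ν =
      ∫ y in (extChartAt I i).target ∩ (extChartAt I i).symm ⁻¹' s, F y ∂ν := by
  refine setIntegral_eq_of_subset_of_forall_sdiff_eq_zero
    (isOpen_extChartAt_target (I := I) i).measurableSet Set.inter_subset_left ?_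
  rintro y ⟨hy, hn⟩
  exact hF y hy fun h => hn ⟨hy, h⟩

/-- The integral of a top-degree form supported in two charts may be computed in either. -/
theorem setIntegral_signedCoord_eq (ν : Measure E) [ν.IsAddHaarMeasure]
    (μ θ : DForm E X (Module.finrank ℝ E)) (a : X → ℝ) {i j : X}
    (hi : ∀ x, x ∉ (extChartAt I i).source → a x = 0)
    (hj : ∀ x, x ∉ (extChartAt I j).source → θ x = 0) :
    ∫ y in (extChartAt I i).target, a ((extChartAt I i).symm y) * signedCoord I μ i θ y ∂ν =
      ∫ y in (extChartAt I j).target, a ((extChartAt I j).symm y) * signedCoord I μ j θ y ∂ν := by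
  -- Both integrals reduce to the overlap of the charts: in chart `i` because `θ` vanishes outside
  -- chart `j`, in chart `j` because `a` vanishes outside chart `i`.
  rw [setIntegral_chart_eq i (extChartAt I j).source _ ν,
    setIntegral_chart_eq j (extChartAt I i).source _ ν, ← image_transition]
  · have hopen := isOpen_transition_source (I := I) j i
    rw [integral_image_eq_integral_abs_det_fderiv_smul ν hopen.measurableSet
      (f' := fun y => fderiv ℝ (transition I j i) y)]
    · refine setIntegral_congr_fun hopen.measurableSet fun y hy => ?_
      rw [signedCoord_transition μ θ hy.1 hy.2]
      have : (extChartAt I i).symm (transition I j i y) = (extChartAt I j).symm y :=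
        (extChartAt I i).left_inv hy.2
      rw [this, smul_eq_mul]
      ring
    · intro y hy
      exact ((contDiffAt_transition hy.1 hy.2).differentiableAt (by simp)).hasFDerivAt.hasFDerivWithinAt
    · intro y hy z hz h
      have h1 : (extChartAt I j).symm y = (extChartAt I j).symm z :=
        (extChartAt I i).injOn hy.2 hz.2 h
      rw [← (extChartAt I j).right_inv hy.1, h1, (extChartAt I j).right_inv hz.1]
  · intro y hy hn
    rw [hi _ hn, zero_mul]
  · intro y hy hn
    have : inChart I i θ y = 0 := by
      rw [inChart_apply, hj _ hn]
      rfl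
    rw [signedCoord, this]
    simp

/-- In the application `m` is the dimension, equal to a successor only propositionally; the cast is
moved onto the vectors. -/
theorem inChart_extDForm_apply (α : InhomForm E X) {k m : ℕ} (h : k + 1 = m) (i : X) (y : E)
    (v : Fin m → E) :
    inChart I i (extDForm I α m) y v = inChart I i (extD I (α k)) y (v ∘ Fin.cast h) := by
  subst h
  rfl

/-- Stokes' theorem for a form supported in a chart. -/
theorem setIntegral_signedCoord_extD_eq_zero [CompactSpace X] (ν : Measure E) [ν.IsAddHaarMeasure]
    {μ : DForm E X (Module.finrank ℝ E)} (hμ : IsVolumeForm I μ)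
    {a : X → ℝ} (ha : IsSmoothFun I a) {j : X} (hj : tsupport a ⊆ (extChartAt I j).source)
    {β : InhomForm E X} (hβ : IsSmoothForm I β) :
    ∫ y in (extChartAt I j).target,
      signedCoord I μ j (extDForm I (funMul a β) (Module.finrank ℝ E)) y ∂ν = 0 := by
  -- In dimension `0` there is nothing to integrate: an exterior derivative has no component of
  -- degree `0`.
  obtain hd | ⟨k, hd⟩ : Module.finrank ℝ E = 0 ∨ ∃ k, k + 1 = Module.finrank ℝ E := by
    rcases h : Module.finrank ℝ E with _ | k
    · exact Or.inl rfl
    · exact Or.inr ⟨k, rfl⟩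
  · have : extDForm I (funMul a β) (Module.finrank ℝ E) = 0 := by
      rw [hd]; rfl
    rw [this]
    have h0 : ∀ y, signedCoord I μ j 0 y = 0 := fun y => mul_zero _
    simp [h0]
  set T := (extChartAt I j).target with hT
  have hTo : IsOpen T := isOpen_extChartAt_target j
  set s : E → ℝ := fun y => Real.sign (inChart I j μ y (Module.finBasis ℝ E)) with hs
  set f : E → E [⋀^Fin k]→L[ℝ] ℝ := inChart I j (funMul a β k) with hf
  set K := chartImage I j (tsupport a) with hK
  have hKc : IsCompact K := isCompact_chartImage (isClosed_tsupport a) hj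
  have hKT : K ⊆ T := chartImage_subset hj
  have hsm : IsSmooth I (funMul a β k) := (IsSmoothForm.funMul ha hβ) k
  have hF0 : ∀ y ∈ T, y ∉ K → s y • f y = 0 := by
    intro y hy hyK
    have h1 := image_eq_zero_of_notMem_tsupport (symm_notMem_of_notMem_chartImage hy hyK)
    rw [hf]
    change s y • (a ((extChartAt I j).symm y) • inChart I j (β k) y) = 0
    rw [h1, zero_smul, smul_zero]
  have hFs : ∀ y ∈ T, ContDiffAt ℝ ∞ (fun y => s y • f y) y := fun y hy =>
    (contDiffAt_const.congr_of_eventuallyEq (sign_eventuallyEq hμ hy)).smul (hsm.contDiffAt hy)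
  -- The orientation sign is absorbed into the form. Extended by zero, `s • f` is smooth with
  -- compact support on the whole of `E`, and on `T` its exterior derivative is `s` times that of
  -- `f`.
  have key := integral_extDeriv_eq_zero ν (contDiff_indicator hTo hKc hKT hF0 hFs)
    (hasCompactSupport_indicator hKc hF0) (Module.finBasis ℝ E ∘ Fin.cast hd)
  rw [← key, ← integral_indicator hTo.measurableSet]
  congr 1
  ext1 y
  by_cases hy : y ∈ T
  · have h1 : T.indicator (fun y => s y • f y) =ᶠ[𝓝 y] s y • f := by
      filter_upwards [indicator_eventuallyEq (F := fun y => s y • f y) hTo hy,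
        sign_eventuallyEq hμ hy] with z hz hz'
      rw [hz]
      change s z • f z = s y • f z
      rw [show s z = s y from hz']
    rw [Set.indicator_of_mem hy, h1.extDeriv_eq, extDeriv_smul, signedCoord,
      inChart_extDForm_apply _ hd, inChart_extD hsm hy]
    rfl
  · rw [Set.indicator_of_notMem hy, (indicator_eventuallyEq_zero hKc hKT hF0 hy).extDeriv_eq]
    have : extDeriv (fun _ : E => (0 : E [⋀^Fin k]→L[ℝ] ℝ)) y = 0 := by
      rw [extDeriv, fderiv_fun_const]
      exact map_zero (ContinuousAlternatingMap.alternatizeUncurryFinCLM ℝ E ℝ)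
    rw [this]
    rfl

variable [T2Space X] [CompactSpace X]

theorem chartPartition_isSubordinate (i : X) :
    tsupport (chartPartition I X i) ⊆ (extChartAt I i).source := by
  rw [extChartAt_source]
  exact (SmoothPartitionOfUnity.exists_isSubordinate_chartAt_source I X).choose_spec i

theorem isSmoothFun_chartPartition (i : X) : IsSmoothFun I (chartPartition I X i) := by
  intro x₀ y hy
  have h1 : ContMDiffAt I 𝓘(ℝ, ℝ) ∞ (chartPartition I X i) ((extChartAt I x₀).symm y) :=
    (chartPartition I X i).contMDiff.contMDiffAt
  have h2 := (contMDiffOn_extChartAt_symm (I := I) (n := ∞) x₀).contMDiffAt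
    ((isOpen_extChartAt_target x₀).mem_nhds hy)
  exact contMDiffAt_iff_contDiffAt.1 (h1.comp y h2)

variable (I X) in
theorem finite_chartPartition_support :
    {i : X | (Function.support (chartPartition I X i)).Nonempty}.Finite :=
  (chartPartition I X).locallyFinite.finite_nonempty_of_compact

variable (I X) in
/-- The finitely many charts with a non-trivial term in the partition of unity. -/
def chartIndex : Finset X := (finite_chartPartition_support I X).toFinset

theorem chartPartition_eq_zero {i : X} (hi : i ∉ chartIndex I X) (x : X) :
    chartPartition I X i x = 0 := by
  by_contra h
  exact hi ((finite_chartPartition_support I X).mem_toFinset.2 ⟨x, h⟩)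

theorem sum_chartPartition (x : X) : ∑ i ∈ chartIndex I X, chartPartition I X i x = 1 := by
  rw [← (chartPartition I X).sum_eq_one (Set.mem_univ x)]
  symm
  refine finsum_eq_sum_of_support_subset _ fun i hi => ?_
  by_contra h
  exact hi (chartPartition_eq_zero h x)

theorem integral_eq_sum (μ : DForm E X (Module.finrank ℝ E)) (η : InhomForm E X) :
    integral I μ η = ∑ i ∈ chartIndex I X, ∫ y in (extChartAt I i).target,
      chartPartition I X i ((extChartAt I i).symm y) *
        signedCoord I μ i (η (Module.finrank ℝ E)) y ∂(Module.finBasis ℝ E).addHaar := by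
  rw [integral, finsum_eq_sum_of_support_subset (s := chartIndex I X)]
  · simp only [signedCoord, mul_assoc]
  · intro i hi
    by_contra h
    exact hi (by simp [chartPartition_eq_zero h])

/-- Compact support inside the chart may come from either factor. In Stokes' theorem it comes from
the partition function `ρ i` in chart `i`, and from the form `d(ρ j β)` in chart `j`. -/
theorem integrableOn_signedCoord (ν : Measure E) [IsFiniteMeasureOnCompacts ν]
    {μ : DForm E X (Module.finrank ℝ E)} (hμ : IsVolumeForm I μ)
    {θ : DForm E X (Module.finrank ℝ E)} (hθ : IsSmooth I θ) {a : X → ℝ} (ha : IsSmoothFun I a)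
    {i : X} {s : Set X} (hs : IsClosed s) (hsi : s ⊆ (extChartAt I i).source)
    (h0 : ∀ x ∉ s, a x = 0 ∨ θ x = 0) :
    IntegrableOn (fun y => a ((extChartAt I i).symm y) * signedCoord I μ i θ y)
      (extChartAt I i).target ν := by
  refine integrableOn_of_contDiffAt (isOpen_extChartAt_target i) (isCompact_chartImage hs hsi)
    (chartImage_subset hsi) ?_ fun y hy => (ha i y hy).mul (contDiffAt_signedCoord hμ hθ hy)
  intro y hy hyK
  rcases h0 _ (symm_notMem_of_notMem_chartImage hy hyK) with h | h
  · rw [h, zero_mul]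
  · have : inChart I i θ y = 0 := by
      rw [inChart_apply, h]
      rfl
    rw [signedCoord, this]
    simp

theorem signedCoord_add (μ θ θ' : DForm E X (Module.finrank ℝ E)) (i : X) (y : E) :
    signedCoord I μ i (θ + θ') y = signedCoord I μ i θ y + signedCoord I μ i θ' y := by
  rw [signedCoord, inChart_add, Pi.add_apply, ContinuousAlternatingMap.add_apply, mul_add]
  rfl

theorem signedCoord_sum {ι : Type*} (s : Finset ι) (μ : DForm E X (Module.finrank ℝ E))
    (θ : ι → DForm E X (Module.finrank ℝ E)) (i : X) (y : E) :
    signedCoord I μ i (∑ j ∈ s, θ j) y = ∑ j ∈ s, signedCoord I μ i (θ j) y := by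
  rw [signedCoord, inChart_sum, Finset.sum_apply, ContinuousAlternatingMap.sum_apply,
    Finset.mul_sum]
  rfl

theorem integral_add {μ : DForm E X (Module.finrank ℝ E)} (hμ : IsVolumeForm I μ)
    {η ζ : InhomForm E X} (hη : IsSmoothForm I η) (hζ : IsSmoothForm I ζ) :
    integral I μ (η + ζ) = integral I μ η + integral I μ ζ := by
  rw [integral_eq_sum, integral_eq_sum, integral_eq_sum, ← Finset.sum_add_distrib]
  refine Finset.sum_congr rfl fun i _ => ?_
  have hint : ∀ {ξ : InhomForm E X}, IsSmoothForm I ξ → IntegrableOn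
      (fun y => chartPartition I X i ((extChartAt I i).symm y) *
        signedCoord I μ i (ξ (Module.finrank ℝ E)) y) (extChartAt I i).target
        (Module.finBasis ℝ E).addHaar := fun hξ =>
    integrableOn_signedCoord _ hμ (hξ _) (isSmoothFun_chartPartition i)
      (isClosed_tsupport _) (chartPartition_isSubordinate i)
      fun x hx => Or.inl (image_eq_zero_of_notMem_tsupport hx)
  rw [← MeasureTheory.integral_add (hint hη) (hint hζ)]
  simp only [Pi.add_apply η ζ, signedCoord_add, mul_add]

theorem eq_sum_funMul_chartPartition (β : InhomForm E X) :
    β = ∑ j ∈ chartIndex I X, funMul (chartPartition I X j) β := by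
  ext1 k
  ext1 x
  rw [Finset.sum_apply, Finset.sum_apply]
  change _ = ∑ j ∈ chartIndex I X, chartPartition I X j x • β k x
  rw [← Finset.sum_smul, sum_chartPartition, one_smul]

theorem extDForm_sum {ι : Type*} {s : Finset ι} {β : ι → InhomForm E X}
    (h : ∀ i ∈ s, IsSmoothForm I (β i)) :
    extDForm I (∑ i ∈ s, β i) = ∑ i ∈ s, extDForm I (β i) := by
  classical
  induction s using Finset.induction_on with
  | empty => simp [extDForm_zero]
  | insert i s hi ih =>
    have hs : ∀ j ∈ s, IsSmoothForm I (β j) := fun j hj => h j (Finset.mem_insert_of_mem hj)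
    rw [Finset.sum_insert hi, Finset.sum_insert hi,
      extDForm_add (h i (Finset.mem_insert_self i s)) (IsSmoothForm.sum hs), ih hs]

/-- Stokes' theorem on a compact manifold without boundary. -/
theorem integral_extDForm_eq_zero {μ : DForm E X (Module.finrank ℝ E)} (hμ : IsVolumeForm I μ)
    {β : InhomForm E X} (hβ : IsSmoothForm I β) : integral I μ (extDForm I β) = 0 := by
  set ν := (Module.finBasis ℝ E).addHaar
  set S := chartIndex I X
  set ρ : X → X → ℝ := fun i => chartPartition I X i with hρ
  have hsm : ∀ j, IsSmoothForm I (funMul (ρ j) β) := fun j =>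
    hβ.funMul (isSmoothFun_chartPartition j)
  set T : X → DForm E X (Module.finrank ℝ E) :=
    fun j => extDForm I (funMul (ρ j) β) (Module.finrank ℝ E) with hTdef
  have hTs : ∀ j, IsSmooth I (T j) := fun j => (hsm j).extDForm _
  have hT : extDForm I β (Module.finrank ℝ E) = ∑ j ∈ S, T j := by
    conv_lhs => rw [eq_sum_funMul_chartPartition (I := I) β]
    rw [extDForm_sum fun j _ => hsm j, Finset.sum_apply]
  have hT0 : ∀ j, ∀ x ∉ tsupport (ρ j), T j x = 0 := by
    intro j x hx
    simp only [hTdef]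
    rcases Module.finrank ℝ E with _ | k
    · rfl
    · exact extD_funMul_eq_zero hx
  have hsub : ∀ j, tsupport (ρ j) ⊆ (extChartAt I j).source := chartPartition_isSubordinate
  have hint : ∀ i j, IntegrableOn (fun y => ρ i ((extChartAt I i).symm y) *
      signedCoord I μ i (T j) y) (extChartAt I i).target ν := fun i j =>
    integrableOn_signedCoord ν hμ (hTs j) (isSmoothFun_chartPartition i) (isClosed_tsupport _)
      (hsub i) fun x hx => Or.inl (image_eq_zero_of_notMem_tsupport hx)
  have hint' : ∀ i j, IntegrableOn (fun y => ρ i ((extChartAt I j).symm y) *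
      signedCoord I μ j (T j) y) (extChartAt I j).target ν := fun i j =>
    integrableOn_signedCoord ν hμ (hTs j) (isSmoothFun_chartPartition i) (isClosed_tsupport (ρ j))
      (hsub j) fun x hx => Or.inr (hT0 j x hx)
  -- Expand `dβ = ∑ d(ρ j β)` and move each term `ρ i d(ρ j β)` from chart `i` to chart `j`. The sum
  -- over `i` then collapses to `1`, leaving the integral of `d(ρ j β)` in the single chart that
  -- contains its support.
  calc integral I μ (extDForm I β)
      = ∑ i ∈ S, ∑ j ∈ S, ∫ y in (extChartAt I i).target,
          ρ i ((extChartAt I i).symm y) * signedCoord I μ i (T j) y ∂ν := by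
        rw [integral_eq_sum, hT]
        refine Finset.sum_congr rfl fun i _ => ?_
        rw [← integral_finsetSum S fun j _ => hint i j]
        simp only [signedCoord_sum, Finset.mul_sum]
        rfl
    _ = ∑ i ∈ S, ∑ j ∈ S, ∫ y in (extChartAt I j).target,
          ρ i ((extChartAt I j).symm y) * signedCoord I μ j (T j) y ∂ν := by
        refine Finset.sum_congr rfl fun i _ => Finset.sum_congr rfl fun j _ => ?_
        exact setIntegral_signedCoord_eq ν μ (T j) (ρ i)
          (fun x hx => image_eq_zero_of_notMem_tsupport fun h => hx (hsub i h))
          (fun x hx => hT0 j x fun h => hx (hsub j h))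
    _ = ∑ j ∈ S, ∫ y in (extChartAt I j).target, signedCoord I μ j (T j) y ∂ν := by
        rw [Finset.sum_comm]
        refine Finset.sum_congr rfl fun j _ => ?_
        rw [← integral_finsetSum S fun i _ => hint' i j]
        simp only [← Finset.sum_mul]
        have h1 : ∀ x, ∑ i ∈ S, ρ i x = 1 := sum_chartPartition
        simp only [h1, one_mul]
    _ = 0 := Finset.sum_eq_zero fun j _ =>
        setIntegral_signedCoord_extD_eq_zero ν hμ (isSmoothFun_chartPartition j) (hsub j) hβ

end Stokes

end EquivForms

namespace EquivForms

/-! ### Cartan's formula for a flow in a chart. -/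

section Cartan

variable {E : Type*} [NormedAddCommGroup E] [NormedSpace ℝ E]

theorem vec_single {A : Type*} (f : Fin 1 → A) : f = ![f 0] := by
  ext i; fin_cases i; rfl

/-- Cartan's formula in a chart: if the `1`-form `B` is invariant under the flow `Φ` with velocity
field `W`, then `d (ι_W B) + ι_W (d B) = 0`. -/
theorem extDeriv_curryLeft_add_curryLeft_extDeriv {Φ : ℝ × E → E} {B : E → E [⋀^Fin 1]→L[ℝ] ℝ}
    {y : E} (hΦ : ContDiffAt ℝ ∞ Φ (0, y)) (hΦ0 : ∀ᶠ z in 𝓝 y, Φ (0, z) = z)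
    (hB : ContDiffAt ℝ ∞ B y)
    (hinv : ∀ᶠ p in 𝓝 ((0, y) : ℝ × E), (B (Φ p)).compContinuousLinearMap
      ((fderiv ℝ Φ p).comp (ContinuousLinearMap.inr ℝ ℝ E)) = B p.2) :
    extDeriv (fun z => (B z).curryLeft (fderiv ℝ Φ (0, z) (1, 0))) y +
      (extDeriv B y).curryLeft (fderiv ℝ Φ (0, y) (1, 0)) = 0 := by
  have hy : Φ (0, y) = y := hΦ0.self_of_nhds
  -- `C` is the pullback `Φ^* B` on space-time. Since `dC = Φ^* dB`, evaluating `dC` at `t = 0` on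
  -- `∂_t` and `e` gives both `(ι_W dB)(e)` and `∂_t (C(e)) - ∂_e (C(∂_t))`. The first derivative
  -- vanishes by invariance; the second is `d(ι_W B)(e)`.
  set C : ℝ × E → (ℝ × E) [⋀^Fin 1]→L[ℝ] ℝ := fun p =>
    (B (Φ p)).compContinuousLinearMap (fderiv ℝ Φ p) with hC
  have hBd : DifferentiableAt ℝ B (Φ (0, y)) := by
    rw [hy]; exact hB.differentiableAt (by simp)
  have hdC : extDeriv C (0, y) = (extDeriv B y).compContinuousLinearMap (fderiv ℝ Φ (0, y)) := by
    have := extDeriv_pullback hBd hΦ minSmoothness_two_le_infty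
    rwa [hy] at this
  have hΦd : ContDiffAt ℝ ∞ (fderiv ℝ Φ) (0, y) := hΦ.fderiv_right (m := ∞) (by simp)
  have hCd : DifferentiableAt ℝ C (0, y) := by
    refine DifferentiableAt.continuousAlternatingMapCompContinuousLinearMap ?_
      (hΦd.differentiableAt (by simp))
    exact hBd.comp _ (hΦ.differentiableAt (by simp))
  have hΦ1 : HasFDerivAt (fun z => Φ (0, z))
      ((fderiv ℝ Φ (0, y)).comp (ContinuousLinearMap.inr ℝ ℝ E)) y :=
    (hΦ.differentiableAt (by simp)).hasFDerivAt.comp y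
      (hasFDerivAt_prodMk_right (0 : ℝ) y)
  have hid : (fderiv ℝ Φ (0, y)).comp (ContinuousLinearMap.inr ℝ ℝ E) =
      ContinuousLinearMap.id ℝ E :=
    hΦ1.unique ((hasFDerivAt_id y).congr_of_eventuallyEq hΦ0)
  ext v
  rw [vec_single v]
  set e := v 0
  have h1 := extDeriv_apply hCd ![(1, 0), (0, e)]
  rw [Fin.sum_univ_two] at h1
  have hr0 : Fin.removeNth 0 ![((1 : ℝ), (0 : E)), (0, e)] = ![(0, e)] := by
    ext i <;> fin_cases i <;> rfl
  have hr1 : Fin.removeNth 1 ![((1 : ℝ), (0 : E)), (0, e)] = ![(1, 0)] := by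
    ext i <;> fin_cases i <;> rfl
  rw [hr0, hr1] at h1
  have hA : fderiv ℝ (fun p => C p ![(0, e)]) (0, y) (1, 0) = 0 := by
    have he : (fun p => C p ![(0, e)]) =ᶠ[𝓝 ((0 : ℝ), y)] fun p => B p.2 ![e] := by
      filter_upwards [hinv] with p hp
      rw [← hp]
      simp only [hC, ContinuousAlternatingMap.compContinuousLinearMap_apply]
      congr 1
      ext i; fin_cases i; rfl
    have hB1 : DifferentiableAt ℝ (fun z => B z ![e]) y :=
      (ContinuousAlternatingMap.apply ℝ E ℝ ![e]).differentiableAt.comp y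
        (hB.differentiableAt (by simp))
    have h2 : HasFDerivAt (fun p : ℝ × E => B p.2 ![e])
        ((fderiv ℝ (fun z => B z ![e]) y).comp (ContinuousLinearMap.snd ℝ ℝ E)) (0, y) :=
      HasFDerivAt.comp (g := fun z => B z ![e]) ((0 : ℝ), y) hB1.hasFDerivAt hasFDerivAt_snd
    rw [he.fderiv_eq, h2.fderiv]
    simp
  have hD : extDeriv (fun z => (B z).curryLeft (fderiv ℝ Φ (0, z) (1, 0))) y ![e] =
      fderiv ℝ (fun p => C p ![(1, 0)]) (0, y) (0, e) := by
    have hC1 : DifferentiableAt ℝ (fun p => C p ![(1, 0)]) (0, y) :=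
      (ContinuousAlternatingMap.apply ℝ (ℝ × E) ℝ ![((1 : ℝ), (0 : E))]).differentiableAt.comp _ hCd
    have h3 : HasFDerivAt (fun z : E => C (0, z) ![(1, 0)])
        ((fderiv ℝ (fun p => C p ![(1, 0)]) (0, y)).comp (ContinuousLinearMap.inr ℝ ℝ E)) y :=
      HasFDerivAt.comp (g := fun p => C p ![(1, 0)]) y hC1.hasFDerivAt
        (hasFDerivAt_prodMk_right (0 : ℝ) y)
    have h4 : (fun z => (B z).curryLeft (fderiv ℝ Φ (0, z) (1, 0))) =ᶠ[𝓝 y] fun z =>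
        ContinuousAlternatingMap.constOfIsEmpty ℝ E (Fin 0) (C (0, z) ![(1, 0)]) := by
      filter_upwards [hΦ0] with z hz
      ext u
      simp only [hC, hz, ContinuousAlternatingMap.curryLeft_apply_apply,
        ContinuousAlternatingMap.compContinuousLinearMap_apply,
        ContinuousAlternatingMap.constOfIsEmpty_apply]
      congr 1
      ext i; fin_cases i; rfl
    rw [h4.extDeriv_eq, extDeriv_constOfIsEmpty, h3.fderiv]
    rfl
  have hE : extDeriv C (0, y) ![(1, 0), (0, e)] =
      (extDeriv B y).curryLeft (fderiv ℝ Φ (0, y) (1, 0)) ![e] := by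
    rw [hdC, ContinuousAlternatingMap.compContinuousLinearMap_apply,
      ContinuousAlternatingMap.curryLeft_apply_apply]
    congr 1
    have h5 : fderiv ℝ Φ (0, y) (0, e) = e := DFunLike.congr_fun hid e
    ext i; fin_cases i
    · rfl
    · exact h5
  rw [ContinuousAlternatingMap.add_apply, hD, ← hE, h1]
  simp [hA]

end Cartan

/-! ### Circle actions in charts. -/

section Action

variable {E : Type*} [NormedAddCommGroup E] [NormedSpace ℝ E]
  {H : Type*} [TopologicalSpace H] {I : ModelWithCorners ℝ E H}
  {X : Type*} [TopologicalSpace X] [ChartedSpace H X]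
  [I.Boundaryless] [IsManifold I ∞ X] [MulAction Circle X]

/-- The flow of a circle action in a preferred chart. -/
def flowChart (I : ModelWithCorners ℝ E H) (x₀ : X) (p : ℝ × E) : E :=
  extChartAt I x₀ (Circle.exp p.1 • (extChartAt I x₀).symm p.2)

theorem flowChart_zero {x₀ : X} {y : E} (hy : y ∈ (extChartAt I x₀).target) :
    flowChart I x₀ (0, y) = y := by
  rw [flowChart, Circle.exp_zero, one_smul, (extChartAt I x₀).right_inv hy]

section Smooth

variable (hA : ContMDiff ((𝓡 1).prod I) I ∞ (fun q : Circle × X => q.1 • q.2))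
include hA

theorem contMDiffAt_flow {x₀ : X} {p : ℝ × E} (hp : p.2 ∈ (extChartAt I x₀).target) :
    ContMDiffAt 𝓘(ℝ, ℝ × E) I ∞
      (fun p : ℝ × E => Circle.exp p.1 • (extChartAt I x₀).symm p.2) p := by
  have h1 : ContMDiffAt 𝓘(ℝ, ℝ × E) (𝓡 1) ∞ (fun p : ℝ × E => Circle.exp p.1) p :=
    contMDiff_circleExp.contMDiffAt.comp p contDiff_fst.contMDiff.contMDiffAt
  have h2 : ContMDiffAt 𝓘(ℝ, ℝ × E) I ∞ (fun p : ℝ × E => (extChartAt I x₀).symm p.2) p :=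
    ((contMDiffOn_extChartAt_symm (I := I) (n := ∞) x₀).contMDiffAt
      ((isOpen_extChartAt_target x₀).mem_nhds hp)).comp p contDiff_snd.contMDiff.contMDiffAt
  exact hA.contMDiffAt.comp p (h1.prodMk h2)

theorem contDiffAt_flowChart {x₀ : X} {p : ℝ × E} (hp : p.2 ∈ (extChartAt I x₀).target)
    (hx : Circle.exp p.1 • (extChartAt I x₀).symm p.2 ∈ (extChartAt I x₀).source) :
    ContDiffAt ℝ ∞ (flowChart I x₀) p := by
  rw [extChartAt_source] at hx
  have h1 : ContMDiffAt I 𝓘(ℝ, E) ∞ (extChartAt I x₀)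
    (Circle.exp p.1 • (extChartAt I x₀).symm p.2) := contMDiffAt_extChartAt' hx
  exact contMDiffAt_iff_contDiffAt.1 (h1.comp p (contMDiffAt_flow hA hp))

theorem contDiffAt_flowChart_zero {x₀ : X} {y : E} (hy : y ∈ (extChartAt I x₀).target) :
    ContDiffAt ℝ ∞ (flowChart I x₀) (0, y) := by
  refine contDiffAt_flowChart hA hy ?_
  rw [Circle.exp_zero, one_smul]
  exact (extChartAt I x₀).map_target hy

theorem mdifferentiable_smul (g : Circle) : MDifferentiable I I (fun x : X => g • x) := by
  intro x
  have h : ContMDiff I I ∞ (fun x : X => g • x) :=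
    hA.comp (contMDiff_const.prodMk contMDiff_id)
  exact h.mdifferentiable (by simp) x

theorem mdifferentiable_orbit (x : X) :
    MDifferentiable 𝓘(ℝ, ℝ) I (fun t : ℝ => Circle.exp t • x) := by
  have h : ContMDiff 𝓘(ℝ, ℝ) I ∞ (fun t : ℝ => Circle.exp t • x) :=
    hA.comp (contMDiff_circleExp.prodMk contMDiff_const)
  exact h.mdifferentiable (by simp)

/-- By the chain rule, the generating vector field in a chart is the time derivative of the local
flow; its smoothness follows from that of the flow. -/
theorem chartD_actionField {x₀ : X} {y : E} (hy : y ∈ (extChartAt I x₀).target) :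
    chartD I x₀ ((extChartAt I x₀).symm y) (actionField I X ((extChartAt I x₀).symm y)) =
      fderiv ℝ (flowChart I x₀) (0, y) (1, 0) := by
  set x := (extChartAt I x₀).symm y
  have h1 := mfderiv_comp_apply_of_eq (x := (0 : ℝ)) (y := x)
    (mdifferentiableAt_extChartAt_of_mem (I := I) (x₀ := x₀) ((extChartAt I x₀).map_target hy))
    (mdifferentiable_orbit hA x 0) (by simp) (1 : ℝ)
  have h2 : HasFDerivAt (fun t : ℝ => flowChart I x₀ (t, y))
      ((fderiv ℝ (flowChart I x₀) (0, y)).comp (ContinuousLinearMap.inl ℝ ℝ E)) 0 :=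
    HasFDerivAt.comp (g := flowChart I x₀) (f := fun t : ℝ => (t, y)) (0 : ℝ)
      ((contDiffAt_flowChart_zero hA hy).differentiableAt (by simp)).hasFDerivAt
      (hasFDerivAt_prodMk_left (0 : ℝ) y)
  have h3 : mfderiv 𝓘(ℝ, ℝ) 𝓘(ℝ, E) (extChartAt I x₀ ∘ fun t : ℝ => Circle.exp t • x) 0 =
      (fderiv ℝ (flowChart I x₀) (0, y)).comp (ContinuousLinearMap.inl ℝ ℝ E) := by
    rw [mfderiv_eq_fderiv]
    exact h2.fderiv
  rw [h3] at h1
  exact h1.symm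

theorem isSmoothField_actionField : IsSmoothField I (actionField I X) := by
  intro x₀ y hy
  have h1 : ContDiffAt ℝ ∞ (fun z => fderiv ℝ (flowChart I x₀) (0, z) (1, 0)) y := by
    have h2 : ContDiffAt ℝ ∞ (fderiv ℝ (flowChart I x₀)) (0, y) :=
      (contDiffAt_flowChart_zero hA hy).fderiv_right (m := ∞) (by simp)
    exact (h2.comp y (contDiffAt_const.prodMk contDiffAt_id)).clm_apply contDiffAt_const
  refine h1.congr_of_eventuallyEq ?_
  filter_upwards [(isOpen_extChartAt_target x₀).mem_nhds hy] with z hz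
  exact chartD_actionField hA hz

/-- Supplies the invariance hypothesis of the chart version of Cartan's formula. It is valid only as
long as the orbit stays in the chart, hence the condition `hx`. -/
theorem inChart_flowChart_of_isInvariant {k : ℕ} {V : DForm E X k} (hV : IsInvariant I V) {x₀ : X}
    {p : ℝ × E} (hp : p.2 ∈ (extChartAt I x₀).target)
    (hx : Circle.exp p.1 • (extChartAt I x₀).symm p.2 ∈ (extChartAt I x₀).source) :
    (inChart I x₀ V (flowChart I x₀ p)).compContinuousLinearMap
      ((fderiv ℝ (flowChart I x₀) p).comp (ContinuousLinearMap.inr ℝ ℝ E)) =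
        inChart I x₀ V p.2 := by
  obtain ⟨t, y⟩ := p
  dsimp only at hp hx ⊢
  set x := (extChartAt I x₀).symm y with hxdef
  set g := Circle.exp t with hg
  set G : E →L[ℝ] E := mfderiv I I (fun x : X => g • x) x with hG
  have h1 : HasFDerivAt (fun z => flowChart I x₀ (t, z))
      ((fderiv ℝ (flowChart I x₀) (t, y)).comp (ContinuousLinearMap.inr ℝ ℝ E)) y :=
    ((contDiffAt_flowChart hA (p := (t, y)) hp hx).differentiableAt (by simp)).hasFDerivAt.comp y
      (hasFDerivAt_prodMk_right t y)
  have h2 : (fderiv ℝ (flowChart I x₀) (t, y)).comp (ContinuousLinearMap.inr ℝ ℝ E) =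
      (chartD I x₀ (g • x)).comp (G.comp (chartSymmD I x₀ y)) := by
    rw [← h1.fderiv, ← mfderiv_eq_fderiv]
    have h3 : MDifferentiableAt 𝓘(ℝ, E) I (fun z => g • (extChartAt I x₀).symm z) y :=
      (mdifferentiable_smul hA g _).comp y (mdifferentiableAt_extChartAt_symm hp)
    refine (mfderiv_comp y (mdifferentiableAt_extChartAt_of_mem hx) h3).trans ?_
    exact congrArg _ (mfderiv_comp y (mdifferentiable_smul hA g _)
      (mdifferentiableAt_extChartAt_symm hp))
  have h4 : (extChartAt I x₀).symm (flowChart I x₀ (t, y)) = g • x :=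
    (extChartAt I x₀).left_inv hx
  have h5 : (V (g • x)).compContinuousLinearMap G = V x := congrFun (hV g) x
  have h6 : (chartSymmD I x₀ (flowChart I x₀ (t, y))).comp (chartD I x₀ (g • x)) =
      ContinuousLinearMap.id ℝ E := chartSymmD_comp_chartD (I := I) (x₀ := x₀) hx
  rw [h2, inChart_apply, inChart_apply, h4, ← hxdef, ← h5]
  ext v
  simp only [ContinuousAlternatingMap.compContinuousLinearMap_apply]
  congr 1
  ext1 i
  exact DFunLike.congr_fun h6 (G (chartSymmD I x₀ y (v i)))

/-- Cartan's formula for the vector field of a circle action and an invariant `1`-form. -/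
theorem extD_curryLeft_add_curryLeft_extD {V : DForm E X 1} (hV : IsSmooth I V)
    (hinv : IsInvariant I V) :
    extD I (fun x => (V x).curryLeft (actionField I X x)) +
      (fun x => (extD I V x).curryLeft (actionField I X x)) = 0 := by
  have hw : IsSmoothField I (actionField I X) := isSmoothField_actionField hA
  refine form_ext_inChart (I := I) fun x₀ y hy => ?_
  -- The set where the flow stays in the chart is an open neighbourhood of `(0, y)`, which is all
  -- the chart version needs.
  have hopen : IsOpen {p : ℝ × E | p.2 ∈ (extChartAt I x₀).target ∧
      Circle.exp p.1 • (extChartAt I x₀).symm p.2 ∈ (extChartAt I x₀).source} := by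
    have hc : ContinuousOn (fun p : ℝ × E => Circle.exp p.1 • (extChartAt I x₀).symm p.2)
        {p : ℝ × E | p.2 ∈ (extChartAt I x₀).target} := fun p hp =>
      (contMDiffAt_flow hA hp).continuousAt.continuousWithinAt
    exact hc.isOpen_inter_preimage ((isOpen_extChartAt_target x₀).preimage continuous_snd)
      (isOpen_extChartAt_source x₀)
  have h0 : ((0 : ℝ), y) ∈ {p : ℝ × E | p.2 ∈ (extChartAt I x₀).target ∧
      Circle.exp p.1 • (extChartAt I x₀).symm p.2 ∈ (extChartAt I x₀).source} := by
    refine ⟨hy, ?_⟩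
    rw [Circle.exp_zero, one_smul]
    exact (extChartAt I x₀).map_target hy
  have key := extDeriv_curryLeft_add_curryLeft_extDeriv (contDiffAt_flowChart_zero hA hy)
    (B := inChart I x₀ V)
    (by filter_upwards [(isOpen_extChartAt_target (I := I) x₀).mem_nhds hy] with z hz using
      flowChart_zero hz)
    (hV.contDiffAt hy)
    (by filter_upwards [hopen.mem_nhds h0] with p hp using
      inChart_flowChart_of_isInvariant hA hinv hp.1 hp.2)
  have h7 : inChart I x₀ (fun x => (V x).curryLeft (actionField I X x)) =ᶠ[𝓝 y]
      fun z => (inChart I x₀ V z).curryLeft (fderiv ℝ (flowChart I x₀) (0, z) (1, 0)) := by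
    filter_upwards [(isOpen_extChartAt_target (I := I) x₀).mem_nhds hy] with z hz
    rw [inChart_curryLeft _ _ hz, chartD_actionField hA hz]
  rw [inChart_add, Pi.add_apply, inChart_extD (hV.curryLeft hw) hy, h7.extDeriv_eq,
    inChart_curryLeft _ _ hy, chartD_actionField hA hy, inChart_extD hV hy, key]
  rfl

end Smooth

end Action

end EquivForms

namespace EquivForms

/-! ### The form `dφ`: smooth, closed, with value `1` on `u` and on `w`. -/

section LocallyExact

variable {E : Type*} [NormedAddCommGroup E] [NormedSpace ℝ E]
  {H : Type*} [TopologicalSpace H] {I : ModelWithCorners ℝ E H}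
  {X : Type*} [TopologicalSpace X] [ChartedSpace H X]
  [I.Boundaryless] [IsManifold I ∞ X]

/-- A form is locally exact if near every point of every chart it is the exterior derivative of a
smooth form. -/
def IsLocallyExact (I : ModelWithCorners ℝ E H) {k : ℕ} (η : DForm E X (k + 1)) : Prop :=
  ∀ x₀ : X, ∀ y ∈ (extChartAt I x₀).target, ∃ B : E → E [⋀^Fin k]→L[ℝ] ℝ,
    ContDiffAt ℝ ∞ B y ∧ inChart I x₀ η =ᶠ[𝓝 y] extDeriv B

theorem IsLocallyExact.isSmooth {k : ℕ} {η : DForm E X (k + 1)} (hη : IsLocallyExact I η) :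
    IsSmooth I η :=
  isSmooth_of_contDiffAt fun x₀ y hy => by
    obtain ⟨B, hB, h⟩ := hη x₀ y hy
    exact (contDiffAt_extDeriv hB).congr_of_eventuallyEq h

theorem IsLocallyExact.extD_eq_zero {k : ℕ} {η : DForm E X (k + 1)} (hη : IsLocallyExact I η) :
    extD I η = 0 :=
  form_ext_inChart fun x₀ y hy => by
    obtain ⟨B, hB, h⟩ := hη x₀ y hy
    rw [inChart_extD hη.isSmooth hy, h.extDeriv_eq,
      extDeriv_extDeriv_apply hB minSmoothness_two_le_infty]
    rfl

end LocallyExact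

section Product

variable {n : ℕ} {M : Type*} [TopologicalSpace M] [ChartedSpace (EuclideanSpace ℝ (Fin n)) M]

theorem contMDiff_circle_coe : ContMDiff (𝓡 1) 𝓘(ℝ, ℂ) ∞ (fun z : Circle => (z : ℂ)) := by
  have := finrank_real_complex_fact'
  exact contMDiff_coe_sphere (E := ℂ) (n := 1)

theorem contMDiff_snd_coe :
    ContMDiff (prodModel n) 𝓘(ℝ, ℂ) ∞ (fun q : M × Circle => (q.2 : ℂ)) :=
  contMDiff_circle_coe.comp contMDiff_snd

/-- The derivative of the complex coordinate on the circle factor. -/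
def circleCoordD (q : M × Circle) : ProdSpace n →L[ℝ] ℂ :=
  mfderiv (prodModel n) 𝓘(ℝ, ℂ) (fun r : M × Circle => (r.2 : ℂ)) q

theorem dAngle_apply (q : M × Circle) (v : Fin 1 → ProdSpace n) :
    dAngle n M q v = ((q.2 : ℂ)⁻¹ * circleCoordD q (v 0)).im := rfl

/-- The value of `dφ` at the velocity of a curve that rotates at unit speed in the circle factor
is `1`. -/
theorem dAngle_curryLeft_velocity {γ : ℝ → M × Circle} {q : M × Circle} {v : ProdSpace n}
    (hγ : MDifferentiableAt 𝓘(ℝ, ℝ) (prodModel n) γ 0) (h0 : γ 0 = q)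
    (h : ∀ t, (γ t).2 = Circle.exp t * q.2)
    (hv : v = (mfderiv 𝓘(ℝ, ℝ) (prodModel n) γ 0 : ℝ →L[ℝ] ProdSpace n) (1 : ℝ)) :
    (dAngle n M q).curryLeft v =
      ContinuousAlternatingMap.constOfIsEmpty ℝ (ProdSpace n) (Fin 0) 1 := by
  have h1 := mfderiv_comp_apply_of_eq (x := (0 : ℝ)) (y := q)
    (contMDiff_snd_coe.mdifferentiable (by simp) q) hγ h0 (1 : ℝ)
  have h2 : HasDerivAt (fun t : ℝ => Complex.exp (t * Complex.I) * (q.2 : ℂ))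
      (Complex.I * (q.2 : ℂ)) 0 := by
    have h3 : HasDerivAt (fun t : ℝ => Complex.exp (t * Complex.I)) Complex.I 0 := by
      have := ((Complex.ofRealCLM.hasDerivAt (x := (0 : ℝ))).mul_const Complex.I).cexp
      simpa using this
    exact h3.mul_const _
  have h3 : (fun r : M × Circle => (r.2 : ℂ)) ∘ γ =
      fun t : ℝ => Complex.exp (t * Complex.I) * (q.2 : ℂ) := by
    funext t
    simp [h t, Circle.coe_exp]
  have h5 : circleCoordD q v = Complex.I * (q.2 : ℂ) := by
    rw [hv]
    refine h1.symm.trans ?_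
    rw [h3, mfderiv_eq_fderiv]
    exact h2.deriv
  ext v'
  rw [ContinuousAlternatingMap.curryLeft_apply_apply, dAngle_apply, Matrix.vecCons,
    Fin.cons_zero, h5, mul_left_comm, inv_mul_cancel₀ (Circle.coe_ne_zero q.2)]
  simp

theorem interiorProd_angleField_dAngle :
    interiorProd (angleField n M) (ofDegree (dAngle n M)) = oneForm := by
  rw [interiorProd_ofDegree_succ, oneForm]
  congr 1
  funext q
  refine dAngle_curryLeft_velocity ?_ (by simp) (fun t => rfl) rfl
  have h : ContMDiff 𝓘(ℝ, ℝ) (prodModel n) ∞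
      (fun t : ℝ => ((q.1, Circle.exp t * q.2) : M × Circle)) :=
    contMDiff_const.prodMk (contMDiff_circleExp.mul contMDiff_const)
  exact h.mdifferentiable (by simp) 0

variable [MulAction Circle M] [IsManifold (𝓡 n) ∞ M]

theorem contMDiff_diag_smul
    (hact : ContMDiff ((𝓡 1).prod (𝓡 n)) (𝓡 n) ∞ (fun q : Circle × M => q.1 • q.2)) :
    ContMDiff ((𝓡 1).prod (prodModel n)) (prodModel n) ∞
      (fun q : Circle × (M × Circle) => q.1 • q.2) := by
  have h1 : ContMDiff ((𝓡 1).prod (prodModel n)) (𝓡 n) ∞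
      (fun q : Circle × (M × Circle) => q.1 • q.2.1) :=
    hact.comp (contMDiff_fst.prodMk (contMDiff_fst.comp contMDiff_snd))
  have h2 : ContMDiff ((𝓡 1).prod (prodModel n)) (𝓡 1) ∞
      (fun q : Circle × (M × Circle) => q.1 * q.2.2) :=
    contMDiff_fst.mul (contMDiff_snd.comp contMDiff_snd)
  exact h1.prodMk h2

/-- Whatever the action on `M`, diagonal orbits rotate the circle factor at unit speed, just as the
orbits of `u` do. -/
theorem interiorProd_diagField_dAngle
    (hact : ContMDiff ((𝓡 1).prod (𝓡 n)) (𝓡 n) ∞ (fun q : Circle × M => q.1 • q.2)) :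
    interiorProd (diagField n M) (ofDegree (dAngle n M)) = oneForm := by
  rw [interiorProd_ofDegree_succ, oneForm]
  congr 1
  funext q
  refine dAngle_curryLeft_velocity ?_ (by simp) (fun t => rfl) rfl
  exact mdifferentiable_orbit (contMDiff_diag_smul hact) q 0

theorem isSmoothField_diagField
    (hact : ContMDiff ((𝓡 1).prod (𝓡 n)) (𝓡 n) ∞ (fun q : Circle × M => q.1 • q.2)) :
    IsSmoothField (prodModel n) (diagField n M) :=
  isSmoothField_actionField (contMDiff_diag_smul hact)

/-- The angle is a local primitive, given by a branch of `Im log z`. This one fact yields both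
smoothness and closedness of `dφ`. -/
theorem isLocallyExact_dAngle : IsLocallyExact (prodModel n) (dAngle n M) := by
  intro x₀ y hy
  set Z : ProdSpace n → ℂ := fun z => (((extChartAt (prodModel n) x₀).symm z).2 : ℂ) with hZ
  have hZs : ∀ z ∈ (extChartAt (prodModel n) x₀).target, ContDiffAt ℝ ∞ Z z := fun z hz =>
    contMDiffAt_iff_contDiffAt.1 (contMDiff_snd_coe.contMDiffAt.comp z
      ((contMDiffOn_extChartAt_symm (I := prodModel n) (n := ∞) x₀).contMDiffAt
        ((isOpen_extChartAt_target x₀).mem_nhds hz)))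
  have hZ0 : ∀ z, Z z ≠ 0 := fun z => Circle.coe_ne_zero _
  -- Dividing by `Z y` places the base value at `1`, away from the cut of the principal logarithm,
  -- without changing the differential.
  set L : ProdSpace n → ℝ := fun z => (Complex.log ((Z y)⁻¹ * Z z)).im with hL
  have hslit : ∀ᶠ z in 𝓝 y, (Z y)⁻¹ * Z z ∈ Complex.slitPlane := by
    have hc : ContinuousAt (fun z => (Z y)⁻¹ * Z z) y :=
      continuousAt_const.mul (hZs y hy).continuousAt
    refine hc.eventually_mem (Complex.isOpen_slitPlane.mem_nhds ?_)
    rw [inv_mul_cancel₀ (hZ0 y)]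
    exact Complex.one_mem_slitPlane
  refine ⟨fun z => ContinuousAlternatingMap.constOfIsEmpty ℝ (ProdSpace n) (Fin 0) (L z), ?_, ?_⟩
  · have h1 := (ContinuousAlternatingMap.constOfIsEmptyLIE ℝ (ProdSpace n) ℝ (Fin 0)).contDiff
      (n := ∞)
    have h2 : ContDiffAt ℝ ∞ (fun z => Complex.log ((Z y)⁻¹ * Z z)) y :=
      ContDiffAt.comp (g := Complex.log) y
      ((Complex.contDiffAt_log hslit.self_of_nhds).restrict_scalars ℝ)
      (contDiffAt_const.mul (hZs y hy))
    exact h1.contDiffAt.comp y (Complex.imCLM.contDiff.contDiffAt.comp y h2)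
  · filter_upwards [hslit, (isOpen_extChartAt_target (I := prodModel n) x₀).mem_nhds hy]
      with z hz hzt
    rw [extDeriv_constOfIsEmpty]
    have h1 : HasFDerivAt Z (fderiv ℝ Z z) z :=
      ((hZs z hzt).differentiableAt (by simp)).hasFDerivAt
    have h2 : HasFDerivAt L (Complex.imCLM.comp
        (((Z y)⁻¹ * Z z)⁻¹ • ((Z y)⁻¹ • fderiv ℝ Z z))) z :=
      HasFDerivAt.comp (g := Complex.imCLM) (f := fun z => Complex.log ((Z y)⁻¹ * Z z)) z
        Complex.imCLM.hasFDerivAt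
        (HasDerivAt.comp_hasFDerivAt (f := fun z => (Z y)⁻¹ * Z z) z (Complex.hasDerivAt_log hz)
          (h1.const_mul ((Z y)⁻¹)))
    rw [h2.fderiv]
    have h3 : fderiv ℝ Z z = (circleCoordD ((extChartAt (prodModel n) x₀).symm z)).comp
          (chartSymmD (prodModel n) x₀ z) := by
      rw [← mfderiv_eq_fderiv]
      exact mfderiv_comp z (contMDiff_snd_coe.mdifferentiable (by simp) _)
        (mdifferentiableAt_extChartAt_symm hzt)
    ext v
    rw [h3]
    change ((Z z)⁻¹ * _).im = (((Z y)⁻¹ * Z z)⁻¹ * ((Z y)⁻¹ * _)).im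
    rw [mul_inv, inv_inv, mul_assoc, mul_left_comm (Z y), ← mul_assoc (Z y),
      mul_inv_cancel₀ (hZ0 y), one_mul]
    rfl

theorem extDForm_dAngle : extDForm (prodModel n) (ofDegree (dAngle n M)) = 0 := by
  rw [extDForm_ofDegree, isLocallyExact_dAngle.extD_eq_zero]
  exact Pi.single_zero _

end Product

end EquivForms

namespace EquivForms

/-! ### The function `(e^{tx} - 1)/x` and its Taylor coefficients. -/

section DividedDifference

/-- The divided Taylor coefficients of `x ↦ (e^{t x} - 1) / x`. -/
def expSlope (t : ℝ) (m : ℕ) : ℝ → ℝ := fun x =>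
  (m.factorial : ℝ)⁻¹ * iteratedDeriv m (dslope (fun x => Real.exp (t * x)) 0) x

/-- Away from `0` it is a quotient of analytic functions; at `0` the power series of the
exponential, shifted by one, is a power series for it. -/
theorem contDiff_dslope_exp (t : ℝ) : ContDiff ℝ ∞ (dslope (fun x => Real.exp (t * x)) 0) := by
  have hexp : ∀ x, AnalyticAt ℝ (fun x => Real.exp (t * x)) x := fun x => by fun_prop
  rw [contDiff_iff_contDiffAt]
  intro x
  refine AnalyticAt.contDiffAt ?_
  rcases eq_or_ne x 0 with rfl | hx
  · obtain ⟨p, hp⟩ := hexp 0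
    exact hp.has_fpower_series_dslope_fslope.analyticAt
  · have h : (fun x => x⁻¹ * (Real.exp (t * x) - Real.exp (t * 0))) =ᶠ[𝓝 x]
        dslope (fun x => Real.exp (t * x)) 0 := by
      filter_upwards [isOpen_ne.mem_nhds hx] with z hz
      rw [dslope_of_ne _ hz, slope_def_field]
      rw [sub_zero, div_eq_inv_mul]
    refine AnalyticAt.congr ?_ h
    exact (analyticAt_id.inv hx).mul ((hexp x).sub analyticAt_const)

theorem contDiff_iteratedDeriv_dslope_exp (t : ℝ) (m : ℕ) :
    ContDiff ℝ ∞ (iteratedDeriv m (dslope (fun x => Real.exp (t * x)) 0)) := by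
  rw [iteratedDeriv_eq_iterate]
  exact ContDiff.iterate_deriv m (contDiff_dslope_exp t)

theorem contDiff_expSlope (t : ℝ) (m : ℕ) : ContDiff ℝ ∞ (expSlope t m) :=
  contDiff_const.mul (contDiff_iteratedDeriv_dslope_exp t m)

theorem hasDerivAt_expSlope (t : ℝ) (m : ℕ) (x : ℝ) :
    HasDerivAt (expSlope t m) (((m : ℝ) + 1) * expSlope t (m + 1) x) x := by
  have h1 : HasDerivAt (iteratedDeriv m (dslope (fun x => Real.exp (t * x)) 0))
      (iteratedDeriv (m + 1) (dslope (fun x => Real.exp (t * x)) 0) x) x := by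
    rw [iteratedDeriv_succ]
    exact ((contDiff_iteratedDeriv_dslope_exp t m).differentiable (by simp) x).hasDerivAt
  have h2 : ((m : ℝ) + 1) * expSlope t (m + 1) x = (m.factorial : ℝ)⁻¹ *
      iteratedDeriv (m + 1) (dslope (fun x => Real.exp (t * x)) 0) x := by
    rw [expSlope, Nat.factorial_succ]
    push_cast
    have : (m.factorial : ℝ) ≠ 0 := by positivity
    field_simp
  rw [h2]
  exact h1.const_mul _

theorem mul_expSlope_zero (t x : ℝ) : x * expSlope t 0 x = Real.exp (t * x) - 1 := by
  have := sub_smul_dslope (fun x => Real.exp (t * x)) 0 x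
  simpa [expSlope] using this

/-- These are the Taylor coefficients of the two sides of `x g(x) = e^{tx} - 1`. By Leibniz, the
coefficient of order `m + 1` on the left is `x g_{m+1} + g_m`. -/
theorem mul_expSlope_succ (t : ℝ) (m : ℕ) (x : ℝ) :
    x * expSlope t (m + 1) x + expSlope t m x =
      ((m + 1).factorial : ℝ)⁻¹ * t ^ (m + 1) * Real.exp (t * x) := by
  have hexp : ∀ x, HasDerivAt (fun x => Real.exp (t * x)) (t * Real.exp (t * x)) x := fun x => by
    simpa [mul_comm] using ((hasDerivAt_id x).const_mul t).exp
  induction m generalizing x with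
  | zero =>
    have h1 := (hasDerivAt_id x).mul (hasDerivAt_expSlope t 0 x)
    have h2 : (id * expSlope t 0) = fun x => Real.exp (t * x) - 1 :=
      funext fun x => mul_expSlope_zero t x
    rw [h2] at h1
    have h3 := h1.unique ((hexp x).sub_const 1)
    simp only [id, CharP.cast_eq_zero, zero_add, one_mul] at h3
    simp only [zero_add, Nat.factorial_one, Nat.cast_one, inv_one, pow_one, one_mul]
    linarith
  | succ m ih =>
    have h1 := ((hasDerivAt_id x).mul (hasDerivAt_expSlope t (m + 1) x)).add
      (hasDerivAt_expSlope t m x)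
    have h2 : (id * expSlope t (m + 1) + expSlope t m) = fun x =>
        ((m + 1).factorial : ℝ)⁻¹ * t ^ (m + 1) * Real.exp (t * x) := funext fun x => ih x
    rw [h2] at h1
    have h3 := h1.unique ((hexp x).const_mul _)
    simp only [id, one_mul] at h3
    rw [Nat.factorial_succ (m + 1)]
    push_cast at h3 ⊢
    have h4 : ((m : ℝ) + 1 + 1) ≠ 0 := by positivity
    -- Differentiating the induction hypothesis gives `g_{m+1}` once from the factor `x` and `m + 1`
    -- times from the derivative of `g_m`, so `m + 2` can be factored out.
    have h5 : ((m : ℝ) + 1 + 1) * (x * expSlope t (m + 1 + 1) x + expSlope t (m + 1) x) =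
        ((m + 1).factorial : ℝ)⁻¹ * t ^ (m + 1) * (t * Real.exp (t * x)) := by
      rw [← h3]; ring
    rw [mul_inv, pow_succ, ← mul_right_inj' h4, h5]
    field_simp

/-- The coefficient of `η^m` in the exponential series of `t(a + η)`. -/
theorem hasSum_choose_mul_pow (t a : ℝ) (m : ℕ) :
    HasSum (fun j : ℕ => (j.factorial : ℝ)⁻¹ * (t ^ j * (j.choose m) * a ^ (j - m)))
      ((m.factorial : ℝ)⁻¹ * t ^ m * Real.exp (t * a)) := by
  -- The terms with `j < m` vanish through the binomial coefficient, so the truncated exponent `j -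
  -- m` does no harm.
  rw [← hasSum_nat_add_iff' m]
  have h0 : ∑ j ∈ Finset.range m,
      (j.factorial : ℝ)⁻¹ * (t ^ j * (j.choose m) * a ^ (j - m)) = 0 :=
    Finset.sum_eq_zero fun j hj => by
      rw [Nat.choose_eq_zero_of_lt (Finset.mem_range.1 hj)]; simp
  rw [h0, sub_zero]
  have h1 := (NormedSpace.expSeries_div_hasSum_exp (t * a)).mul_left ((m.factorial : ℝ)⁻¹ * t ^ m)
  rw [← Real.exp_eq_exp_ℝ] at h1
  refine h1.congr_fun fun i => ?_
  have h2 := Nat.add_choose_mul_factorial_mul_factorial i m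
  have h3 : ((i + m).choose m : ℝ) * i.factorial * m.factorial = (i + m).factorial := by
    exact_mod_cast h2
  have h4 : ((i + m).factorial : ℝ) ≠ 0 := by positivity
  have h5 : (i.factorial : ℝ) ≠ 0 := by positivity
  have h6 : (m.factorial : ℝ) ≠ 0 := by positivity
  rw [Nat.add_sub_cancel, mul_pow, pow_add]
  field_simp
  rw [← h3]
  ring

end DividedDifference

end EquivForms

namespace EquivForms

/-! ### Functional calculus of `f + α` for nilpotent `α`. -/

section Polynomials

variable {E : Type*} [NormedAddCommGroup E] [NormedSpace ℝ E] {X : Type*}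

theorem ofFun_add_wedgeForm (f : X → ℝ) (α β : InhomForm E X) :
    wedgeForm (ofFun f + α) β = funMul f β + wedgeForm α β := by
  rw [wedgeForm_add_left, wedgeForm_ofFun]

/-- The polynomial `∑_{m ≤ N} a_m α^m` in an inhomogeneous form, with functions as coefficients. -/
def polyForm (α : InhomForm E X) (N : ℕ) (a : ℕ → X → ℝ) : InhomForm E X :=
  ∑ m ∈ Finset.range (N + 1), funMul (a m) (wedgePow α m)

theorem polyForm_apply (α : InhomForm E X) (N : ℕ) (a : ℕ → X → ℝ) (k : ℕ) (x : X) :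
    polyForm α N a k x = ∑ m ∈ Finset.range (N + 1), a m x • wedgePow α m k x := by
  rw [polyForm, Finset.sum_apply, Finset.sum_apply]
  rfl

/-- The coefficients of the product of a polynomial by `f + α`. -/
def shiftCoeff (f : X → ℝ) (a : ℕ → X → ℝ) : ℕ → X → ℝ
  | 0 => fun x => f x * a 0 x
  | m + 1 => fun x => f x * a (m + 1) x + a m x

/-- Multiplication by `α` shifts the coefficients by one; the only term to leave the range is the
multiple of `α^(N+1)`, which is zero. -/
theorem ofFun_add_wedgeForm_polyForm {f : X → ℝ} {α : InhomForm E X} {N : ℕ} (a : ℕ → X → ℝ)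
    (hN : wedgePow α (N + 1) = 0) :
    wedgeForm (ofFun f + α) (polyForm α N a) = polyForm α N (shiftCoeff f a) := by
  have h1 : wedgeForm α (polyForm α N a) =
      ∑ m ∈ Finset.range (N + 1), funMul (a m) (wedgePow α (m + 1)) := by
    rw [polyForm, wedgeForm_sum_right]
    exact Finset.sum_congr rfl fun m _ => wedgeForm_funMul_right _ _ _
  have h2 : ∀ k x, wedgePow α (N + 1) k x = 0 := fun k x => by rw [hN]; rfl
  rw [ofFun_add_wedgeForm, h1]
  ext1 k; ext1 x
  rw [Pi.add_apply, Pi.add_apply, funMul, polyForm_apply, polyForm_apply, Finset.sum_apply,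
    Finset.sum_apply, Finset.sum_range_succ (n := N) (f := fun m => funMul _ _ k x),
    Finset.sum_range_succ' (n := N), Finset.sum_range_succ' (n := N)]
  simp only [funMul, h2, smul_zero, add_zero, shiftCoeff, add_smul, Finset.sum_add_distrib,
    smul_add, Finset.smul_sum, mul_smul]
  abel

theorem wedgePow_smul_ofFun_add (f : X → ℝ) {α : InhomForm E X} {N : ℕ}
    (hN : wedgePow α (N + 1) = 0) (t : ℝ) (j : ℕ) :
    wedgePow (t • (ofFun f + α)) j =
      polyForm α N fun m x => t ^ j * (j.choose m) * f x ^ (j - m) := by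
  induction j with
  | zero =>
    ext1 k; ext1 x
    rw [polyForm_apply, Finset.sum_range_succ', Finset.sum_eq_zero]
    · simp [wedgePow]
    · intro m _
      simp
  | succ j ih =>
    rw [wedgePow, ih, wedgeForm_smul_left, ofFun_add_wedgeForm_polyForm _ hN]
    ext1 k; ext1 x
    rw [Pi.smul_apply, Pi.smul_apply, polyForm_apply, polyForm_apply, Finset.smul_sum]
    refine Finset.sum_congr rfl fun m _ => ?_
    rw [smul_smul]
    congr 1
    rcases m with _ | m
    · simp only [shiftCoeff, Nat.choose_zero_right, Nat.sub_zero]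
      ring
    · simp only [shiftCoeff, Nat.choose_succ_succ, Nat.add_sub_add_right]
      -- For `j < m + 1` the coefficient with truncated exponent `j - (m + 1)` is multiplied by a
      -- zero binomial coefficient.
      rcases lt_or_ge j (m + 1) with h | h
      · rw [Nat.choose_eq_zero_of_lt h]
        push_cast
        ring
      · obtain ⟨i, rfl⟩ := Nat.exists_eq_add_of_le h
        have h1 : m + 1 + i - (m + 1) = i := by omega
        have h2 : m + 1 + i - m = i + 1 := by omega
        rw [h1, h2]
        push_cast
        ring

/-- Taylor's formula at `f`, exact because `α` is nilpotent. Binomial expansion of each power leaves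
one scalar exponential series per power of `α`. -/
theorem expForm_smul_ofFun_add (f : X → ℝ) {α : InhomForm E X} {N : ℕ}
    (hN : wedgePow α (N + 1) = 0) (t : ℝ) :
    expForm (t • (ofFun f + α)) =
      polyForm α N fun m x => (m.factorial : ℝ)⁻¹ * t ^ m * Real.exp (t * f x) := by
  ext1 k; ext1 x
  rw [expForm, polyForm_apply]
  refine HasSum.tsum_eq ?_
  simp only [wedgePow_smul_ofFun_add f hN, polyForm_apply, Finset.smul_sum, smul_smul]
  exact hasSum_sum fun m _ => (hasSum_choose_mul_pow t (f x) m).smul_const _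

/-- The exponential minus `1` is a multiple of the exponent. -/
theorem expForm_smul_ofFun_add_eq (f : X → ℝ) {α : InhomForm E X} {N : ℕ}
    (hN : wedgePow α (N + 1) = 0) (t : ℝ) :
    expForm (t • (ofFun f + α)) = oneForm +
      wedgeForm (ofFun f + α) (polyForm α N fun m x => expSlope t m (f x)) := by
  rw [expForm_smul_ofFun_add f hN, ofFun_add_wedgeForm_polyForm _ hN]
  ext1 k; ext1 x
  rw [Pi.add_apply, Pi.add_apply, polyForm_apply, polyForm_apply, Finset.sum_range_succ',
    Finset.sum_range_succ']
  simp only [shiftCoeff, mul_expSlope_zero, mul_expSlope_succ, wedgePow,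
    Nat.factorial_zero, Nat.cast_one, inv_one, pow_zero, one_mul]
  have key : ∀ (A B : E [⋀^Fin k]→L[ℝ] ℝ) (e : ℝ), A + e • B = B + (A + (e - 1) • B) :=
    fun A B e => by ext v; simp; ring
  exact key _ _ _

theorem interiorProd_polyForm {v : X → E} {η : DForm E X 2}
    (h : interiorProd v (ofDegree η) = 0) (N : ℕ) (a : ℕ → X → ℝ) :
    interiorProd v (polyForm (ofDegree η) N a) = 0 := by
  rw [polyForm, interiorProd_sum]
  refine Finset.sum_eq_zero fun m _ => ?_
  rw [interiorProd_funMul, interiorProd_wedgePow_eq_zero h]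
  ext1 k; ext1 x
  exact smul_zero _

/-- A form of top degree that is annihilated by `ι_v`, where `v` vanishes nowhere, is zero. -/
theorem apply_finrank_eq_zero_of_interiorProd [FiniteDimensional ℝ E] {v : X → E}
    {K : DForm E X 1} (hK : interiorProd v (ofDegree K) = oneForm) {β : InhomForm E X}
    (hβ : interiorProd v β = 0) : β (Module.finrank ℝ E) = 0 := by
  -- `β` is itself an interior product, so its top component comes from a form of degree above the
  -- dimension.
  have h : interiorProd v (wedgeForm (ofDegree K) β) = β := by
    rw [interiorProd_wedgeForm, hK, hβ, oneForm_wedgeForm, wedgeForm_zero_right, add_zero]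
  rw [← h]
  ext1 x
  rw [interiorProd, form_eq_zero_of_finrank_lt (Nat.lt_succ_self _)
    (wedgeForm (ofDegree K) β (Module.finrank ℝ E + 1) x)]
  ext
  simp

end Polynomials

end EquivForms

namespace EquivForms

/-! ### The localization argument. -/

section Localization

variable {E : Type*} [NormedAddCommGroup E] [NormedSpace ℝ E]
  {H : Type*} [TopologicalSpace H] {I : ModelWithCorners ℝ E H}
  {X : Type*} [TopologicalSpace X] [ChartedSpace H X]
  [I.Boundaryless] [IsManifold I ∞ X]

theorem IsSmoothFun.comp {f : X → ℝ} (hf : IsSmoothFun I f) {h : ℝ → ℝ} (hh : ContDiff ℝ ∞ h) :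
    IsSmoothFun I (fun x => h (f x)) :=
  fun x₀ y hy => hh.contDiffAt.comp y (hf x₀ y hy)

theorem IsSmoothForm.polyForm {α : InhomForm E X} (hα : IsSmoothForm I α) {a : ℕ → X → ℝ}
    (ha : ∀ m, IsSmoothFun I (a m)) (N : ℕ) : IsSmoothForm I (polyForm α N a) :=
  IsSmoothForm.sum fun m _ => (hα.wedgePow m).funMul (ha m)

/-- The chain rule for the exterior derivative of a function. -/
theorem extDForm_ofFun_comp {f : X → ℝ} (hf : IsSmoothFun I f) {h : ℝ → ℝ} {h' : ℝ → ℝ}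
    (hh : ContDiff ℝ ∞ h) (hh' : ∀ x, HasDerivAt h (h' x) x) :
    extDForm I (ofFun fun x => h (f x) : InhomForm E X) =
      funMul (fun x => h' (f x)) (extDForm I (ofFun f)) := by
  have key : extD I (fun x => ContinuousAlternatingMap.constOfIsEmpty ℝ E (Fin 0) (h (f x))) =
      fun x => h' (f x) •
        extD I (fun x => ContinuousAlternatingMap.constOfIsEmpty ℝ E (Fin 0) (f x)) x := by
    refine form_ext_inChart (I := I) fun x₀ y hy => ?_
    have hs : ∀ {g : X → ℝ}, IsSmoothFun I g → IsSmooth I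
        (fun x => ContinuousAlternatingMap.constOfIsEmpty ℝ E (Fin 0) (g x)) := fun hg => by
      have := isSmoothForm_ofFun hg 0
      rwa [ofFun, ofDegree_apply_self] at this
    rw [inChart_extD (hs (hf.comp hh)) hy, inChart_smul, inChart_extD (hs hf) hy,
      inChart_constOfIsEmpty, inChart_constOfIsEmpty, extDeriv_constOfIsEmpty,
      extDeriv_constOfIsEmpty]
    have h1 : HasFDerivAt (f ∘ (extChartAt I x₀).symm)
        (fderiv ℝ (f ∘ (extChartAt I x₀).symm) y) y :=
      ((hf x₀ y hy).differentiableAt (by simp)).hasFDerivAt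
    have h2 := (hh' (f ((extChartAt I x₀).symm y))).comp_hasFDerivAt
      (f := f ∘ (extChartAt I x₀).symm) y h1
    have h3 : fderiv ℝ (fun y => h (f ((extChartAt I x₀).symm y))) y =
      h' (f ((extChartAt I x₀).symm y)) •
        fderiv ℝ (fun y => f ((extChartAt I x₀).symm y)) y := h2.fderiv
    rw [h3]
    rfl
  rw [ofFun, ofFun, extDForm_ofDegree, extDForm_ofDegree, key]
  ext1 k
  by_cases hk : k = 1
  · subst hk
    ext1 x
    rw [funMul, ofDegree_apply_self, ofDegree_apply_self]
  · ext1 x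
    rw [funMul, ofDegree_apply_ne _ hk, ofDegree_apply_ne _ hk]
    exact (smul_zero _).symm

theorem extDForm_wedgePow {η : DForm E X 2} (hη : IsSmooth I η) (hd : extD I η = 0) (m : ℕ) :
    extDForm I (wedgePow (ofDegree η) m) = 0 := by
  induction m with
  | zero =>
    have h1 := extDForm_ofFun_comp (I := I) (X := X) (isSmoothFun_const 0)
      (contDiff_const (c := (1 : ℝ))) (fun x => hasDerivAt_const x (1 : ℝ))
    refine h1.trans ?_
    ext1 k; ext1 x
    exact zero_smul ℝ _
  | succ m ih =>
    have h1 := isSmoothForm_ofDegree hη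
    have h2 : (ofDegree (0 : DForm E X 3)) = 0 := Pi.single_zero _
    rw [wedgePow, extDForm_wedgeForm h1 (h1.wedgePow m), ih, extDForm_ofDegree, hd, h2,
      wedgeForm_zero_left, wedgeForm_zero_right, add_zero]

/-- If `f + η` is equivariantly closed, then so are the polynomials in `η` whose coefficients are
the divided Taylor coefficients of a function of `f`. -/
theorem equivD_polyForm {w : X → E} {f : X → ℝ} (hf : IsSmoothFun I f) {η : DForm E X 2}
    (hη : IsSmooth I η) (hd : extD I η = 0)
    (hdf : extDForm I (ofFun f) = interiorProd w (ofDegree η)) {N : ℕ}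
    (hN : wedgePow (ofDegree η) N = 0) {h : ℕ → ℝ → ℝ} (hh : ∀ m, ContDiff ℝ ∞ (h m))
    (hh' : ∀ m x, HasDerivAt (h m) (((m : ℝ) + 1) * h (m + 1) x) x) :
    equivD I w (polyForm (ofDegree η) N fun m x => h m (f x)) = 0 := by
  have hs := isSmoothForm_ofDegree hη
  set δ := interiorProd w (ofDegree η) with hδ
  have hpow : ∀ m, equivD I w (wedgePow (ofDegree η) m) =
      -interiorProd w (wedgePow (ofDegree η) m) := fun m => by
    rw [equivD, extDForm_wedgePow hη hd, zero_sub]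
  have hterm : ∀ m, equivD I w (funMul (fun x => h m (f x)) (wedgePow (ofDegree η) m)) =
      funMul (fun x => ((m : ℝ) + 1) * h (m + 1) (f x))
        (wedgeForm δ (wedgePow (ofDegree η) m)) -
      funMul (fun x => h m (f x)) (interiorProd w (wedgePow (ofDegree η) m)) := fun m => by
    have h1 : equivD I w (ofFun fun x => h m (f x)) =
        funMul (fun x => ((m : ℝ) + 1) * h (m + 1) (f x)) δ := by
      rw [equivD, extDForm_ofFun_comp hf (hh m) (hh' m), hdf, ofFun, interiorProd_ofDegree_zero,
        sub_zero]
    rw [← wedgeForm_ofFun, equivD_wedgeForm w (isSmoothForm_ofFun (hf.comp (hh m)))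
      (hs.wedgePow m), h1, wedgeForm_funMul_left, hpow, ofFun,
      gradeInv_ofDegree_of_even Even.zero, wedgeForm_neg_right, sub_eq_add_neg]
    congr 2
    exact wedgeForm_ofFun _ _
  rw [polyForm, equivD_sum w fun m _ => (hs.wedgePow m).funMul (hf.comp (hh m))]
  simp only [hterm]
  -- The sums telescope because `(m + 1) ι_w η ∧ η^m = ι_w η^(m+1)`: drop the last term of the first
  -- sum, where `η^N = 0`, and the first term of the second, where `ι_w 1 = 0`.
  rw [Finset.sum_sub_distrib, Finset.sum_range_succ, hN, wedgeForm_zero_right,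
    Finset.sum_range_succ' (fun m => funMul (fun x => h m (f x)) _)]
  have h0 : interiorProd w (wedgePow (ofDegree η) 0) = 0 := interiorProd_ofDegree_zero w _
  have hz : ∀ a : X → ℝ, funMul a (0 : InhomForm E X) = 0 := fun a => by
    ext1 k; ext1 x
    exact smul_zero _
  rw [h0, hz, hz, add_zero, add_zero, sub_eq_zero]
  refine Finset.sum_congr rfl fun m _ => ?_
  rw [interiorProd_wedgePow]
  ext1 k; ext1 x
  simp only [funMul, Pi.smul_apply, smul_smul]
  rw [mul_comm]

variable [FiniteDimensional ℝ E] [MeasurableSpace E] [BorelSpace E] [T2Space X] [CompactSpace X]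

theorem integral_eq_zero_of_apply_eq_zero (μ : DForm E X (Module.finrank ℝ E)) {β : InhomForm E X}
    (hβ : β (Module.finrank ℝ E) = 0) : integral I μ β = 0 := by
  have h : ∀ i, inChart I i (0 : DForm E X (Module.finrank ℝ E)) = 0 := fun i => rfl
  rw [integral]
  simp [hβ, h]

/-- Localization: the integral of `K ∧ α` does not change when `α` is multiplied by `e^{-s D V}`. -/
theorem integral_wedgeForm_expForm {μ : DForm E X (Module.finrank ℝ E)} (hμ : IsVolumeForm I μ)
    {u w : X → E} (hw : IsSmoothField I w) {K : DForm E X 1} (hK : IsSmooth I K)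
    (hdK : extDForm I (ofDegree K) = 0) (huK : interiorProd u (ofDegree K) = oneForm)
    (hwK : interiorProd w (ofDegree K) = oneForm) {α : InhomForm E X} (hα : IsSmoothForm I α)
    (hDα : equivD I w α = 0) (huα : interiorProd u α = 0) {V : DForm E X 1} (hV : IsSmooth I V)
    (hCartan : extD I (fun x => (V x).curryLeft (w x)) +
      (fun x => (extD I V x).curryLeft (w x)) = 0)
    (huV : interiorProd u (ofDegree V) = 0)
    (huDV : interiorProd u (equivD I w (ofDegree V)) = 0) (s : ℝ) :
    integral I μ (wedgeForm (ofDegree K) α) =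
      integral I μ (wedgeForm (wedgeForm (ofDegree K) α)
        (expForm ((-s) • equivD I w (ofDegree V)))) := by
  set f : X → ℝ := fun x => -(V x ![w x]) with hf
  set η := extD I V with hη
  have hηs : IsSmooth I η := hV.extD
  have hVw : ofFun f = -ofDegree fun x => (V x).curryLeft (w x) := by
    ext1 k
    by_cases hk : k = 0
    · subst hk
      ext x v
      rw [ofFun, ofDegree_apply_self, Pi.neg_apply, ofDegree_apply_self, Pi.neg_apply,
        ContinuousAlternatingMap.neg_apply, ContinuousAlternatingMap.curryLeft_apply_apply,
        ContinuousAlternatingMap.constOfIsEmpty_apply, hf, Subsingleton.elim v ![]]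
    · rw [ofFun, Pi.neg_apply, ofDegree_apply_ne _ hk, ofDegree_apply_ne _ hk, neg_zero]
  have hc : equivD I w (ofDegree V) = ofFun f + ofDegree η := by
    rw [equivD, extDForm_ofDegree, interiorProd_ofDegree_succ, hVw]
    abel
  have hfs : IsSmoothFun I f := fun x₀ y hy => by
    have h1 := (((hV.curryLeft hw).neg).contDiffAt hy)
    have h2 := (ContinuousAlternatingMap.apply ℝ E ℝ (![] : Fin 0 → E)).contDiff (n := ∞)
    have h3 : f ∘ (extChartAt I x₀).symm = ContinuousAlternatingMap.apply ℝ E ℝ ![] ∘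
        inChart I x₀ (-fun x => (V x).curryLeft (w x)) := by
      funext z
      change -(V _ (Matrix.vecCons (w _) _)) = -(V _ (Matrix.vecCons (w _) _))
      congr 3
      exact Subsingleton.elim _ _
    rw [h3]
    exact h2.contDiffAt.comp y h1
  -- With `f = -ι_w V`, this is exactly Cartan's formula for the invariant form `V`.
  have hdf : extDForm I (ofFun f) = interiorProd w (ofDegree η) := by
    set Z : DForm E X 0 := fun x => (V x).curryLeft (w x)
    have h1 : extDForm I (ofFun f) + extDForm I (ofDegree Z) = 0 := by
      rw [← extDForm_add (isSmoothForm_ofFun hfs) (isSmoothForm_ofDegree (hV.curryLeft hw)), hVw,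
        neg_add_cancel, extDForm_zero]
    have h2 : interiorProd w (ofDegree η) + extDForm I (ofDegree Z) = 0 := by
      rw [interiorProd_ofDegree_succ, extDForm_ofDegree, add_comm, ofDegree, ofDegree,
        ← Pi.single_add, hCartan, Pi.single_zero]
    exact add_right_cancel (h1.trans h2.symm)
  -- The function part of `DV` is killed by `ι_u` for degree reasons, so `ι_u DV = 0` is a condition
  -- on `dV` alone.
  have huη : interiorProd u (ofDegree η) = 0 := by
    rw [hc, interiorProd_add, ofFun, interiorProd_ofDegree_zero, zero_add] at huDV
    exact huDV
  -- Large enough for both uses: `η^N = 0` closes the telescoping sum for `DP`, and `η^(N+1) = 0`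
  -- makes multiplication by `DV` exact on polynomials.
  set N := Module.finrank ℝ E + 1 with hN
  have hN0 : wedgePow (ofDegree η) N = 0 := wedgePow_ofDegree_two_eq_zero η (by omega)
  have hN1 : wedgePow (ofDegree η) (N + 1) = 0 := wedgePow_ofDegree_two_eq_zero η (by omega)
  set P := polyForm (ofDegree η) N fun m x => expSlope (-s) m (f x) with hP
  have hPs : IsSmoothForm I P :=
    (isSmoothForm_ofDegree hηs).polyForm (fun m => hfs.comp (contDiff_expSlope _ m)) N
  have hDP : equivD I w P = 0 :=
    equivD_polyForm hfs hηs (extD_extD hV) hdf hN0 (contDiff_expSlope _) (hasDerivAt_expSlope _)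
  have huP : interiorProd u P = 0 := interiorProd_polyForm huη _ _
  have hexp : expForm ((-s) • equivD I w (ofDegree V)) =
      oneForm + wedgeForm (equivD I w (ofDegree V)) P := by
    rw [hc, expForm_smul_ofFun_add_eq f hN1]
  set c := equivD I w (ofDegree V) with hcdef
  have hKs := isSmoothForm_ofDegree hK
  have hVs := isSmoothForm_ofDegree hV
  have hcs : IsSmoothForm I c := hVs.equivD hw
  set B := wedgeForm (ofDegree V) P with hB
  have hBs : IsSmoothForm I B := hVs.wedgeForm hPs
  have hDB : equivD I w B = wedgeForm c P := by
    rw [hB, equivD_wedgeForm w hVs hPs, hDP, wedgeForm_zero_right, add_zero]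
  have huB : interiorProd u B = 0 := by
    rw [hB, interiorProd_wedgeForm, huV, huP, wedgeForm_zero_left, wedgeForm_zero_right, add_zero]
  -- The grading involution compensates the sign of the antiderivation rule, so that `DC = α ∧ DV ∧
  -- P` without a sign.
  set C := wedgeForm (gradeInv α) B with hC
  have hCs : IsSmoothForm I C := hα.gradeInv.wedgeForm hBs
  have hg0 : gradeInv (0 : InhomForm E X) = 0 := by
    ext1 k; ext1 x
    exact smul_zero _
  have hDC : equivD I w C = wedgeForm α (wedgeForm c P) := by
    rw [hC, equivD_wedgeForm w hα.gradeInv hBs, equivD_gradeInv w hα, hDα, hg0, neg_zero,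
      wedgeForm_zero_left, zero_add, gradeInv_gradeInv, hDB]
  have huC : interiorProd u C = 0 := by
    rw [hC, interiorProd_wedgeForm, interiorProd_gradeInv, huα, huB, hg0, neg_zero,
      wedgeForm_zero_left, wedgeForm_zero_right, add_zero]
  have hDK : equivD I w (ofDegree K) = -oneForm := by rw [equivD, hdK, hwK, zero_sub]
  have hgK : gradeInv (ofDegree K) = -ofDegree K := by
    rw [gradeInv_ofDegree, pow_one]
    ext1 k; ext1 x
    exact neg_one_smul_form _
  have hDT : equivD I w (wedgeForm (ofDegree K) C) =
      -C - wedgeForm (ofDegree K) (wedgeForm α (wedgeForm c P)) := by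
    rw [equivD_wedgeForm w hKs hCs, hDK, hgK, hDC, wedgeForm_neg_left, wedgeForm_neg_left,
      oneForm_wedgeForm, sub_eq_add_neg]
  -- In top degree `C` vanishes because `ι_u C = 0`, and `ι_w (K ∧ C)` vanishes because it comes
  -- from a degree above the dimension. What remains of the formula for `D(K ∧ C)` says that `K ∧ α
  -- ∧ DV ∧ P` is minus an exact form.
  have htop : (extDForm I (wedgeForm (ofDegree K) C) +
      wedgeForm (ofDegree K) (wedgeForm α (wedgeForm c P))) (Module.finrank ℝ E) = 0 := by
    have h1 : C (Module.finrank ℝ E) = 0 := apply_finrank_eq_zero_of_interiorProd huK huC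
    have h2 : interiorProd w (wedgeForm (ofDegree K) C) (Module.finrank ℝ E) = 0 := by
      ext x v
      rw [interiorProd, form_eq_zero_of_finrank_lt (Nat.lt_succ_self _)
        (wedgeForm (ofDegree K) C (Module.finrank ℝ E + 1) x)]
      rfl
    have h3 := congrFun hDT (Module.finrank ℝ E)
    rw [equivD, Pi.sub_apply, h2, Pi.sub_apply, Pi.neg_apply, h1, neg_zero, sub_zero,
      zero_sub] at h3
    rw [Pi.add_apply, h3, neg_add_cancel]
  have hTs := hKs.wedgeForm hCs
  have hRs := hKs.wedgeForm (hα.wedgeForm (hcs.wedgeForm hPs))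
  have hzero : integral I μ (wedgeForm (ofDegree K) (wedgeForm α (wedgeForm c P))) = 0 := by
    have h1 := integral_eq_zero_of_apply_eq_zero (I := I) μ htop
    rwa [integral_add hμ hTs.extDForm hRs, integral_extDForm_eq_zero hμ hTs, zero_add] at h1
  rw [hexp, wedgeForm_add_right, wedgeForm_oneForm, wedgeForm_assoc,
    integral_add hμ (hKs.wedgeForm hα) hRs, hzero, add_zero]

end Localization

end EquivForms

end

theorem lemma2p1 (n : ℕ)
    -- `M` is a compact orientable manifold of dimension `n` with a smooth circle action
    {M : Type*} [TopologicalSpace M] [T2Space M] [CompactSpace M]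
    [ChartedSpace (EuclideanSpace ℝ (Fin n)) M] [IsManifold (𝓡 n) ∞ M]
    (hM : EquivForms.IsOrientable (𝓡 n) M)
    [MulAction Circle M]
    (hact : ContMDiff ((𝓡 1).prod (𝓡 n)) (𝓡 n) ∞ (fun q : Circle × M => q.1 • q.2))
    -- an orientation of `N = M × S¹`, given by a volume form
    (μ : EquivForms.DForm (EquivForms.ProdSpace n) (M × Circle)
      (Module.finrank ℝ (EquivForms.ProdSpace n)))
    (hμ : EquivForms.IsVolumeForm (EquivForms.prodModel n) μ)
    -- `α` is a smooth equivariantly closed form on `N` which does not contain `dφ`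
    (α : EquivForms.InhomForm (EquivForms.ProdSpace n) (M × Circle))
    (hα : ∀ k, EquivForms.IsSmooth (EquivForms.prodModel n) (α k))
    (hDα : EquivForms.equivD (EquivForms.prodModel n) (EquivForms.diagField n M) α = 0)
    (huα : EquivForms.interiorProd (EquivForms.angleField n M) α = 0)
    -- `V` is a smooth invariant `1`-form on `N` with `ι_u V = 0` and `ι_u DV = 0`
    (V : EquivForms.DForm (EquivForms.ProdSpace n) (M × Circle) 1)
    (hV : EquivForms.IsSmooth (EquivForms.prodModel n) V)
    (hVinv : EquivForms.IsInvariant (EquivForms.prodModel n) V)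
    (huV : EquivForms.interiorProd (EquivForms.angleField n M) (EquivForms.ofDegree V) = 0)
    (huDV : EquivForms.interiorProd (EquivForms.angleField n M)
      (EquivForms.equivD (EquivForms.prodModel n) (EquivForms.diagField n M)
        (EquivForms.ofDegree V)) = 0)
    (s : ℝ) :
    EquivForms.integral (EquivForms.prodModel n) μ
        (EquivForms.wedgeForm (EquivForms.ofDegree (EquivForms.dAngle n M)) α) =
      EquivForms.integral (EquivForms.prodModel n) μ
        (EquivForms.wedgeForm
          (EquivForms.wedgeForm (EquivForms.ofDegree (EquivForms.dAngle n M)) α)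
          (EquivForms.expForm ((-s) •
            EquivForms.equivD (EquivForms.prodModel n) (EquivForms.diagField n M)
              (EquivForms.ofDegree V)))) :=
  -- The general statement with `K = dφ`. Invariance of `V` enters only through Cartan's formula.
  EquivForms.integral_wedgeForm_expForm hμ (EquivForms.isSmoothField_diagField hact)
    EquivForms.isLocallyExact_dAngle.isSmooth EquivForms.extDForm_dAngle
    EquivForms.interiorProd_angleField_dAngle (EquivForms.interiorProd_diagField_dAngle hact)
    hα hDα huα hV
    (EquivForms.extD_curryLeft_add_curryLeft_extD (EquivForms.contMDiff_diag_smul hact) hV hVinv)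
    huV huDV s
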